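/- **Setting.** Let $k\ge 1$, $0<x_1<\dots<x_k<1$ and $0\le q_0<q_1<\dots<q_k\le 1$ (the standard normalisation is $q_0=0$). For $x\in(0,1)$ let REM$_x$ be the Poisson point process on $(0,\infty)$ with intensity $-d(\xi^{-x})=x\,\xi^{-x-1}d\xi$. For every $n\le k$ and every address $(\alpha_1,\dots,\alpha_{n-1})\in\mathbb N^{n-1}$ let $\{\xi^{(n)}_{\alpha_n;\alpha_1,\dots,\alpha_{n-1}}\}_{\alpha_n\in\mathbb N}$ be a (measurable) labelling of the points of a REM$_{x_n}$, all these processes being independent. For $\underline\alpha=(\alpha_1,\dots,\alpha_k)\in\mathbb N^k$ put $$\xi_{\underline\alpha}=\prod_{n=1}^k\xi^{(n)}_{\alpha_n;\alpha_1,\dots,\alpha_{n-1}},\qquad q_{\underline\alpha,\underline\alpha'}=q_{n(\underline\alpha,\underline\alpha')},\quad n(\underline\alpha,\underline\alpha')=\max\{j\le k:(\alpha_1,\dots,\alpha_j)=(\alpha'_1,\dots,\alpha'_j)\}.$$ Let $\eta=(\eta_{\underline\alpha})$ be a centered Gaussian process, independent of all the points $\xi^{(n)}$, with $\mathbb E(\eta_{\underline\alpha}\eta_{\underline\alpha'})=q_{\underline\alpha,\underline\alpha'}$,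 let $\psi:\mathbb R\to\mathbb R$ be Lipschitz, and put $$\widetilde\xi_{\underline\alpha}=e^{\psi(\eta_{\underline\alpha})}\xi_{\underline\alpha},\qquad Z=\sum_{\underline\alpha}\xi_{\underline\alpha},\qquad \widetilde Z=\sum_{\underline\alpha}\widetilde\xi_{\underline\alpha}.$$ Define $\psi_k=\psi$ and, for $j=k,k-1,\dots,1$, with $z$ a standard normal variable, $$\psi_{j-1}(y)=\frac1{x_j}\ln\mathbb E_z\Big(e^{x_j\,\psi_j(y+\sqrt{q_j-q_{j-1}}\,z)}\Big).$$ Write $\{w_{\underline\alpha}\}\stackrel{\mathcal D}{=}\{w'_{\underline\alpha}\}$ if the weights listed in descending order, jointly with the correspondingly ordered overlap matrix, have the same law for $w$ as for $w'$. **Theorem 4.4.** All the expectations in the definition of the $\psi_j$ are finite. Almost surely the $\xi_{\underline\alpha}$ are positive, distinct and summable, and so are the $\widetilde\xi_{\underline\alpha}$ (so both can be listed in descending order, and $0<Z,\widetilde Z<\infty$). Moreover: 1. If $q_0=0$, then with the deterministic number $\bar\psi_0:=\psi_0(0)$, $$\{\widetilde\xi_{\underline\alpha}\}\stackrel{\mathcal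 D}{=}\{e^{\bar\psi_0}\xi_{\underline\alpha}\},\qquad \widetilde Z\stackrel{\mathcal D}{=}e^{\bar\psi_0}Z.$$ 2. For every $q_0\ge 0$, $\{\widetilde\xi_{\underline\alpha}\}\stackrel{\mathcal D}{=}\{e^{\psi_0(\sqrt{q_0}\,g)}\,\xi_{\underline\alpha}\}$, where $g$ is a standard normal variable independent of $\xi$. 3. For every $q_0\ge0$ the relative weights are quasi-stationary: $\{\widetilde\xi_{\underline\alpha}/\widetilde Z\}\stackrel{\mathcal D}{=}\{\xi_{\underline\alpha}/Z\}$. -/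

import Mathlib

open MeasureTheory ProbabilityTheory
open scoped NNReal ENNReal

namespace RPC

/-- The intensity measure `ρ_x(dξ) = -d(ξ^{-x}) = x ξ^{-x-1} dξ` on `(0, ∞)`. -/
noncomputable def remIntensity (x : ℝ) : Measure ℝ :=
  (volume.restrict (Set.Ioi 0)).withDensity fun t => ENNReal.ofReal (x * t ^ (-x - 1))

/-- The number of points of the family `X` that lie in `A` (counted with multiplicity). -/
noncomputable def occupation {Ω : Type*} (X : ℕ → Ω → ℝ) (A : Set ℝ) (ω : Ω) : ℕ∞ :=
  {m | X m ω ∈ A}.encard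

/-- `X 0, X 1, …` is a measurable labelling (in no particular order) of the points of a Poisson
point process with intensity `ρ_x`: occupation numbers of disjoint Borel sets are independent, and
the occupation number of a set of finite intensity has the Poisson law. -/
structure IsREM {Ω : Type*} [MeasurableSpace Ω] (x : ℝ) (X : ℕ → Ω → ℝ) (μ : Measure Ω) :
    Prop where
  measurable : ∀ m, Measurable (X m)
  indep : ∀ (r : ℕ) (A : Fin r → Set ℝ), (∀ i, MeasurableSet (A i)) →
    (∀ i j, i ≠ j → Disjoint (A i) (A j)) → iIndepFun (fun i => occupation X (A i)) μ
  law : ∀ A : Set ℝ, MeasurableSet A → remIntensity x A ≠ ⊤ → ∀ n : ℕ,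
    μ {ω | occupation X A ω = n} =
      ENNReal.ofReal (Real.exp (-(remIntensity x A).toReal) *
        (remIntensity x A).toReal ^ n / (Nat.factorial n : ℝ))

/-- The points of the cascade before multiplication. With `n : Fin k` counted from `0`,
`X n (α_1, …, α_n) m` is the point with label `m` of the `(n+1)`-st level process attached to the
address `(α_1, …, α_n)`. That process is a REM with parameter `x_{n+1}` (written `x n`), and the
processes of all levels and addresses are independent. -/
structure IsCascade {Ω : Type*} [MeasurableSpace Ω] {k : ℕ} (x : Fin k → ℝ)
    (X : (n : Fin k) → (Fin n → ℕ) → ℕ → Ω → ℝ) (μ : Measure Ω) : Prop where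
  rem : ∀ (n : Fin k) (a : Fin n → ℕ), IsREM (x n) (X n a) μ
  indep : iIndepFun (fun (p : Σ n : Fin k, (Fin n → ℕ)) (ω : Ω) (m : ℕ) => X p.1 p.2 m ω) μ

/-- The first `n` entries `(α_1, …, α_n)` of an address. -/
def prefixOf {k : ℕ} (α : Fin k → ℕ) (n : Fin k) : Fin n → ℕ :=
  fun i => α (Fin.castLE n.isLt.le i)

/-- The weight `ξ_α = ∏_n ξ^{(n)}_{α_n; α_1, …, α_{n-1}}`. -/
noncomputable def weight {Ω : Type*} {k : ℕ} (X : (n : Fin k) → (Fin n → ℕ) → ℕ → Ω → ℝ)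
    (α : Fin k → ℕ) (ω : Ω) : ℝ :=
  ∏ n : Fin k, X n (prefixOf α n) (α n) ω

/-- `n(α, β) = max {j ≤ k : (α_1, …, α_j) = (β_1, …, β_j)}`. -/
def commonLevel {k : ℕ} (α β : Fin k → ℕ) : Fin (k + 1) :=
  ⟨Nat.findGreatest (fun j => ∀ i : Fin k, (i : ℕ) < j → α i = β i) k,
    Nat.lt_succ_of_le (Nat.findGreatest_le k)⟩

/-- The overlap `q_{α, β} = q_{n(α, β)}`. -/
def overlap {k : ℕ} (q : Fin (k + 1) → ℝ) (α β : Fin k → ℕ) : ℝ :=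
  q (commonLevel α β)

/-- The Gaussian log-moment map `f ↦ (1/x) ln E_z exp (x f(· + √s z))`, `z` standard normal. -/
noncomputable def logMoment (x s : ℝ) (f : ℝ → ℝ) (y : ℝ) : ℝ :=
  (1 / x) * Real.log (∫ z, Real.exp (x * f (y + Real.sqrt s * z)) ∂(gaussianReal 0 1))

/-- The functions `ψ_k = ψ`, `ψ_{j-1} = (1/x_j) ln E_z exp (x_j ψ_j(· + √(q_j - q_{j-1}) z))`.
In the code `x j` is `x_{j+1}`, for `j : Fin k`. -/
noncomputable def psiLevel {k : ℕ} (x : Fin k → ℝ) (q : Fin (k + 1) → ℝ) (ψ : ℝ → ℝ)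
    (j : Fin (k + 1)) : ℝ → ℝ :=
  Fin.reverseInduction (motive := fun _ => ℝ → ℝ) ψ
    (fun i f => logMoment (x i) (q i.succ - q i.castSucc) f) j

/-- The index of the `(n+1)`-st largest of the numbers `w a`: an index `a` for which exactly `n`
of the numbers are larger (an arbitrary index if there is none). -/
noncomputable def rankIndex {A : Type*} [Nonempty A] (w : A → ℝ) (n : ℕ) : A :=
  Classical.epsilon fun a => {b | w a < w b}.encard = (n : ℕ∞)

/-- The configuration given by a family of weights and their overlaps: the weights listed in
descending order, with the correspondingly ordered overlap matrix. -/
noncomputable def config {k : ℕ} (q : Fin (k + 1) → ℝ) (w : (Fin k → ℕ) → ℝ) :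
    (ℕ → ℝ) × (ℕ → ℕ → ℝ) :=
  (fun n => w (rankIndex w n), fun n m => overlap q (rankIndex w n) (rankIndex w m))

/-- The weights are positive, distinct and summable; then they can be listed in descending order
and the partition function is positive and finite. -/
def WellOrdered {A : Type*} (w : A → ℝ) : Prop :=
  (∀ a, 0 < w a) ∧ Function.Injective w ∧ Summable w

end RPC

/-! The Gaussian field can be realised on the tree of addresses. Its covariance q_{n(α,α')} is that
of √q_0 g plus independent normal steps of variance q_j − q_{j-1} along each path, and a centred
Gaussian law is fixed by its covariance (`map_field_eq_map_rootField`). Thus every label at every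
node carries a Poisson point and an independent normal mark.

Suppose that below the root the perturbed subtrees can already be replaced by unperturbed ones,
multiplied by exp ψ_1(y + s z_m), where z_m is the mark of child m. These factors can be moved to
the root points. Divided by exp ψ_0(y), they are i.i.d. with moment of order x_1 equal to one: this
is the definition of ψ_0. The intensity x ξ^{-x-1} dξ is multiplied by a^x under scaling by a, so
the marked points are again a Poisson process with the same intensity (`IsREM.isPPP_mul`). Only the
factor exp ψ_0(y) remains, and induction on the depth concludes (`lintegral_perturbed_forest`). The
induction is over forests, because the subtrees have different starting values y + s z_m and have to
be replaced jointly.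

Marking destroys the labelling, so laws are compared only through functions invariant under
automorphisms of the tree (`SameTreeLaw`); the ordered weights with their overlaps are such
functions. At the root the points are sorted. Void probabilities determine the law of a simple point
process, hence of its sorted points (`IsPPP.map_sortSeq_eq`), and the replacing subtrees are i.i.d.,
so sorting the children changes nothing. The resulting reference law is `canonLaw`.

Order and summability are proved for `canonLaw` and then transferred. Weights are distinct because
the ratio of two Poisson points has no atoms. They are summable because the total mass has finite
moments of order s < x_1: one level costs a moment of order x_1 of the mass of the subtrees, which
is finite by induction since x_1 < x_2 < …. For the relative weights, the common random factor exp
ψ_0(√q_0 g) cancels. -/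

namespace RPC

/-! ### The intensity x t^{-x-1} dt: integrability of powers and scaling. -/

section Intensity

lemma measurable_remDensity (x : ℝ) :
    Measurable fun t : ℝ => ENNReal.ofReal (x * t ^ (-x - 1)) := by fun_prop

instance sFinite_remIntensity (x : ℝ) : SFinite (remIntensity x) := by
  unfold remIntensity; infer_instance

lemma lintegral_remIntensity (x : ℝ) {g : ℝ → ℝ≥0∞} (hg : Measurable g) :
    ∫⁻ t, g t ∂remIntensity x =
      ∫⁻ t in Set.Ioi 0, ENNReal.ofReal (x * t ^ (-x - 1)) * g t := by
  rw [remIntensity, lintegral_withDensity_eq_lintegral_mul _ (measurable_remDensity x) hg]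
  rfl

lemma remIntensity_Iic_zero (x : ℝ) : remIntensity x (Set.Iic 0) = 0 := by
  rw [remIntensity, withDensity_apply _ measurableSet_Iic, Measure.restrict_restrict
    measurableSet_Iic, Set.Iic_inter_Ioi]
  simp

lemma remIntensity_le {x δ : ℝ} (hx : 0 < x) (hδ : 0 < δ) {A : Set ℝ} (hA : MeasurableSet A)
    (hAδ : A ⊆ Set.Ici δ) :
    remIntensity x A ≤ ENNReal.ofReal (x * δ ^ (-x - 1)) * volume A := by
  rw [remIntensity, withDensity_apply _ hA, ← setLIntegral_const]
  calc _ ≤ ∫⁻ t in A, ENNReal.ofReal (x * t ^ (-x - 1)) :=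
        lintegral_mono' (Measure.restrict_mono_measure Measure.restrict_le_self _) le_rfl
    _ ≤ _ := by
      refine setLIntegral_mono' hA fun t ht => ENNReal.ofReal_le_ofReal ?_
      have := Real.rpow_le_rpow_of_nonpos (z := -x - 1) hδ (hAδ ht) (by linarith)
      gcongr

lemma setLIntegral_Ioi_rpow_lt_top {a c : ℝ} (ha : a < -1) (hc : 0 < c) :
    ∫⁻ t in Set.Ioi c, ENNReal.ofReal (t ^ a) < ⊤ := by
  have h := (integrableOn_Ioi_rpow_of_lt ha hc).2
  rw [HasFiniteIntegral] at h
  refine lt_of_le_of_lt (lintegral_mono fun t => ?_) h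
  rw [← ofReal_norm]
  exact ENNReal.ofReal_le_ofReal (le_abs_self _)

lemma setLIntegral_Ioc_rpow_lt_top {a c : ℝ} (ha : -1 < a) (hc : 0 < c) :
    ∫⁻ t in Set.Ioc 0 c, ENNReal.ofReal (t ^ a) < ⊤ := by
  have h := (intervalIntegral.intervalIntegrable_rpow' (a := 0) (b := c) ha)
  rw [intervalIntegrable_iff_integrableOn_Ioc_of_le hc.le] at h
  have h := h.2
  rw [HasFiniteIntegral] at h
  refine lt_of_le_of_lt (lintegral_mono fun t => ?_) h
  rw [← ofReal_norm]
  exact ENNReal.ofReal_le_ofReal (le_abs_self _)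

lemma remDensity_mul_rpow {x s t : ℝ} (hx : 0 < x) (ht : 0 < t) :
    ENNReal.ofReal (x * t ^ (-x - 1)) * ENNReal.ofReal t ^ s =
      ENNReal.ofReal x * ENNReal.ofReal (t ^ (s - x - 1)) := by
  rw [ENNReal.ofReal_rpow_of_pos ht, ← ENNReal.ofReal_mul (by positivity),
    ← ENNReal.ofReal_mul hx.le, mul_assoc, ← Real.rpow_add ht]
  ring_nf

lemma setLIntegral_remIntensity_Ioi_lt_top {x s c : ℝ} (hx : 0 < x) (hs : s < x) (hc : 0 < c) :
    ∫⁻ t in Set.Ioi c, ENNReal.ofReal t ^ s ∂remIntensity x < ⊤ := by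
  rw [← lintegral_indicator measurableSet_Ioi, lintegral_remIntensity x
    (Measurable.indicator (by fun_prop) measurableSet_Ioi)]
  have hsub : Set.Ioi c ⊆ Set.Ioi (0 : ℝ) := Set.Ioi_subset_Ioi hc.le
  calc _ = ∫⁻ t in Set.Ioi (0 : ℝ), (Set.Ioi c).indicator
            (fun t => ENNReal.ofReal x * ENNReal.ofReal (t ^ (s - x - 1))) t := by
        refine setLIntegral_congr_fun measurableSet_Ioi fun t ht => ?_
        by_cases h : t ∈ Set.Ioi c
        · simp only [Set.indicator_of_mem h]
          exact remDensity_mul_rpow hx ht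
        · simp [Set.indicator_of_notMem h]
    _ = ENNReal.ofReal x * ∫⁻ t in Set.Ioi c, ENNReal.ofReal (t ^ (s - x - 1)) := by
        rw [setLIntegral_indicator measurableSet_Ioi, Set.inter_eq_left.2 hsub,
          lintegral_const_mul _ (by fun_prop)]
    _ < ⊤ := ENNReal.mul_lt_top ENNReal.ofReal_lt_top
        (setLIntegral_Ioi_rpow_lt_top (by linarith) hc)

lemma remIntensity_Ioi_lt_top {x c : ℝ} (hx : 0 < x) (hc : 0 < c) :
    remIntensity x (Set.Ioi c) < ⊤ := by
  simpa using setLIntegral_remIntensity_Ioi_lt_top hx hx hc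

lemma setLIntegral_remIntensity_Ioc_lt_top {x s c : ℝ} (hx : 0 < x) (hs : x < s) (hc : 0 < c) :
    ∫⁻ t in Set.Ioc 0 c, ENNReal.ofReal t ^ s ∂remIntensity x < ⊤ := by
  rw [← lintegral_indicator measurableSet_Ioc, lintegral_remIntensity x
    (Measurable.indicator (by fun_prop) measurableSet_Ioc)]
  have hsub : Set.Ioc 0 c ⊆ Set.Ioi (0 : ℝ) := Set.Ioc_subset_Ioi_self
  calc _ = ∫⁻ t in Set.Ioi (0 : ℝ), (Set.Ioc 0 c).indicator
            (fun t => ENNReal.ofReal x * ENNReal.ofReal (t ^ (s - x - 1))) t := by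
        refine setLIntegral_congr_fun measurableSet_Ioi fun t ht => ?_
        by_cases h : t ∈ Set.Ioc 0 c
        · simp only [Set.indicator_of_mem h]
          exact remDensity_mul_rpow hx ht
        · simp [Set.indicator_of_notMem h]
    _ = ENNReal.ofReal x * ∫⁻ t in Set.Ioc 0 c, ENNReal.ofReal (t ^ (s - x - 1)) := by
        rw [setLIntegral_indicator measurableSet_Ioc, Set.inter_eq_left.2 hsub,
          lintegral_const_mul _ (by fun_prop)]
    _ < ⊤ := ENNReal.mul_lt_top ENNReal.ofReal_lt_top
        (setLIntegral_Ioc_rpow_lt_top (by linarith) hc)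

/-- Substitution u = at: the density contributes a^{x+1} and dt contributes a^{-1}. This
self-similarity is what makes the marking invariance work. -/
lemma lintegral_remIntensity_comp_mul {x a : ℝ} (hx : 0 < x) (ha : 0 < a) {g : ℝ → ℝ≥0∞}
    (hg : Measurable g) :
    ∫⁻ t, g (a * t) ∂remIntensity x = ENNReal.ofReal a ^ x * ∫⁻ t, g t ∂remIntensity x := by
  have hmap := Real.map_volume_mul_left ha.ne'
  rw [lintegral_remIntensity x (by fun_prop), lintegral_remIntensity x hg]
  set G : ℝ → ℝ≥0∞ := (Set.Ioi 0).indicator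
    fun t => ENNReal.ofReal (x * t ^ (-x - 1)) * g t with hG
  have hGm : Measurable G := Measurable.indicator (by fun_prop) measurableSet_Ioi
  have h1 : ∫⁻ t, G (a * t) = ENNReal.ofReal a⁻¹ * ∫⁻ t, G t := by
    rw [← lintegral_map hGm (by fun_prop), hmap, lintegral_smul_measure,
      abs_of_pos (inv_pos.2 ha), smul_eq_mul]
  have h2 : ∀ t ∈ Set.Ioi (0 : ℝ), ENNReal.ofReal (x * t ^ (-x - 1)) * g (a * t) =
      ENNReal.ofReal a ^ (x + 1) * G (a * t) := by
    intro t ht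
    have hat : a * t ∈ Set.Ioi (0 : ℝ) := mul_pos ha ht
    rw [hG, Set.indicator_of_mem hat, ← mul_assoc, ENNReal.ofReal_rpow_of_pos ha,
      ← ENNReal.ofReal_mul (by positivity)]
    congr 2
    rw [Real.mul_rpow ha.le (le_of_lt ht), show -x - 1 = -(x + 1) by ring, Real.rpow_neg ha.le]
    have := (Real.rpow_pos_of_pos ha (x + 1)).ne'
    field_simp
  rw [setLIntegral_congr_fun measurableSet_Ioi h2, lintegral_const_mul _ (by fun_prop),
    ← lintegral_indicator measurableSet_Ioi]
  have h3 : (Set.Ioi (0 : ℝ)).indicator (fun t => G (a * t)) = fun t => G (a * t) := by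
    ext t
    by_cases h : 0 < t
    · simp [Set.indicator, h]
    · have : ¬ (0 < a * t) := by
        rw [mul_pos_iff_of_pos_left ha]; exact h
      simp [hG, Set.indicator, h, this]
  rw [h3, h1, hG, lintegral_indicator measurableSet_Ioi, ← mul_assoc]
  congr 1
  rw [ENNReal.rpow_add _ _ (by simpa using ha) ENNReal.ofReal_ne_top, ENNReal.rpow_one,
    mul_assoc, ← ENNReal.ofReal_mul ha.le, mul_inv_cancel₀ ha.ne']
  simp

end Intensity

/-! ### Expectations of functions of Poisson counts. -/

section Counting

variable {Ω : Type*} [MeasurableSpace Ω] {μ : Measure Ω}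

lemma measurable_occupation {X : ℕ → Ω → ℝ} (hX : ∀ m, Measurable (X m)) {A : Set ℝ}
    (hA : MeasurableSet A) : Measurable (occupation X A) := by
  refine measurable_encard.comp ?_
  rw [measurable_set_iff]
  intro m
  exact measurable_mem.2 (hX m hA)

/-- The count may a priori be infinite, but the Poisson masses of the natural numbers already add up
to one, so the value ∞ contributes nothing. -/
lemma lintegral_of_poisson [IsProbabilityMeasure μ] {N : Ω → ℕ∞} (hN : Measurable N) {r : ℝ}
    (hr : 0 ≤ r)
    (law : ∀ n : ℕ, μ {ω | N ω = n} =
      ENNReal.ofReal (Real.exp (-r) * r ^ n / (Nat.factorial n : ℝ)))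
    (g : ℕ∞ → ℝ≥0∞) :
    ∫⁻ ω, g (N ω) ∂μ =
      ∑' n : ℕ, ENNReal.ofReal (Real.exp (-r) * r ^ n / (Nat.factorial n : ℝ)) * g n := by
  have hm : ∀ n : ℕ, MeasurableSet {ω | N ω = n} := fun n =>
    hN (measurableSet_singleton (n : ℕ∞))
  have hd : Pairwise (Function.onFun Disjoint fun n : ℕ => {ω | N ω = n}) := by
    intro a b hab
    refine Set.disjoint_left.2 fun ω h1 h2 => hab ?_
    simpa using (h1 : N ω = a).symm.trans h2
  have hU : μ (⋃ n : ℕ, {ω | N ω = n}) = 1 := by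
    rw [measure_iUnion hd hm]
    simp_rw [law]
    have this : HasSum (fun n : ℕ => Real.exp (-r) * r ^ n / (Nat.factorial n : ℝ)) 1 :=
      hasSum_one_poissonMeasure ⟨r, hr⟩
    rw [← ENNReal.ofReal_tsum_of_nonneg (fun n => by positivity) this.summable]
    rw [this.tsum_eq, ENNReal.ofReal_one]
  have hae : (⋃ n : ℕ, {ω | N ω = n} : Set Ω) =ᵐ[μ] Set.univ :=
    ae_eq_univ.2 ((prob_compl_eq_zero_iff (MeasurableSet.iUnion hm)).2 hU)
  rw [← setLIntegral_univ, ← setLIntegral_congr hae, lintegral_iUnion hm hd]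
  refine tsum_congr fun n => ?_
  rw [setLIntegral_congr_fun (hm n) (g := fun _ => g n) (fun ω h => by
    simp only [Set.mem_ofPred_eq] at h; rw [h]), setLIntegral_const, law, mul_comm]

lemma IsREM.lintegral_occupation [IsProbabilityMeasure μ] {x : ℝ} {X : ℕ → Ω → ℝ}
    (h : IsREM x X μ) {A : Set ℝ} (hA : MeasurableSet A) (hfin : remIntensity x A ≠ ⊤)
    (g : ℕ∞ → ℝ≥0∞) :
    ∫⁻ ω, g (occupation X A ω) ∂μ =
      ∑' n : ℕ, ENNReal.ofReal (Real.exp (-(remIntensity x A).toReal) *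
        (remIntensity x A).toReal ^ n / (Nat.factorial n : ℝ)) * g n :=
  lintegral_of_poisson (measurable_occupation h.measurable hA) ENNReal.toReal_nonneg
    (h.law A hA hfin) g

/-- The generating function of the Poisson law; with c replaced by 1 − c it yields the Laplace
functional of a simple function. -/
lemma tsum_poisson_mul_pow {r c : ℝ} (hr : 0 ≤ r) (hc : 0 ≤ c) :
    ∑' n : ℕ, ENNReal.ofReal (Real.exp (-r) * r ^ n / (Nat.factorial n : ℝ)) *
      ENNReal.ofReal (c ^ n) = ENNReal.ofReal (Real.exp (-((1 - c) * r))) := by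
  have h := (NormedSpace.expSeries_div_hasSum_exp (c * r)).mul_left (Real.exp (-r))
  have h2 : ∀ n : ℕ, ENNReal.ofReal (Real.exp (-r) * r ^ n / (Nat.factorial n : ℝ)) *
      ENNReal.ofReal (c ^ n) =
      ENNReal.ofReal (Real.exp (-r) * ((c * r) ^ n / (Nat.factorial n : ℝ))) := by
    intro n
    rw [← ENNReal.ofReal_mul (by positivity)]
    congr 1
    ring
  simp_rw [h2]
  rw [← ENNReal.ofReal_tsum_of_nonneg (fun n => by positivity) h.summable, h.tsum_eq,
    ← Real.exp_eq_exp_ℝ, ← Real.exp_add]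
  ring_nf

lemma tsum_poisson_mul_self {r : ℝ} (hr : 0 ≤ r) :
    ∑' n : ℕ, ENNReal.ofReal (Real.exp (-r) * r ^ n / (Nat.factorial n : ℝ)) * (n : ℝ≥0∞) =
      ENNReal.ofReal r := by
  rw [tsum_eq_zero_add' ENNReal.summable]
  have h2 : ∀ n : ℕ, ENNReal.ofReal (Real.exp (-r) * r ^ (n + 1) /
      (Nat.factorial (n + 1) : ℝ)) * ((n + 1 : ℕ) : ℝ≥0∞) =
      ENNReal.ofReal r * (ENNReal.ofReal (Real.exp (-r) * r ^ n / (Nat.factorial n : ℝ)) *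
        ENNReal.ofReal (1 ^ n)) := by
    intro n
    rw [← ENNReal.ofReal_natCast, ← ENNReal.ofReal_mul (by positivity),
      ← ENNReal.ofReal_mul (by positivity), ← ENNReal.ofReal_mul (by positivity)]
    congr 1
    rw [Nat.factorial_succ]
    push_cast
    have : (n : ℝ) + 1 ≠ 0 := by positivity
    field_simp
    rw [one_pow, mul_one, pow_succ, mul_comm]
  simp_rw [h2]
  rw [ENNReal.tsum_mul_left, tsum_poisson_mul_pow hr zero_le_one]
  simp

end Counting


/-- The function `a ↦ exp (-a)` on `[0, ∞]`. -/
noncomputable def expNeg (a : ℝ≥0∞) : ℝ≥0∞ := (EReal.exp a)⁻¹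

lemma expNeg_zero : expNeg 0 = 1 := by simp [expNeg]

lemma expNeg_of_ne_top {a : ℝ≥0∞} (ha : a ≠ ⊤) :
    expNeg a = ENNReal.ofReal (Real.exp (-a.toReal)) := by
  lift a to ℝ≥0 using ha
  have : ((a : ℝ≥0∞) : EReal) = ((a : ℝ) : EReal) := rfl
  rw [expNeg, this, EReal.exp_coe, ← ENNReal.ofReal_inv_of_pos (Real.exp_pos _), ← Real.exp_neg]
  simp

lemma expNeg_add (a b : ℝ≥0∞) : expNeg (a + b) = expNeg a * expNeg b := by
  have h : ∀ c : ℝ≥0∞, EReal.exp c ≠ 0 := fun c => by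
    rw [Ne, EReal.exp_eq_zero_iff]
    exact EReal.coe_ennreal_ne_bot c
  rw [expNeg, EReal.coe_ennreal_add, EReal.exp_add, ENNReal.mul_inv (Or.inl (h a)) (Or.inr (h b))]
  rfl

lemma expNeg_sum {ι : Type*} (s : Finset ι) (a : ι → ℝ≥0∞) :
    expNeg (∑ i ∈ s, a i) = ∏ i ∈ s, expNeg (a i) := by
  classical
  induction s using Finset.induction_on with
  | empty => simp [expNeg_zero]
  | insert i s hi ih => rw [Finset.sum_insert hi, Finset.prod_insert hi, expNeg_add, ih]

lemma continuous_expNeg : Continuous expNeg :=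
  continuous_inv.comp (ENNReal.continuous_exp.comp continuous_coe_ennreal_ereal)

lemma expNeg_antitone : Antitone expNeg := fun _ _ h =>
  ENNReal.inv_le_inv.2 (EReal.exp_monotone (EReal.coe_ennreal_le_coe_ennreal_iff.2 h))

/-! ### Integration of independent pairs and infinite products of numbers in [0, 1]. -/

section Auxiliary

variable {Ω : Type*} [MeasurableSpace Ω] {μ : Measure Ω}

lemma lintegral_indepFun {β γ : Type*} [MeasurableSpace β] [MeasurableSpace γ]
    [IsProbabilityMeasure μ] {U : Ω → β} {V : Ω → γ} (h : IndepFun U V μ) (hU : Measurable U)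
    (hV : Measurable V) {F : β → γ → ℝ≥0∞} (hF : Measurable (Function.uncurry F)) :
    ∫⁻ ω, F (U ω) (V ω) ∂μ = ∫⁻ ω, ∫⁻ v, F (U ω) v ∂(μ.map V) ∂μ := by
  have : IsProbabilityMeasure (μ.map V) := Measure.isProbabilityMeasure_map hV.aemeasurable
  have h1 := (indepFun_iff_map_prod_eq_prod_map_map hU.aemeasurable hV.aemeasurable).1 h
  calc ∫⁻ ω, F (U ω) (V ω) ∂μ = ∫⁻ p, Function.uncurry F p ∂(μ.map fun ω => (U ω, V ω)) := by
        rw [lintegral_map hF (hU.prodMk hV)]; rfl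
    _ = ∫⁻ u, ∫⁻ v, F u v ∂(μ.map V) ∂(μ.map U) := by
        rw [h1, lintegral_prod _ hF.aemeasurable]; rfl
    _ = _ := lintegral_map hF.lintegral_prod_right' hU

lemma measurable_tprod_of_le_one {f : ℕ → Ω → ℝ≥0∞} (hf : ∀ m, Measurable (f m))
    (h1 : ∀ m ω, f m ω ≤ 1) : Measurable fun ω => ∏' m, f m ω := by
  have : (fun ω => ∏' m, f m ω) = fun ω => ⨅ s : Finset ℕ, ∏ m ∈ s, f m ω := by
    ext ω
    exact ENNReal.tprod_eq_iInf_prod fun m => h1 m ω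
  rw [this]
  exact Measurable.iInf fun s => Finset.measurable_prod _ fun m _ => hf m

lemma tprod_le_one {f : ℕ → ℝ≥0∞} (h1 : ∀ m, f m ≤ 1) : ∏' m, f m ≤ 1 := by
  rw [ENNReal.tprod_eq_iInf_prod h1]
  exact (iInf_le _ ∅).trans (by simp)

/-- An infinite product of factors at most 1 is the infimum of its finite subproducts, so the two
infima commute and only continuity of finite products is needed. -/
lemma iInf_tprod_one_sub {f : ℕ → ℕ → ℝ≥0∞} (hmono : Monotone f) :
    ⨅ n, ∏' m, (1 - f n m) = ∏' m, (1 - ⨆ n, f n m) := by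
  rw [ENNReal.tprod_eq_iInf_prod fun m => tsub_le_self]
  simp_rw [fun n => ENNReal.tprod_eq_iInf_prod (f := fun m => 1 - f n m) fun m => tsub_le_self]
  rw [iInf_comm]
  congr 1
  ext s
  have hanti : Antitone fun n => ∏ m ∈ s, (1 - f n m) := fun a b hab =>
    Finset.prod_le_prod' fun m _ => tsub_le_tsub_left (hmono hab m) 1
  refine tendsto_nhds_unique (tendsto_atTop_iInf hanti) ?_
  refine ENNReal.tendsto_finsetProd_of_ne_top s (fun m _ => ?_)
    fun m _ => ne_top_of_le_ne_top ENNReal.one_ne_top tsub_le_self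
  exact ENNReal.Tendsto.sub tendsto_const_nhds
    (tendsto_atTop_iSup fun a b hab => hmono hab m) (Or.inl ENNReal.one_ne_top)

lemma tsum_indicator_eq_encard (s : Set ℕ) :
    ∑' m, s.indicator (fun _ => (1 : ℝ≥0∞)) m = s.encard := by
  rw [← tsum_subtype, ENNReal.tsum_set_one]

end Auxiliary

/-- The points `X 0, X 1, …` have intensity measure `ρ` and the void probabilities of a Poisson
process with intensity `ρ`. -/
structure IsPPP {Ω : Type*} [MeasurableSpace Ω] (ρ : Measure ℝ) (X : ℕ → Ω → ℝ)
    (μ : Measure Ω) : Prop where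
  measurable : ∀ m, Measurable (X m)
  intensity : Measure.sum (fun m => μ.map (X m)) = ρ
  void : ∀ A : Set ℝ, MeasurableSet A → μ {ω | ∀ m, X m ω ∉ A} = expNeg (ρ A)

/-! ### Intensity and Laplace functional of a REM. -/

section REM

variable {Ω : Type*} [MeasurableSpace Ω] {μ : Measure Ω}

/-- The intensity is infinite near 0, so measures are compared on sets bounded away from 0, and
these exhaust the positive half-line. -/
lemma measure_eq_of_Ioi {M ρ : Measure ℝ} (h0 : M (Set.Iic 0) = 0) (h0' : ρ (Set.Iic 0) = 0)
    (h : ∀ A, MeasurableSet A → ∀ c > 0, A ⊆ Set.Ioi c → M A = ρ A) : M = ρ := by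
  ext A hA
  have key : ∀ N : Measure ℝ, N (Set.Iic 0) = 0 →
      N A = ⨆ n : ℕ, N (A ∩ Set.Ioi (1 / ((n : ℝ) + 1))) := by
    intro N hN
    have hmono : Monotone fun n : ℕ => A ∩ Set.Ioi (1 / ((n : ℝ) + 1)) := by
      intro a b hab
      refine Set.inter_subset_inter_right _ (Set.Ioi_subset_Ioi ?_)
      exact one_div_le_one_div_of_le (by positivity) (by exact_mod_cast Nat.succ_le_succ hab)
    rw [← hmono.measure_iUnion, ← Set.inter_iUnion]
    have : (⋃ n : ℕ, Set.Ioi (1 / ((n : ℝ) + 1))) = Set.Ioi 0 := by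
      ext t
      simp only [Set.mem_iUnion, Set.mem_Ioi]
      exact ⟨fun ⟨n, hn⟩ => lt_trans (by positivity) hn, fun ht => exists_nat_one_div_lt ht⟩
    rw [this]
    refine le_antisymm ?_ (measure_mono Set.inter_subset_left)
    calc N A ≤ N (A ∩ Set.Ioi 0 ∪ Set.Iic 0) := by
          refine measure_mono fun t ht => ?_
          rcases lt_or_ge 0 t with h | h
          · exact Or.inl ⟨ht, h⟩
          · exact Or.inr h
      _ ≤ _ := (measure_union_le _ _).trans (by rw [hN, add_zero])
  rw [key M h0, key ρ h0']
  congr 1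
  ext n
  exact h _ (hA.inter measurableSet_Ioi) _ (by positivity) Set.inter_subset_right

/-- The sum over m of the indicators of X m ∈ A is the occupation number, whose mean is the Poisson
parameter. -/
lemma IsREM.tsum_measure_of_ne_top [IsProbabilityMeasure μ] {x : ℝ} {X : ℕ → Ω → ℝ}
    (h : IsREM x X μ) {A : Set ℝ} (hA : MeasurableSet A) (hfin : remIntensity x A ≠ ⊤) :
    Measure.sum (fun m => μ.map (X m)) A = remIntensity x A := by
  rw [Measure.sum_apply _ hA]
  calc ∑' m, μ.map (X m) A = ∑' m, ∫⁻ ω, {m | X m ω ∈ A}.indicator (fun _ => 1) m ∂μ := by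
        refine tsum_congr fun m => ?_
        rw [Measure.map_apply (h.measurable m) hA, ← lintegral_indicator_one (h.measurable m hA)]
        rfl
    _ = ∫⁻ ω, ∑' m, {m | X m ω ∈ A}.indicator (fun _ => 1) m ∂μ := by
        rw [lintegral_tsum]
        intro m
        exact (measurable_const.indicator (h.measurable m hA) : Measurable
          ((X m ⁻¹' A).indicator fun _ => (1 : ℝ≥0∞))).aemeasurable
    _ = ∫⁻ ω, ((occupation X A ω : ℕ∞) : ℝ≥0∞) ∂μ := by
        simp_rw [tsum_indicator_eq_encard]; rfl
    _ = _ := by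
        rw [h.lintegral_occupation hA hfin fun n => (n : ℝ≥0∞)]
        simp only [ENat.toENNReal_coe]
        rw [tsum_poisson_mul_self ENNReal.toReal_nonneg, ENNReal.ofReal_toReal hfin]

lemma IsREM.intensity [IsProbabilityMeasure μ] {x : ℝ} (hx : 0 < x) {X : ℕ → Ω → ℝ}
    (h : IsREM x X μ) : Measure.sum (fun m => μ.map (X m)) = remIntensity x := by
  refine measure_eq_of_Ioi ?_ (remIntensity_Iic_zero x) fun A hA c hc hAc =>
    h.tsum_measure_of_ne_top hA ((measure_mono hAc).trans_lt (remIntensity_Ioi_lt_top hx hc)).ne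
  rw [h.tsum_measure_of_ne_top measurableSet_Iic (by simp [remIntensity_Iic_zero]),
    remIntensity_Iic_zero]

lemma tsum_lintegral_of_intensity {ρ : Measure ℝ} {X : ℕ → Ω → ℝ} (hX : ∀ m, Measurable (X m))
    (h : Measure.sum (fun m => μ.map (X m)) = ρ) {g : ℝ → ℝ≥0∞} (hg : Measurable g) :
    ∑' m, ∫⁻ ω, g (X m ω) ∂μ = ∫⁻ t, g t ∂ρ := by
  rw [← h, lintegral_sum_measure]
  exact tsum_congr fun m => (lintegral_map hg (hX m)).symm

lemma ae_forall_notMem_of_intensity {ρ : Measure ℝ} {X : ℕ → Ω → ℝ} (hX : ∀ m, Measurable (X m))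
    (h : Measure.sum (fun m => μ.map (X m)) = ρ) {A : Set ℝ} (hA : MeasurableSet A)
    (h0 : ρ A = 0) : ∀ᵐ ω ∂μ, ∀ m, X m ω ∉ A := by
  rw [ae_all_iff]
  intro m
  rw [← h, Measure.sum_apply _ hA, ENNReal.tsum_eq_zero] at h0
  have := h0 m
  rw [Measure.map_apply (hX m) hA] at this
  exact measure_eq_zero_iff_ae_notMem.1 this

/-- Borel–Cantelli: the finite intensity of A is the sum of the probabilities of X m ∈ A. No
independence of the points is used. -/
lemma ae_finite_of_intensity {ρ : Measure ℝ} {X : ℕ → Ω → ℝ} (hX : ∀ m, Measurable (X m))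
    (h : Measure.sum (fun m => μ.map (X m)) = ρ) {A : Set ℝ} (hA : MeasurableSet A)
    (hfin : ρ A ≠ ⊤) : ∀ᵐ ω ∂μ, {m | X m ω ∈ A}.Finite := by
  rw [← h, Measure.sum_apply _ hA] at hfin
  have := measure_setOfPred_frequently_eq_zero (μ := μ) (p := fun m ω => X m ω ∈ A) (by
    convert hfin using 3 with m
    rw [Measure.map_apply (hX m) hA]; rfl)
  rw [measure_eq_zero_iff_ae_notMem] at this
  filter_upwards [this] with ω hω
  rw [Nat.frequently_atTop_iff_infinite, Set.not_infinite] at hω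
  exact hω

/-- The Laplace functional of a REM, for a simple test function. -/
lemma IsREM.lintegral_tprod_simpleFunc [IsProbabilityMeasure μ] {x : ℝ} (hx : 0 < x)
    {X : ℕ → Ω → ℝ} (h : IsREM x X μ) (f : SimpleFunc ℝ ℝ≥0∞) (hf : ∀ t, f t ≤ 1)
    (hfin : ∀ c ≠ 0, remIntensity x (f ⁻¹' {c}) ≠ ⊤) :
    ∫⁻ ω, ∏' m, (1 - f (X m ω)) ∂μ = expNeg (∫⁻ t, f t ∂remIntensity x) := by
  classical
  set s : Finset ℝ≥0∞ := f.range.filter (· ≠ 0) with hs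
  have hs0 : ∀ c ∈ s, c ≠ 0 := fun c hc => (Finset.mem_filter.1 hc).2
  have hs1 : ∀ c ∈ s, c ≤ 1 := fun c hc => by
    obtain ⟨t, ht⟩ := SimpleFunc.mem_range.1 (Finset.mem_filter.1 hc).1
    exact ht ▸ hf t
  have hA : ∀ c, MeasurableSet (f ⁻¹' {c}) := fun c => f.measurableSet_fiber c
  have hfinite : ∀ᵐ ω ∂μ, ∀ c ∈ s, {m | X m ω ∈ f ⁻¹' {c}}.Finite := by
    rw [Filter.eventually_all_finset]
    intro c hc
    exact ae_finite_of_intensity h.measurable (h.intensity hx) (hA c) (hfin c (hs0 c hc))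
  -- Grouping the points by the value c of f turns the product into finitely many powers (1 − c)^N,
  -- with N the occupation number of a level set. `toNat` sends an infinite count to 0, which
  -- matters only on a null event.
  let g : ℝ≥0∞ → ℕ∞ → ℝ≥0∞ := fun c n => (1 - c) ^ n.toNat
  have hprod : ∀ᵐ ω ∂μ, ∏' m, (1 - f (X m ω)) =
      ∏ c ∈ s.attach, g c (occupation X (f ⁻¹' {(c : ℝ≥0∞)}) ω) := by
    filter_upwards [hfinite] with ω hω
    have hT : {m | f (X m ω) ≠ 0}.Finite := by
      refine (Set.Finite.biUnion s.finite_toSet hω).subset fun m hm => ?_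
      exact Set.mem_biUnion (Finset.mem_coe.2 (Finset.mem_filter.2
        ⟨SimpleFunc.mem_range_self _ _, hm⟩)) rfl
    rw [tprod_eq_prod (s := hT.toFinset) (fun m hm => by
      have : f (X m ω) = 0 := by simpa using hm
      simp [this])]
    rw [Finset.prod_attach s fun c => g c (occupation X (f ⁻¹' {c}) ω),
      ← Finset.prod_fiberwise_of_maps_to (t := s) (g := fun m => f (X m ω)) (fun m hm => by
        refine Finset.mem_filter.2 ⟨SimpleFunc.mem_range_self _ _, ?_⟩
        simpa using hm)]
    refine Finset.prod_congr rfl fun c hc => ?_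
    rw [Finset.prod_congr rfl (g := fun _ => 1 - c) (fun m hm => by
      rw [(Finset.mem_filter.1 hm).2]), Finset.prod_const]
    congr 1
    have : occupation X (f ⁻¹' {c}) ω =
        ((({m ∈ hT.toFinset | f (X m ω) = c} : Finset ℕ)) : Set ℕ).encard := by
      unfold occupation
      congr 1
      ext m
      simp only [Set.mem_preimage, Set.mem_singleton_iff, Set.mem_ofPred_eq, Finset.coe_filter,
        Set.Finite.mem_toFinset]
      exact ⟨fun h => ⟨h ▸ hs0 c hc, h⟩, fun h => h.2⟩
    rw [this, Set.encard_coe_eq_coe_finsetCard]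
    rfl
  have hindep : iIndepFun (fun c : s => occupation X (f ⁻¹' {(c : ℝ≥0∞)})) μ := by
    have e := s.equivFin
    have h1 := h.indep s.card (fun i => f ⁻¹' {((e.symm i : s) : ℝ≥0∞)}) (fun i => hA _)
      (fun i j hij => by
        refine Set.disjoint_left.2 fun t h1 h2 => hij (e.symm.injective (Subtype.ext ?_))
        exact (h1 : f t = _).symm.trans h2)
    have h2 := h1.precomp e.injective
    simpa using h2
  have hindep2 := hindep.comp (fun c => g c) fun c => Measurable.of_discrete
  rw [lintegral_congr_ae hprod]
  have := lintegral_prod_eq_prod_lintegral_of_indepFun s.attach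
    (fun c ω => g c (occupation X (f ⁻¹' {(c : ℝ≥0∞)}) ω)) hindep2
    (fun c => (Measurable.of_discrete (f := g c)).comp (measurable_occupation h.measurable (hA _)))
  rw [this, Finset.prod_attach s fun c => ∫⁻ ω, g c (occupation X (f ⁻¹' {c}) ω) ∂μ]
  have hI : ∫⁻ t, f t ∂remIntensity x = ∑ c ∈ s, c * remIntensity x (f ⁻¹' {c}) := by
    rw [SimpleFunc.lintegral_eq_lintegral, SimpleFunc.lintegral, hs, Finset.sum_filter_of_ne]
    intro c _ hc hc0
    simp [hc0] at hc
  rw [hI, expNeg_sum]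
  refine Finset.prod_congr rfl fun c hc => ?_
  rw [h.lintegral_occupation (hA c) (hfin c (hs0 c hc))]
  have hct : c ≠ ⊤ := ne_top_of_le_ne_top ENNReal.one_ne_top (hs1 c hc)
  have hc1 : c.toReal ≤ 1 := ENNReal.toReal_le_of_le_ofReal zero_le_one (by simpa using hs1 c hc)
  have hg : ∀ n : ℕ, g c n = ENNReal.ofReal ((1 - c.toReal) ^ n) := by
    intro n
    rw [ENNReal.ofReal_pow (by linarith), ENNReal.ofReal_sub _ ENNReal.toReal_nonneg,
      ENNReal.ofReal_toReal hct, ENNReal.ofReal_one]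
    rfl
  simp_rw [hg]
  rw [tsum_poisson_mul_pow ENNReal.toReal_nonneg (by linarith),
    expNeg_of_ne_top (ENNReal.mul_ne_top hct (hfin c (hs0 c hc))), ENNReal.toReal_mul]
  ring_nf

/-- The Laplace functional of a REM. -/
lemma IsREM.lintegral_tprod [IsProbabilityMeasure μ] {x : ℝ} (hx : 0 < x)
    {X : ℕ → Ω → ℝ} (h : IsREM x X μ) {f : ℝ → ℝ≥0∞} (hfm : Measurable f) (hf : ∀ t, f t ≤ 1) :
    ∫⁻ ω, ∏' m, (1 - f (X m ω)) ∂μ = expNeg (∫⁻ t, f t ∂remIntensity x) := by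
  -- The approximations are cut off below 1/(n+1): the level sets of nonzero values then have finite
  -- intensity, as the simple case requires.
  let F : ℕ → SimpleFunc ℝ ℝ≥0∞ := fun n =>
    (SimpleFunc.eapprox f n).restrict (Set.Ioi (1 / ((n : ℝ) + 1)))
  have hF : ∀ n t, F n t = (Set.Ioi (1 / ((n : ℝ) + 1))).indicator (SimpleFunc.eapprox f n) t :=
    fun n t => SimpleFunc.restrict_apply _ measurableSet_Ioi t
  have hle : ∀ n t, SimpleFunc.eapprox f n t ≤ f t := fun n t => by
    rw [← SimpleFunc.iSup_eapprox_apply hfm t]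
    exact le_iSup (fun n => SimpleFunc.eapprox f n t) n
  have hF1 : ∀ n t, F n t ≤ 1 := fun n t => by
    rw [hF]
    exact (Set.indicator_le_self _ _ t).trans ((hle n t).trans (hf t))
  have hFmono : Monotone fun n t => F n t := by
    intro a b hab t
    simp only [hF]
    refine (Set.indicator_le_indicator (SimpleFunc.monotone_eapprox f hab t)).trans ?_
    refine Set.indicator_le_indicator_of_subset (Set.Ioi_subset_Ioi ?_) (fun _ => zero_le) t
    exact one_div_le_one_div_of_le (by positivity) (by exact_mod_cast Nat.succ_le_succ hab)
  have hsup : ∀ t, 0 < t → ⨆ n, F n t = f t := by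
    intro t ht
    refine le_antisymm (iSup_le fun n => ?_) ?_
    · rw [hF]
      exact (Set.indicator_le_self _ _ t).trans (hle n t)
    · rw [← SimpleFunc.iSup_eapprox_apply hfm t]
      refine iSup_le fun n => ?_
      obtain ⟨N, hN⟩ := exists_nat_one_div_lt ht
      refine le_trans ?_ (le_iSup (fun n => F n t) (max n N))
      simp only [hF]
      rw [Set.indicator_of_mem]
      · exact SimpleFunc.monotone_eapprox f (le_max_left n N) t
      · refine lt_of_le_of_lt ?_ hN
        exact one_div_le_one_div_of_le (by positivity)
          (by exact_mod_cast Nat.succ_le_succ (le_max_right n N))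
  have hpos := ae_forall_notMem_of_intensity h.measurable (h.intensity hx) measurableSet_Iic
    (remIntensity_Iic_zero x)
  -- As F n increases to f on the positive half-line, the products decrease to the product for f.
  -- Both sides of the identity then pass to the limit by monotonicity.
  have hL : ∀ᵐ ω ∂μ, ∏' m, (1 - f (X m ω)) = ⨅ n, ∏' m, (1 - F n (X m ω)) := by
    filter_upwards [hpos] with ω hω
    rw [iInf_tprod_one_sub (f := fun n m => F n (X m ω)) (fun a b hab m => hFmono hab _)]
    refine tprod_congr fun m => ?_
    rw [hsup _ (by simpa using hω m)]
  rw [lintegral_congr_ae hL, lintegral_iInf]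
  · have hR : ∫⁻ t, f t ∂remIntensity x = ⨆ n, ∫⁻ t, F n t ∂remIntensity x := by
      rw [← lintegral_iSup (fun n => (F n).measurable) hFmono]
      refine lintegral_congr_ae ?_
      have : ∀ᵐ t ∂remIntensity x, t ∉ Set.Iic (0 : ℝ) :=
        measure_eq_zero_iff_ae_notMem.1 (remIntensity_Iic_zero x)
      filter_upwards [this] with t ht
      exact (hsup t (by simpa using ht)).symm
    have hmono : Monotone fun n => ∫⁻ t, F n t ∂remIntensity x := fun a b hab =>
      lintegral_mono (hFmono hab)
    have heach : ∀ n, ∫⁻ ω, ∏' m, (1 - F n (X m ω)) ∂μ = expNeg (∫⁻ t, F n t ∂remIntensity x) := by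
      intro n
      refine h.lintegral_tprod_simpleFunc hx (F n) (hF1 n) fun c hc => ?_
      refine ((measure_mono fun t ht => ?_).trans_lt
        (remIntensity_Ioi_lt_top hx (show 0 < 1 / ((n : ℝ) + 1) by positivity))).ne
      by_contra hcon
      have : F n t = c := ht
      rw [hF, Set.indicator_of_notMem hcon] at this
      exact hc this.symm
    simp_rw [heach, hR]
    refine tendsto_nhds_unique
      (tendsto_atTop_iInf fun a b hab => expNeg_antitone (hmono hab)) ?_
    exact (continuous_expNeg.tendsto _).comp (tendsto_atTop_iSup hmono)
  · exact fun n => measurable_tprod_of_le_one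
      (fun m => measurable_const.sub ((F n).measurable.comp (h.measurable m)))
      fun m ω => tsub_le_self
  · intro a b hab ω
    simp only
    rw [ENNReal.tprod_eq_iInf_prod fun m => tsub_le_self,
      ENNReal.tprod_eq_iInf_prod fun m => tsub_le_self]
    exact iInf_mono fun s => Finset.prod_le_prod' fun m _ => tsub_le_tsub_left (hFmono hab _) 1
  · refine ((lintegral_mono fun ω => tprod_le_one fun m => tsub_le_self).trans_lt ?_).ne
    simp

end REM


/-! ### The marking theorem. -/

section Marking

variable {Ω : Type*} [MeasurableSpace Ω] {μ : Measure Ω} [IsProbabilityMeasure μ]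

/-- By Fubini and scaling, a fixed factor a(z) contributes a(z)^x times the intensity of A, and
these coefficients average to one. -/
lemma lintegral_prob_mul_mem_remIntensity {β : Type*} [MeasurableSpace β] {γ : Measure β}
    [IsProbabilityMeasure γ] {a : β → ℝ} (ha : Measurable a) (hpos : ∀ z, 0 < a z) {x : ℝ}
    (hx : 0 < x) (hmom : ∫⁻ z, ENNReal.ofReal (a z) ^ x ∂γ = 1) {A : Set ℝ}
    (hA : MeasurableSet A) :
    ∫⁻ t, γ {z | a z * t ∈ A} ∂remIntensity x = remIntensity x A := by
  have hmeas : Measurable fun p : ℝ × β => A.indicator (1 : ℝ → ℝ≥0∞) (a p.2 * p.1) :=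
    (measurable_one.indicator hA).comp (by fun_prop)
  have h1 : ∀ t, γ {z | a z * t ∈ A} = ∫⁻ z, A.indicator (1 : ℝ → ℝ≥0∞) (a z * t) ∂γ := by
    intro t
    have hm : MeasurableSet {z | a z * t ∈ A} := (ha.mul_const t) hA
    rw [← lintegral_indicator_one hm]
    rfl
  simp_rw [h1]
  rw [lintegral_lintegral_swap hmeas.aemeasurable]
  have h2 : ∀ z, ∫⁻ t, A.indicator (1 : ℝ → ℝ≥0∞) (a z * t) ∂remIntensity x =
      ENNReal.ofReal (a z) ^ x * remIntensity x A := by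
    intro z
    rw [lintegral_remIntensity_comp_mul hx (hpos z) (measurable_one.indicator hA),
      lintegral_indicator_one hA]
  simp_rw [h2]
  rw [lintegral_mul_const _ (by fun_prop), hmom, one_mul]

/-- The marking theorem: multiplying the points of a REM by independent, identically distributed
positive factors with normalised moment of order `x` gives again a Poisson process with the same
intensity. -/
lemma IsREM.isPPP_mul {β : Type*} [MeasurableSpace β] {γ : Measure β} [IsProbabilityMeasure γ]
    {a : β → ℝ} (ha : Measurable a) (hpos : ∀ z, 0 < a z) {x : ℝ} (hx : 0 < x)
    (hmom : ∫⁻ z, ENNReal.ofReal (a z) ^ x ∂γ = 1) {X : ℕ → Ω → ℝ} (hX : IsREM x X μ)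
    {Z : Ω → ℕ → β} (hZ : Measurable Z)
    (hZlaw : μ.map Z = Measure.infinitePi fun _ : ℕ => γ)
    (hind : IndepFun (fun ω m => X m ω) Z μ) :
    IsPPP (remIntensity x) (fun m ω => a (Z ω m) * X m ω) μ := by
  have hZm : ∀ m, Measurable fun ω => Z ω m := fun m => (measurable_pi_apply m).comp hZ
  have hXm : Measurable fun ω m => X m ω := measurable_pi_lambda _ hX.measurable
  have hYm : ∀ m, Measurable fun ω => a (Z ω m) * X m ω := fun m =>
    (ha.comp (hZm m)).mul (hX.measurable m)
  have hfm : ∀ {A : Set ℝ}, MeasurableSet A → Measurable fun t : ℝ => γ {z | a z * t ∈ A} := by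
    intro A hA
    have hm : MeasurableSet {p : ℝ × β | a p.2 * p.1 ∈ A} :=
      (show Measurable fun p : ℝ × β => a p.2 * p.1 by fun_prop) hA
    exact measurable_measure_prodMk_left hm
  refine ⟨hYm, ?_, fun A hA => ?_⟩
  · ext A hA
    rw [Measure.sum_apply _ hA, ← lintegral_prob_mul_mem_remIntensity ha hpos hx hmom hA,
      ← tsum_lintegral_of_intensity hX.measurable (hX.intensity hx) (hfm hA)]
    refine tsum_congr fun m => ?_
    rw [Measure.map_apply (hYm m) hA, ← lintegral_indicator_one (hYm m hA)]
    have hind' : IndepFun (X m) (fun ω => Z ω m) μ :=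
      hind.comp (φ := fun u : ℕ → ℝ => u m) (ψ := fun u : ℕ → β => u m)
        (measurable_pi_apply m) (measurable_pi_apply m)
    have hlaw : μ.map (fun ω => Z ω m) = γ := by
      rw [← Measure.infinitePi_map_eval (fun _ : ℕ => γ) m, ← hZlaw,
        Measure.map_map (measurable_pi_apply m) hZ]
      rfl
    have := lintegral_indepFun hind' (hX.measurable m) (hZm m)
      (F := fun t z => A.indicator (1 : ℝ → ℝ≥0∞) (a z * t))
      ((measurable_one.indicator hA).comp (by fun_prop))
    refine (this.trans ?_)
    rw [hlaw]
    refine lintegral_congr fun ω => ?_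
    have hm : MeasurableSet {z | a z * X m ω ∈ A} := (ha.mul_const _) hA
    rw [← lintegral_indicator_one hm]
    rfl
  -- Given the points, the marks are independent, so the conditional void probability is the product
  -- over m of 1 − f(X m), with f(t) the probability that the marked position of t lies in A. The
  -- Laplace functional and the preceding average of f finish the computation.
  · have hset : MeasurableSet {p : (ℕ → ℝ) × (ℕ → β) | ∀ m, a (p.2 m) * p.1 m ∉ A} := by
      have : {p : (ℕ → ℝ) × (ℕ → β) | ∀ m, a (p.2 m) * p.1 m ∉ A} =
          ⋂ m, (fun p : (ℕ → ℝ) × (ℕ → β) => a (p.2 m) * p.1 m) ⁻¹' Aᶜ := by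
        ext p; simp
      rw [this]
      exact MeasurableSet.iInter fun m =>
        (show Measurable fun p : (ℕ → ℝ) × (ℕ → β) => a (p.2 m) * p.1 m by fun_prop) hA.compl
    have h1 : μ {ω | ∀ m, a (Z ω m) * X m ω ∉ A} =
        ∫⁻ ω, {p : (ℕ → ℝ) × (ℕ → β) | ∀ m, a (p.2 m) * p.1 m ∉ A}.indicator
          (1 : (ℕ → ℝ) × (ℕ → β) → ℝ≥0∞) (fun m => X m ω, Z ω) ∂μ := by
      have hm : MeasurableSet {ω | ∀ m, a (Z ω m) * X m ω ∉ A} := (hXm.prodMk hZ) hset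
      rw [← lintegral_indicator_one hm]
      rfl
    rw [h1, lintegral_indepFun hind hXm hZ (F := fun u v =>
      {p : (ℕ → ℝ) × (ℕ → β) | ∀ m, a (p.2 m) * p.1 m ∉ A}.indicator
          (1 : (ℕ → ℝ) × (ℕ → β) → ℝ≥0∞) (u, v)) (measurable_one.indicator hset), hZlaw,
      ← lintegral_prob_mul_mem_remIntensity ha hpos hx hmom hA,
      ← hX.lintegral_tprod hx (hfm hA) fun t => prob_le_one]
    refine lintegral_congr fun ω => ?_
    have hB : ∀ m, MeasurableSet {z | a z * X m ω ∈ A} := fun m => (ha.mul_const _) hA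
    have h2 : (fun v => {p : (ℕ → ℝ) × (ℕ → β) | ∀ m, a (p.2 m) * p.1 m ∉ A}.indicator
          (1 : (ℕ → ℝ) × (ℕ → β) → ℝ≥0∞) (fun m => X m ω, v)) =
        (Set.univ.pi fun m => {z | a z * X m ω ∈ A}ᶜ).indicator 1 := by
      ext v
      by_cases h : ∀ m, a (v m) * X m ω ∉ A
      · rw [Set.indicator_of_mem (by exact h), Set.indicator_of_mem (by simpa using h)]
        rfl
      · rw [Set.indicator_of_notMem (by exact h), Set.indicator_of_notMem (by simpa using h)]
    rw [h2, lintegral_indicator_one (MeasurableSet.univ_pi fun m => (hB m).compl),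
      Measure.infinitePi_pi_univ _ fun m => (hB m).compl]
    exact tprod_congr fun m => prob_compl_eq_one_sub (hB m)

end Marking

/-! ### Absence of coincidences, from the intensity and the void probabilities alone. -/

section PPP

variable {Ω : Type*} [MeasurableSpace Ω] {μ : Measure Ω} {x : ℝ}
  {X : ℕ → Ω → ℝ}

lemma sub_one_sub_expNeg_le {r : ℝ≥0∞} (hr : r ≤ 1) : r - (1 - expNeg r) ≤ r ^ 2 := by
  have hrt : r ≠ ⊤ := ne_top_of_le_ne_top ENNReal.one_ne_top hr
  lift r to ℝ≥0 using hrt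
  have hr1 : (r : ℝ) ≤ 1 := by exact_mod_cast hr
  rw [expNeg_of_ne_top ENNReal.coe_ne_top, tsub_le_iff_right]
  have h := Real.abs_exp_sub_one_sub_id_le (x := -r) (by simpa using hr1)
  have h' := (abs_le.1 h).2
  simp only [ENNReal.coe_toReal]
  rw [← ENNReal.ofReal_one, ← ENNReal.ofReal_sub _ (Real.exp_pos _).le, ← ENNReal.ofReal_coe_nnreal,
    ← ENNReal.ofReal_pow r.coe_nonneg, ← ENNReal.ofReal_add (by positivity)
      (sub_nonneg.2 (Real.exp_le_one_iff.2 (by simp)))]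
  refine ENNReal.ofReal_le_ofReal ?_
  nlinarith

/-- With N the number of points in C, the indicator of the pair event plus that of N > 0 is at most
N. Taking expectations, the pair probability is at most r − (1 − e^{-r}) with r = ρ(C), which is at
most r². -/
lemma IsPPP.measure_pair_le [IsProbabilityMeasure μ] {ρ : Measure ℝ} (h : IsPPP ρ X μ) {C : Set ℝ} (hC : MeasurableSet C)
    (hC1 : ρ C ≤ 1) {a b : ℕ} (hab : a ≠ b) : μ {ω | X a ω ∈ C ∧ X b ω ∈ C} ≤ ρ C ^ 2 := by
  refine le_trans ?_ (sub_one_sub_expNeg_le hC1)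
  have hm : ∀ m, MeasurableSet {ω | X m ω ∈ C} := fun m => h.measurable m hC
  have hvm : MeasurableSet {ω | ∀ m, X m ω ∉ C} := by
    have : {ω | ∀ m, X m ω ∉ C} = ⋂ m, {ω | X m ω ∈ C}ᶜ := by ext; simp
    rw [this]
    exact MeasurableSet.iInter fun m => (hm m).compl
  rw [← h.void C hC, ← prob_compl_eq_one_sub hvm]
  refine ENNReal.le_sub_of_add_le_right (measure_ne_top _ _) ?_
  have hρ : ρ C = ∑' m, ∫⁻ ω, {ω | X m ω ∈ C}.indicator 1 ω ∂μ := by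
    rw [← h.intensity, Measure.sum_apply _ hC]
    refine tsum_congr fun m => ?_
    rw [lintegral_indicator_one (hm m), Measure.map_apply (h.measurable m) hC]
    rfl
  have hab_m : MeasurableSet {ω | X a ω ∈ C ∧ X b ω ∈ C} := (hm a).inter (hm b)
  rw [hρ, ← lintegral_tsum (fun m => (measurable_one.indicator (hm m)).aemeasurable),
    ← lintegral_indicator_one hab_m, ← lintegral_indicator_one hvm.compl,
    ← lintegral_add_left (measurable_one.indicator hab_m)]
  refine lintegral_mono fun ω => ?_
  by_cases h1 : X a ω ∈ C ∧ X b ω ∈ C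
  · rw [Set.indicator_of_mem (by exact h1), Set.indicator_of_mem (by simpa using ⟨a, h1.1⟩)]
    refine le_trans ?_ (ENNReal.sum_le_tsum {a, b})
    rw [Finset.sum_pair hab, Set.indicator_of_mem (by exact h1.1),
      Set.indicator_of_mem (by exact h1.2)]
  · rw [Set.indicator_of_notMem (by exact h1), zero_add]
    by_cases h2 : ∀ m, X m ω ∉ C
    · rw [Set.indicator_of_notMem (by simpa using h2)]
      exact zero_le
    · rw [Set.indicator_of_mem (by simpa using h2)]
      push Not at h2
      obtain ⟨m, hm⟩ := h2
      refine le_trans ?_ (ENNReal.le_tsum m)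
      rw [Set.indicator_of_mem (by exact hm)]

/-- The range of X b is cut into about MN cells of length 1/M. On the event both points lie in the
union of some cell with its dilation by c, and this union has intensity of order 1/M. The pair bound
gives order M^{-2} for each cell, hence 1/M in total, and M tends to infinity. -/
lemma IsPPP.measure_eq_mul_inter_le [IsProbabilityMeasure μ] (hx : 0 < x) (h : IsPPP (remIntensity x) X μ) {a b : ℕ}
    (hab : a ≠ b) {c : ℝ} (hc : 0 < c) {N : ℕ} (hN : 0 < N) :
    μ {ω | X a ω = c * X b ω ∧ 1 / (N : ℝ) ≤ X b ω ∧ X b ω ≤ N} = 0 := by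
  -- Both a cell and its dilation by c stay above δ, where the density is at most x δ^{-x-1}.
  -- Together they have length at most (1 + c)/M, so D/M bounds the intensity of the union.
  set δ : ℝ := min 1 c / N with hδ
  have hδ0 : 0 < δ := by positivity
  set D : ℝ := x * δ ^ (-x - 1) * (1 + c) with hD
  have hD0 : 0 ≤ D := by positivity
  have key : ∀ M : ℕ, 0 < M → D ≤ M →
      μ {ω | X a ω = c * X b ω ∧ 1 / (N : ℝ) ≤ X b ω ∧ X b ω ≤ N} ≤
        ENNReal.ofReal ((2 * N * D ^ 2) / M) := by
    intro M hM hDM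
    have hM0 : (0 : ℝ) < M := by exact_mod_cast hM
    have hN0 : (1 : ℝ) ≤ N := by exact_mod_cast hN
    have hM1 : (1 : ℝ) ≤ M := by exact_mod_cast hM
    let cell : ℕ → Set ℝ := fun i => Set.Ico ((i : ℝ) / M) ((i + 1 : ℝ) / M) ∩ Set.Ici (1 / (N : ℝ))
    have hcell : ∀ i, MeasurableSet (cell i) := fun i => measurableSet_Ico.inter measurableSet_Ici
    let C : ℕ → Set ℝ := fun i => cell i ∪ (fun t => c⁻¹ * t) ⁻¹' cell i
    have hCm : ∀ i, MeasurableSet (C i) := fun i =>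
      (hcell i).union ((show Measurable fun t : ℝ => c⁻¹ * t by fun_prop) (hcell i))
    have hCδ : ∀ i, C i ⊆ Set.Ici δ := by
      rintro i t (ht | ht)
      · refine le_trans ?_ (show 1 / (N : ℝ) ≤ t from ht.2)
        exact div_le_div_of_nonneg_right (min_le_left _ _) (by positivity)
      · have h1 : 1 / (N : ℝ) ≤ c⁻¹ * t := ht.2
        have h2 : c / N ≤ t := by
          rw [inv_mul_eq_div, le_div_iff₀ hc] at h1
          calc c / N = 1 / N * c := by ring
            _ ≤ t := h1
        exact (div_le_div_of_nonneg_right (min_le_right _ _) (by positivity)).trans h2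
    have hvol : ∀ i, volume (C i) ≤ ENNReal.ofReal ((1 + c) / M) := by
      intro i
      have hv1 : volume (cell i) ≤ ENNReal.ofReal (1 / M) := by
        refine (measure_mono Set.inter_subset_left).trans (le_of_eq ?_)
        rw [Real.volume_Ico]
        congr 1
        ring
      refine (measure_union_le _ _).trans ?_
      rw [Real.volume_preimage_mul_left (inv_pos.2 hc).ne', inv_inv, abs_of_pos hc, add_div,
        ENNReal.ofReal_add (by positivity) (by positivity)]
      refine add_le_add hv1 ((mul_le_mul_right hv1 _).trans (le_of_eq ?_))
      rw [← ENNReal.ofReal_mul hc.le]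
      congr 1
      ring
    have hρ : ∀ i, remIntensity x (C i) ≤ ENNReal.ofReal (D / M) := by
      intro i
      refine (remIntensity_le hx hδ0 (hCm i) (hCδ i)).trans ((mul_le_mul_right (hvol i) _).trans
        (le_of_eq ?_))
      rw [← ENNReal.ofReal_mul (by positivity)]
      congr 1
      rw [hD]
      ring
    have hρ1 : ∀ i, remIntensity x (C i) ≤ 1 := fun i => (hρ i).trans <| by
      rw [← ENNReal.ofReal_one]
      exact ENNReal.ofReal_le_ofReal ((div_le_one hM0).2 hDM)
    calc _ ≤ μ (⋃ i ∈ Finset.range (M * N + 1), {ω | X a ω ∈ C i ∧ X b ω ∈ C i}) := by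
          refine measure_mono ?_
          rintro ω ⟨h1, h2, h3⟩
          have hb0 : 0 ≤ X b ω := le_trans (by positivity) h2
          have hmem : X b ω ∈ cell ⌊M * X b ω⌋₊ := by
            refine ⟨⟨?_, ?_⟩, h2⟩
            · rw [div_le_iff₀ hM0, mul_comm]
              exact Nat.floor_le (by positivity)
            · rw [lt_div_iff₀ hM0, mul_comm]
              exact Nat.lt_floor_add_one _
          refine Set.mem_biUnion (x := ⌊M * X b ω⌋₊) ?_ ⟨Or.inr ?_, Or.inl hmem⟩
          · rw [Finset.mem_coe, Finset.mem_range, Nat.lt_succ_iff]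
            refine Nat.floor_le_of_le ?_
            push_cast
            gcongr
          · change c⁻¹ * X a ω ∈ cell ⌊M * X b ω⌋₊
            rwa [h1, inv_mul_cancel_left₀ hc.ne']
      _ ≤ ∑ i ∈ Finset.range (M * N + 1), μ {ω | X a ω ∈ C i ∧ X b ω ∈ C i} :=
          measure_biUnion_finset_le _ _
      _ ≤ ∑ i ∈ Finset.range (M * N + 1), ENNReal.ofReal (D / M) ^ 2 := by
          refine Finset.sum_le_sum fun i _ => (h.measure_pair_le (hCm i) (hρ1 i) hab).trans ?_
          gcongr
          exact hρ i
      _ = ENNReal.ofReal ((M * N + 1) * (D / M) ^ 2) := by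
          rw [Finset.sum_const, Finset.card_range, nsmul_eq_mul, ← ENNReal.ofReal_pow
            (by positivity), ← ENNReal.ofReal_natCast, ← ENNReal.ofReal_mul (by positivity)]
          push_cast
          rfl
      _ ≤ _ := by
          refine ENNReal.ofReal_le_ofReal ?_
          have : (M * N + 1 : ℝ) ≤ 2 * N * M := by nlinarith
          calc (M * N + 1 : ℝ) * (D / M) ^ 2 ≤ 2 * N * M * (D / M) ^ 2 := by gcongr
            _ = 2 * N * D ^ 2 / M := by field_simp
  have hlim : Filter.Tendsto (fun M : ℕ => ENNReal.ofReal ((2 * N * D ^ 2) / M)) Filter.atTop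
      (nhds 0) := by
    rw [← ENNReal.ofReal_zero]
    exact ENNReal.tendsto_ofReal (tendsto_const_div_atTop_nhds_zero_nat _)
  refine le_antisymm (ge_of_tendsto hlim ?_) zero_le
  filter_upwards [Filter.eventually_gt_atTop 0,
    tendsto_natCast_atTop_atTop.eventually (Filter.eventually_ge_atTop D)] with M h1 h2
  exact key M h1 h2

lemma IsPPP.ae_pos (h : IsPPP (remIntensity x) X μ) : ∀ᵐ ω ∂μ, ∀ m, 0 < X m ω := by
  filter_upwards [ae_forall_notMem_of_intensity h.measurable h.intensity measurableSet_Iic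
    (remIntensity_Iic_zero x)] with ω hω m
  simpa using hω m

/-- The ratio of two different points of a REM has no atoms. -/
lemma IsPPP.ae_ne_mul [IsProbabilityMeasure μ] (hx : 0 < x) (h : IsPPP (remIntensity x) X μ) {a b : ℕ} (hab : a ≠ b) {c : ℝ}
    (hc : 0 < c) : ∀ᵐ ω ∂μ, X a ω ≠ c * X b ω := by
  have h1 : ∀ᵐ ω ∂μ, ∀ N : ℕ,
      ω ∉ {ω | X a ω = c * X b ω ∧ 1 / ((N + 1 : ℕ) : ℝ) ≤ X b ω ∧ X b ω ≤ (N + 1 : ℕ)} :=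
    ae_all_iff.2 fun N => measure_eq_zero_iff_ae_notMem.1
      (h.measure_eq_mul_inter_le hx hab hc N.succ_pos)
  filter_upwards [h1, h.ae_pos] with ω h1 h2 heq
  obtain ⟨n1, hn1⟩ := exists_nat_one_div_lt (h2 b)
  obtain ⟨n2, hn2⟩ := exists_nat_ge (X b ω)
  refine h1 (max n1 n2) ⟨heq, le_trans ?_ hn1.le, hn2.trans ?_⟩
  · exact one_div_le_one_div_of_le (by positivity)
      (by exact_mod_cast Nat.succ_le_succ (le_max_left _ _))
  · exact_mod_cast (le_max_right n1 n2).trans (Nat.le_succ _)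

end PPP


/-! ### Listing a family of weights in descending order. -/

section Rank

variable {A : Type*}

/-- The weights are positive, distinct, and only finitely many of them exceed any given level. -/
structure Rankable (w : A → ℝ) : Prop where
  pos : ∀ a, 0 < w a
  injective : Function.Injective w
  finite : ∀ t > 0, {b | t < w b}.Finite

lemma WellOrdered.rankable {w : A → ℝ} (h : WellOrdered w) : Rankable w := by
  refine ⟨h.1, h.2.1, fun t ht => ?_⟩
  have := h.2.2.tendsto_cofinite_zero.eventually (gt_mem_nhds ht)
  rw [Filter.eventually_cofinite] at this
  exact this.subset fun b hb => not_lt.2 (le_of_lt hb)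

lemma encard_eq_of_add_one_eq {a : ℕ∞} {n : ℕ} (h : a + 1 = ((n + 1 : ℕ) : ℕ∞)) : a = n := by
  have ha : a ≠ ⊤ := by
    rintro rfl
    rw [top_add] at h
    exact ENat.natCast_ne_top _ h.symm
  lift a to ℕ using ha
  have h' : a + 1 = n + 1 := by exact_mod_cast h
  exact_mod_cast Nat.succ_injective h'

namespace Rankable

variable {w : A → ℝ} (h : Rankable w)
include h

lemma finite_above (a : A) : {b | w a < w b}.Finite := h.finite _ (h.pos a)

lemma eq_of_encard_eq {a b : A} (hab : {c | w a < w c}.encard = {c | w b < w c}.encard) :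
    a = b := by
  wlog hlt : w a < w b generalizing a b
  · rcases lt_trichotomy (w a) (w b) with h1 | h1 | h1
    · exact this hab h1
    · exact h.injective h1
    · exact (this hab.symm h1).symm
  exfalso
  have hss : {c | w b < w c} ⊂ {c | w a < w c} :=
    ⟨fun c hc => hlt.trans hc, fun hcon => lt_irrefl (w b) (hcon hlt)⟩
  exact absurd hab ((h.finite_above b).encard_lt_encard hss).ne'

/-- The index of the smallest weight above w a has rank one less; the minimum exists because only
finitely many weights are larger. -/
lemma exists_encard_pred {a : A} {n : ℕ} (ha : {c | w a < w c}.encard = ((n + 1 : ℕ) : ℕ∞)) :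
    ∃ b, {c | w b < w c}.encard = (n : ℕ∞) := by
  have hne : {c | w a < w c}.Nonempty := by
    rw [← Set.encard_ne_zero, ha]
    exact_mod_cast n.succ_ne_zero
  obtain ⟨b, hb, hmin⟩ := Set.exists_min_image _ w (h.finite_above a) hne
  refine ⟨b, ?_⟩
  have heq : {c | w a < w c} = insert b {c | w b < w c} := by
    ext c
    refine ⟨fun hc => ?_, ?_⟩
    · rcases (hmin c hc).lt_or_eq with h1 | h1
      · exact Or.inr h1
      · exact Or.inl (h.injective h1.symm)
    · rintro (rfl | hc)
      · exact hb
      · exact lt_trans (show w a < w b from hb) hc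
  have hb' : b ∉ {c | w b < w c} := fun hc => lt_irrefl (w b) hc
  rw [heq, Set.encard_insert_of_notMem hb'] at ha
  exact encard_eq_of_add_one_eq ha

lemma exists_encard_le {a : A} : ∀ {m n : ℕ}, n ≤ m → {c | w a < w c}.encard = (m : ℕ∞) →
    ∃ b, {c | w b < w c}.encard = (n : ℕ∞) := by
  intro m n hnm
  induction m, hnm using Nat.le_induction generalizing a with
  | base => exact fun ha => ⟨a, ha⟩
  | succ m _ ih =>
    intro ha
    obtain ⟨b, hb⟩ := h.exists_encard_pred ha
    exact ih hb

/-- The rank is an injective function on an infinite set, hence unbounded; descending one rank at a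
time from a large rank reaches n. -/
lemma exists_encard_eq [Infinite A] (n : ℕ) : ∃ b, {c | w b < w c}.encard = (n : ℕ∞) := by
  let r : A → ℕ := fun a => {c | w a < w c}.encard.toNat
  have hr : ∀ a, {c | w a < w c}.encard = (r a : ℕ∞) := fun a =>
    (ENat.natCast_toNat (h.finite_above a).encard_lt_top.ne).symm
  have hinj : Function.Injective r := fun a b hab =>
    h.eq_of_encard_eq (by rw [hr, hr, hab])
  obtain ⟨_, ⟨a, rfl⟩, ha⟩ := (Set.infinite_range_of_injective hinj).exists_gt n
  exact h.exists_encard_le ha.le (hr a)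

lemma rankIndex_spec [Infinite A] (n : ℕ) :
    {c | w (rankIndex w n) < w c}.encard = (n : ℕ∞) :=
  Classical.epsilon_spec (h.exists_encard_eq n)

lemma rankIndex_eq_iff [Infinite A] {n : ℕ} {a : A} :
    rankIndex w n = a ↔ {c | w a < w c}.encard = (n : ℕ∞) := by
  refine ⟨fun ha => ha ▸ h.rankIndex_spec n, fun ha => h.eq_of_encard_eq ?_⟩
  rw [h.rankIndex_spec n, ha]

lemma rankIndex_bijective [Infinite A] : Function.Bijective (rankIndex w) := by
  refine ⟨fun m n hmn => ?_, fun a => ?_⟩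
  · have := h.rankIndex_spec m
    rw [hmn, h.rankIndex_spec n] at this
    exact_mod_cast this.symm
  · refine ⟨{c | w a < w c}.encard.toNat, h.rankIndex_eq_iff.2 ?_⟩
    exact (ENat.natCast_toNat (h.finite_above a).encard_lt_top.ne).symm

lemma comp_equiv (σ : A ≃ A) : Rankable (w ∘ σ) :=
  ⟨fun _ => h.pos _, h.injective.comp σ.injective, fun t ht =>
    Set.Finite.preimage (s := {b | t < w b}) σ.injective.injOn (h.finite t ht)⟩

lemma rankIndex_comp [Infinite A] (σ : A ≃ A) (n : ℕ) :
    rankIndex (w ∘ σ) n = σ.symm (rankIndex w n) := by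
  rw [(h.comp_equiv σ).rankIndex_eq_iff, ← h.rankIndex_spec n]
  have : {c | (w ∘ σ) (σ.symm (rankIndex w n)) < (w ∘ σ) c} =
      σ ⁻¹' {c | w (rankIndex w n) < w c} := by
    ext c; simp
  rw [this, Set.encard_preimage_of_bijective σ.bijective]

/-- Expresses the ordered values through counts above a level, which are measurable functions of the
family. -/
lemma lt_rankIndex_iff [Infinite A] (n : ℕ) (t : ℝ) :
    t < w (rankIndex w n) ↔ ((n + 1 : ℕ) : ℕ∞) ≤ {c | t < w c}.encard := by
  have hins : (insert (rankIndex w n) {c | w (rankIndex w n) < w c}).encard = ((n + 1 : ℕ) : ℕ∞) := by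
    have hnot : rankIndex w n ∉ {c | w (rankIndex w n) < w c} := fun hc =>
      lt_irrefl (w (rankIndex w n)) hc
    rw [Set.encard_insert_of_notMem hnot, h.rankIndex_spec]
    simp
  constructor
  · intro ht
    rw [← hins]
    refine Set.encard_le_encard ?_
    rintro c (rfl | hc)
    · exact ht
    · exact ht.trans hc
  · intro hn
    by_contra hcon
    have : {c | t < w c}.encard ≤ n := by
      rw [← h.rankIndex_spec n]
      exact Set.encard_le_encard fun c hc => lt_of_le_of_lt (not_lt.1 hcon) hc
    have h2 : ((n + 1 : ℕ) : ℕ∞) ≤ (n : ℕ∞) := hn.trans this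
    exact absurd (Nat.cast_le.1 h2) (by omega)

end Rankable

end Rank

/-! ### Void probabilities determine the law of the sorted points. -/

section Sorting

open Classical in
/-- The numbers `u 0, u 1, …` listed in descending order, if this is possible. -/
noncomputable def sortSeq (u : ℕ → ℝ) (n : ℕ) : ℝ := if Rankable u then u (rankIndex u n) else 0

/-- The configurations of points with no point in `A`. -/
def voidSet (A : Set ℝ) : Set (ℕ → ℝ) := {u | ∀ m, u m ∉ A}

/-- The `σ`-algebra generated by the void events. -/
@[reducible] def voidSigma : MeasurableSpace (ℕ → ℝ) :=
  MeasurableSpace.generateFrom {V | ∃ A : Set ℝ, MeasurableSet A ∧ V = voidSet A}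

lemma measurableSet_voidSet {A : Set ℝ} (hA : MeasurableSet A) : MeasurableSet (voidSet A) := by
  have : voidSet A = ⋂ m, (fun u : ℕ → ℝ => u m) ⁻¹' Aᶜ := by ext; simp [voidSet]
  rw [this]
  exact MeasurableSet.iInter fun m => measurable_pi_apply m hA.compl

lemma voidSigma_le : voidSigma ≤ MeasurableSpace.pi := by
  refine MeasurableSpace.generateFrom_le ?_
  rintro _ ⟨A, hA, rfl⟩
  exact measurableSet_voidSet hA

lemma isPiSystem_voidSet :
    IsPiSystem {V | ∃ A : Set ℝ, MeasurableSet A ∧ V = voidSet A} := by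
  rintro _ ⟨A, hA, rfl⟩ _ ⟨B, hB, rfl⟩ _
  refine ⟨A ∪ B, hA.union hB, ?_⟩
  ext u
  simp only [voidSet, Set.mem_inter_iff, Set.mem_ofPred_eq, Set.mem_union, not_or, forall_and]

/-- For configurations of distinct points, the event that at least `n` points exceed `t`. -/
def exceedSet : ℕ → ℝ → Set (ℕ → ℝ)
  | 0, _ => Set.univ
  | n + 1, t => ⋃ r : {r : ℚ // t < r}, exceedSet n r ∩ (voidSet (Set.Ioc t r))ᶜ

lemma measurableSet_exceedSet (n : ℕ) (t : ℝ) : MeasurableSet[voidSigma] (exceedSet n t) := by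
  induction n generalizing t with
  | zero => exact MeasurableSet.univ
  | succ n ih =>
    rw [exceedSet]
    refine MeasurableSet.iUnion fun r => (ih _).inter (MeasurableSet.compl ?_)
    exact MeasurableSpace.measurableSet_generateFrom ⟨_, measurableSet_Ioc, rfl⟩

/-- Among n + 1 points above t, a rational r separates the lowest from the others: n points lie
above r and at least one lies in (t, r]. Distinctness lets counts be recovered from void events,
which do not see multiplicities. -/
lemma mem_exceedSet_iff {u : ℕ → ℝ} (hu : Function.Injective u) (n : ℕ) (t : ℝ) :
    u ∈ exceedSet n t ↔ (n : ℕ∞) ≤ {m | t < u m}.encard := by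
  induction n generalizing t with
  | zero => simp [exceedSet]
  | succ n ih =>
    simp only [exceedSet, Set.mem_iUnion, Set.mem_inter_iff, ih]
    constructor
    · rintro ⟨⟨r, hr⟩, h1, h2⟩
      simp only [voidSet, Set.mem_compl_iff, Set.mem_ofPred_eq, not_forall, not_not] at h2
      obtain ⟨m, hm⟩ := h2
      have hnot : m ∉ {m | (r : ℝ) < u m} := fun hc => absurd hm.2 (not_le.2 hc)
      have hsub : insert m {m | (r : ℝ) < u m} ⊆ {m | t < u m} := by
        rintro c (rfl | hc)
        · exact hm.1
        · exact lt_trans hr hc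
      refine le_trans ?_ (Set.encard_le_encard hsub)
      rw [Set.encard_insert_of_notMem hnot]
      push_cast
      gcongr
    · intro hn
      obtain ⟨s, hs, hcard⟩ := Set.exists_subset_encard_eq hn
      have hfin : s.Finite := Set.finite_of_encard_eq_coe hcard
      have hne : s.Nonempty := by
        rw [← Set.encard_ne_zero, hcard]
        exact_mod_cast n.succ_ne_zero
      obtain ⟨m, hm, hmin⟩ := Set.exists_min_image s u hfin hne
      have hcard' : (s \ {m}).encard = (n : ℕ∞) := by
        have := Set.encard_sdiff_singleton_add_one hm
        rw [hcard] at this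
        exact encard_eq_of_add_one_eq this
      have hlt : ∀ c ∈ s \ {m}, u m < u c := fun c hc =>
        lt_of_le_of_ne (hmin c hc.1) fun heq => hc.2 (hu heq.symm)
      obtain ⟨r, hr1, hr2⟩ : ∃ r : ℚ, u m ≤ r ∧ ∀ c ∈ s \ {m}, (r : ℝ) < u c := by
        rcases (s \ {m}).eq_empty_or_nonempty with he | hne'
        · obtain ⟨r, hr⟩ := exists_rat_gt (u m)
          exact ⟨r, hr.le, by simp [he]⟩
        · obtain ⟨c, hc, hcmin⟩ := Set.exists_min_image _ u (hfin.subset Set.sdiff_subset) hne'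
          obtain ⟨r, hr1, hr2⟩ := exists_rat_btwn (hlt c hc)
          exact ⟨r, hr1.le, fun c' hc' => hr2.trans_le (hcmin c' hc')⟩
      have htm : t < u m := hs hm
      refine ⟨⟨r, htm.trans_le hr1⟩, ?_, ?_⟩
      · rw [← hcard']
        exact Set.encard_le_encard hr2
      · intro hc
        exact hc m ⟨htm, hr1⟩

lemma Rankable.sortSeq_apply {u : ℕ → ℝ} (hu : Rankable u) (n : ℕ) :
    sortSeq u n = u (rankIndex u n) := if_pos hu

lemma Rankable.lt_sortSeq_iff {u : ℕ → ℝ} (hu : Rankable u) (n : ℕ) (t : ℝ) :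
    t < sortSeq u n ↔ u ∈ exceedSet (n + 1) t := by
  rw [mem_exceedSet_iff hu.injective, hu.sortSeq_apply, hu.lt_rankIndex_iff]

lemma Rankable.exists_sortSeq_eq {u : ℕ → ℝ} (hu : Rankable u) :
    ∃ σ : ℕ ≃ ℕ, sortSeq u = u ∘ σ :=
  ⟨Equiv.ofBijective _ hu.rankIndex_bijective, funext hu.sortSeq_apply⟩

lemma measurableSet_rankable {A : Type*} [Countable A] :
    MeasurableSet {w : A → ℝ | Rankable w} := by
  have hset : {w : A → ℝ | Rankable w} = (⋂ a, {w | 0 < w a}) ∩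
      (⋂ a, ⋂ b, ⋂ _ : a ≠ b, {w | w a ≠ w b}) ∩
      ⋂ n : ℕ, {w | {b | 1 / ((n : ℝ) + 1) < w b}.encard < ⊤} := by
    ext w
    simp only [Set.mem_inter_iff, Set.mem_iInter, Set.mem_ofPred_eq, Set.encard_lt_top_iff]
    constructor
    · intro h
      exact ⟨⟨h.pos, fun a b hab hw => hab (h.injective hw)⟩, fun n => h.finite _ (by positivity)⟩
    · rintro ⟨⟨h1, h2⟩, h3⟩
      refine ⟨h1, fun a b hab => by_contra fun hne => h2 a b hne hab, fun t ht => ?_⟩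
      obtain ⟨n, hn⟩ := exists_nat_one_div_lt ht
      exact (h3 n).subset fun m hm => lt_trans hn hm
  rw [hset]
  refine (MeasurableSet.inter (MeasurableSet.iInter fun a => ?_) (MeasurableSet.iInter fun a =>
    MeasurableSet.iInter fun b => MeasurableSet.iInter fun _ => ?_)).inter
    (MeasurableSet.iInter fun n => ?_)
  · exact measurableSet_lt measurable_const (measurable_pi_apply a)
  · exact (measurableSet_eq_fun (measurable_pi_apply a) (measurable_pi_apply b)).compl
  · have hm : Measurable fun w : A → ℝ => {b | 1 / ((n : ℝ) + 1) < w b}.encard := by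
      refine measurable_encard.comp (measurable_set_iff.2 fun b => ?_)
      exact measurable_mem.2 (measurableSet_lt measurable_const (measurable_pi_apply b))
    exact hm (MeasurableSet.of_discrete (s := Set.Iio ⊤))

lemma measurable_sortSeq : Measurable sortSeq := by
  refine measurable_pi_lambda _ fun n => measurable_of_Ioi fun t => ?_
  have hset : (fun u => sortSeq u n) ⁻¹' Set.Ioi t =
      ({u | Rankable u} ∩ exceedSet (n + 1) t) ∪ ({u | Rankable u}ᶜ ∩ {_u | t < 0}) := by
    ext u
    by_cases hu : Rankable u
    · simp [hu, hu.lt_sortSeq_iff]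
    · simp [hu, sortSeq]
  rw [hset]
  exact (measurableSet_rankable.inter (voidSigma_le _ (measurableSet_exceedSet _ _))).union
    (measurableSet_rankable.compl.inter (MeasurableSet.const _))

/-- On rankable configurations every event that a sorted value exceeds t is an `exceedSet`, so
sorting is measurable for the trace of the σ-algebra of void events. -/
lemma exists_voidSigma_eq_preimage_sortSeq {B : Set (ℕ → ℝ)} (hB : MeasurableSet B) :
    ∃ V, MeasurableSet[voidSigma] V ∧ ∀ u, Rankable u → (sortSeq u ∈ B ↔ u ∈ V) := by
  have hm : @Measurable {u : ℕ → ℝ // Rankable u} (ℕ → ℝ) (voidSigma.comap Subtype.val) _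
      (fun u => sortSeq u) := by
    let _ : MeasurableSpace {u : ℕ → ℝ // Rankable u} := voidSigma.comap Subtype.val
    refine measurable_pi_lambda _ fun n => measurable_of_Ioi fun t => ?_
    refine ⟨exceedSet (n + 1) t, measurableSet_exceedSet _ _, ?_⟩
    ext u
    exact (u.2.lt_sortSeq_iff n t).symm
  obtain ⟨V, hV, hVB⟩ := hm hB
  refine ⟨V, hV, fun u hu => ?_⟩
  have := congrArg (fun s => (⟨u, hu⟩ : {u : ℕ → ℝ // Rankable u}) ∈ s) hVB
  exact Eq.to_iff this.symm

section Law

variable {Ω : Type*} [MeasurableSpace Ω] {μ : Measure Ω} {x : ℝ} {X Y : ℕ → Ω → ℝ}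

lemma IsPPP.ae_rankable [IsProbabilityMeasure μ] (hx : 0 < x)
    (h : IsPPP (remIntensity x) X μ) : ∀ᵐ ω ∂μ, Rankable fun m => X m ω := by
  have hinj : ∀ᵐ ω ∂μ, ∀ a b, a ≠ b → X a ω ≠ X b ω := by
    rw [ae_all_iff]; intro a
    rw [ae_all_iff]; intro b
    rcases eq_or_ne a b with hab | hab
    · simp [hab]
    · filter_upwards [h.ae_ne_mul hx hab one_pos] with ω hω _
      simpa using hω
  have hfin : ∀ᵐ ω ∂μ, ∀ n : ℕ, {m | X m ω ∈ Set.Ioi (1 / ((n : ℝ) + 1))}.Finite :=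
    ae_all_iff.2 fun n => ae_finite_of_intensity h.measurable h.intensity measurableSet_Ioi
      (remIntensity_Ioi_lt_top hx (by positivity)).ne
  filter_upwards [h.ae_pos, hinj, hfin] with ω h1 h2 h3
  refine ⟨h1, fun a b hab => by_contra fun hne => h2 a b hne hab, fun t ht => ?_⟩
  obtain ⟨n, hn⟩ := exists_nat_one_div_lt ht
  exact (h3 n).subset fun m hm => lt_trans hn hm

lemma IsPPP.measurable_pi {ρ : Measure ℝ} (h : IsPPP ρ X μ) : Measurable fun ω m => X m ω :=
  measurable_pi_lambda _ h.measurable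

/-- The law of the points of a Poisson process in descending order is determined by the
intensity. -/
theorem IsPPP.map_sortSeq_eq [IsProbabilityMeasure μ] {Ω' : Type*} [MeasurableSpace Ω']
    {μ' : Measure Ω'} [IsProbabilityMeasure μ'] {Y : ℕ → Ω' → ℝ} (hx : 0 < x)
    (hX : IsPPP (remIntensity x) X μ) (hY : IsPPP (remIntensity x) Y μ') :
    μ.map (fun ω => sortSeq fun m => X m ω) = μ'.map (fun ω => sortSeq fun m => Y m ω) := by
  -- Void events form a π-system, as avoiding A and avoiding B means avoiding A ∪ B. Two laws with
  -- the same void probabilities therefore agree on the σ-algebra generated by them.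
  have hvoid : ∀ V, MeasurableSet[voidSigma] V →
      μ {ω | (fun m => X m ω) ∈ V} = μ' {ω | (fun m => Y m ω) ∈ V} := by
    intro V hV
    have h1 : IsProbabilityMeasure (μ.map fun ω m => X m ω) :=
      Measure.isProbabilityMeasure_map hX.measurable_pi.aemeasurable
    have h2 : IsProbabilityMeasure (μ'.map fun ω m => Y m ω) :=
      Measure.isProbabilityMeasure_map hY.measurable_pi.aemeasurable
    have heq : (μ.map fun ω m => X m ω).trim voidSigma_le =
        (μ'.map fun ω m => Y m ω).trim voidSigma_le := by
      have := isFiniteMeasure_trim (μ := μ.map fun ω m => X m ω) voidSigma_le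
      refine @ext_of_generate_finite _ voidSigma _ _ _ rfl isPiSystem_voidSet this ?_ ?_
      · rintro _ ⟨A, hA, rfl⟩
        have hmA : MeasurableSet[voidSigma] (voidSet A) :=
          MeasurableSpace.measurableSet_generateFrom ⟨A, hA, rfl⟩
        rw [trim_measurableSet_eq _ hmA, trim_measurableSet_eq _ hmA,
          Measure.map_apply hX.measurable_pi (measurableSet_voidSet hA),
          Measure.map_apply hY.measurable_pi (measurableSet_voidSet hA)]
        exact (hX.void A hA).trans (hY.void A hA).symm
      · rw [trim_measurableSet_eq _ MeasurableSet.univ, trim_measurableSet_eq _ MeasurableSet.univ,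
          measure_univ, measure_univ]
    have := congrArg (fun ν => ν V) heq
    rw [trim_measurableSet_eq _ hV, trim_measurableSet_eq _ hV,
      Measure.map_apply hX.measurable_pi (voidSigma_le _ hV),
      Measure.map_apply hY.measurable_pi (voidSigma_le _ hV)] at this
    exact this
  ext B hB
  obtain ⟨V, hV, hVB⟩ := exists_voidSigma_eq_preimage_sortSeq hB
  have hXs : Measurable fun ω => sortSeq fun m => X m ω := measurable_sortSeq.comp hX.measurable_pi
  have hYs : Measurable fun ω => sortSeq fun m => Y m ω := measurable_sortSeq.comp hY.measurable_pi
  rw [Measure.map_apply hXs hB, Measure.map_apply hYs hB]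
  calc _ = μ {ω | (fun m => X m ω) ∈ V} := by
        refine measure_congr ?_
        filter_upwards [hX.ae_rankable hx] with ω hω
        exact propext (hVB _ hω)
    _ = _ := hvoid V hV
    _ = _ := by
        refine measure_congr ?_
        filter_upwards [hY.ae_rankable hx] with ω hω
        exact propext (hVB _ hω).symm

end Law

end Sorting


/-! ### The Gaussian recursion for the functions ψ_j. -/

section Psi

/-- A Lipschitz function grows at most linearly, so the exponential is dominated by a sum of two
exponential functions of z with opposite rates. -/
lemma integrable_exp_lipschitz {f : ℝ → ℝ} {K : ℝ≥0} (hf : LipschitzWith K f) (c s y : ℝ) :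
    Integrable (fun z => Real.exp (c * f (y + s * z))) (gaussianReal 0 1) := by
  have hdom : Integrable (fun z => Real.exp (c * f y) *
      (Real.exp (|c| * K * |s| * z) + Real.exp (-(|c| * K * |s|) * z))) (gaussianReal 0 1) :=
    ((integrable_exp_mul_gaussianReal _).add (integrable_exp_mul_gaussianReal _)).const_mul _
  have hcont : Continuous f := hf.continuous
  refine hdom.mono' (by fun_prop) (Filter.Eventually.of_forall fun z => ?_)
  rw [Real.norm_eq_abs, abs_of_pos (Real.exp_pos _)]
  have h1 : |f (y + s * z) - f y| ≤ K * (|s| * |z|) := by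
    have := hf.dist_le_mul (y + s * z) y
    rwa [Real.dist_eq, Real.dist_eq, add_sub_cancel_left, abs_mul] at this
  have h2 : c * f (y + s * z) ≤ c * f y + |c| * K * |s| * |z| := by
    have h3 : c * (f (y + s * z) - f y) ≤ |c| * (K * (|s| * |z|)) :=
      (le_abs_self _).trans (by rw [abs_mul]; gcongr)
    linarith
  calc Real.exp (c * f (y + s * z)) ≤ Real.exp (c * f y + |c| * K * |s| * |z|) :=
        Real.exp_le_exp.2 h2
    _ = Real.exp (c * f y) * Real.exp (|c| * K * |s| * |z|) := Real.exp_add _ _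
    _ ≤ _ := by
        gcongr
        rcases abs_cases z with ⟨h, _⟩ | ⟨h, _⟩
        · rw [h]; linarith [Real.exp_pos (-(|c| * K * |s|) * z)]
        · rw [h, mul_neg, ← neg_mul]; linarith [Real.exp_pos (|c| * K * |s| * z)]

lemma integral_exp_lipschitz_pos {f : ℝ → ℝ} {K : ℝ≥0} (hf : LipschitzWith K f) (c s y : ℝ) :
    0 < ∫ z, Real.exp (c * f (y + s * z)) ∂(gaussianReal 0 1) :=
  integral_exp_pos (integrable_exp_lipschitz hf c s y)

/-- Moving y to y' changes the exponent by at most x K |y − y'| for every z; the logarithm and the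
factor 1/x return exactly K. Thus integrability persists through the recursion. -/
lemma LipschitzWith.logMoment {f : ℝ → ℝ} {K : ℝ≥0} (hf : LipschitzWith K f) {x : ℝ} (hx : 0 < x)
    (s : ℝ) : LipschitzWith K (RPC.logMoment x s f) := by
  refine LipschitzWith.of_le_add_mul K fun y y' => ?_
  have hint := fun y => integrable_exp_lipschitz hf x (Real.sqrt s) y
  have hle : ∫ z, Real.exp (x * f (y + Real.sqrt s * z)) ∂(gaussianReal 0 1) ≤
      Real.exp (x * (K * dist y y')) *
        ∫ z, Real.exp (x * f (y' + Real.sqrt s * z)) ∂(gaussianReal 0 1) := by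
    rw [← integral_const_mul]
    refine integral_mono (hint y) ((hint y').const_mul _) fun z => ?_
    simp only
    rw [← Real.exp_add]
    refine Real.exp_le_exp.2 ?_
    have := hf.dist_le_mul (y + Real.sqrt s * z) (y' + Real.sqrt s * z)
    rw [dist_add_right, Real.dist_eq] at this
    have := (le_abs_self _).trans this
    nlinarith
  have hlog := Real.log_le_log (integral_exp_lipschitz_pos hf x (Real.sqrt s) y) hle
  rw [Real.log_mul (Real.exp_pos _).ne' (integral_exp_lipschitz_pos hf x (Real.sqrt s) y').ne',
    Real.log_exp] at hlog
  unfold RPC.logMoment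
  calc _ ≤ 1 / x * (x * (K * dist y y') +
        Real.log (∫ z, Real.exp (x * f (y' + Real.sqrt s * z)) ∂(gaussianReal 0 1))) := by gcongr
    _ = _ := by field_simp; ring

/-- `logMoment` is the constant whose subtraction normalises the moment of order x. This is the
moment hypothesis of the marking theorem. -/
lemma lintegral_exp_sub_logMoment {f : ℝ → ℝ} {K : ℝ≥0} (hf : LipschitzWith K f) {x : ℝ}
    (hx : 0 < x) (s y : ℝ) :
    ∫⁻ z, ENNReal.ofReal (Real.exp (f (y + Real.sqrt s * z) - logMoment x s f y)) ^ x
      ∂(gaussianReal 0 1) = 1 := by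
  have hpos := integral_exp_lipschitz_pos hf x (Real.sqrt s) y
  have hint := integrable_exp_lipschitz hf x (Real.sqrt s) y
  have h1 : ∀ z, ENNReal.ofReal (Real.exp (f (y + Real.sqrt s * z) - logMoment x s f y)) ^ x =
      ENNReal.ofReal (Real.exp (x * f (y + Real.sqrt s * z)) *
        (∫ z, Real.exp (x * f (y + Real.sqrt s * z)) ∂(gaussianReal 0 1))⁻¹) := by
    intro z
    rw [ENNReal.ofReal_rpow_of_pos (Real.exp_pos _), ← Real.exp_mul, sub_mul, sub_eq_add_neg,
      Real.exp_add, mul_comm _ x]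
    congr 2
    rw [logMoment, Real.exp_neg, mul_assoc, mul_comm, mul_assoc, mul_one_div_cancel hx.ne', mul_one,
      Real.exp_log hpos]
  simp_rw [h1]
  rw [← ofReal_integral_eq_lintegral_ofReal (hint.mul_const _)
    (Filter.Eventually.of_forall fun z => by positivity), integral_mul_const,
    mul_inv_cancel₀ hpos.ne', ENNReal.ofReal_one]

variable {k : ℕ}

lemma psiLevel_last (x : Fin k → ℝ) (q : Fin (k + 1) → ℝ) (ψ : ℝ → ℝ) :
    psiLevel x q ψ (Fin.last k) = ψ :=
  Fin.reverseInduction_last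

lemma psiLevel_castSucc (x : Fin k → ℝ) (q : Fin (k + 1) → ℝ) (ψ : ℝ → ℝ) (i : Fin k) :
    psiLevel x q ψ i.castSucc =
      logMoment (x i) (q i.succ - q i.castSucc) (psiLevel x q ψ i.succ) :=
  Fin.reverseInduction_castSucc (motive := fun _ => ℝ → ℝ) i

/-- The recursion runs down from the last level and reaches levels 1, …, k+1 without using the first
parameter, so the tails of x and q suffice for the subtrees. -/
lemma psiLevel_succ (x : Fin (k + 1) → ℝ) (q : Fin (k + 2) → ℝ) (ψ : ℝ → ℝ) (j : Fin (k + 1)) :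
    psiLevel x q ψ j.succ = psiLevel (Fin.tail x) (Fin.tail q) ψ j := by
  induction j using Fin.reverseInduction with
  | last => rw [psiLevel_last, Fin.succ_last, psiLevel_last]
  | cast i ih =>
    rw [psiLevel_castSucc, ← ih, Fin.succ_castSucc, psiLevel_castSucc]
    rfl

lemma lipschitzWith_psiLevel {x : Fin k → ℝ} (hx : ∀ n, 0 < x n) (q : Fin (k + 1) → ℝ)
    {ψ : ℝ → ℝ} {K : ℝ≥0} (hψ : LipschitzWith K ψ) (j : Fin (k + 1)) :
    LipschitzWith K (psiLevel x q ψ j) := by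
  induction j using Fin.reverseInduction with
  | last => rwa [psiLevel_last]
  | cast i ih =>
    rw [psiLevel_castSucc]
    exact LipschitzWith.logMoment ih (hx i) _

lemma logMoment_zero {x : ℝ} (s : ℝ) : logMoment x s (fun _ => 0) = fun _ => 0 := by
  ext y
  simp [logMoment]

/-- With ψ = 0 the result on perturbed weights becomes a description of the unperturbed ones. -/
lemma psiLevel_zero_fun (x : Fin k → ℝ) (q : Fin (k + 1) → ℝ) (j : Fin (k + 1)) :
    psiLevel x q (fun _ => 0) j = fun _ => 0 := by
  induction j using Fin.reverseInduction with
  | last => rw [psiLevel_last]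
  | cast i ih => rw [psiLevel_castSucc, ih, logMoment_zero]

end Psi

/-! ### Trees, their decomposition at the root, and their automorphisms. -/

section Tree

variable {k : ℕ}

/-- A family of sequences of real numbers, one for each address of length less than `k`. -/
abbrev Tree (k : ℕ) := (n : Fin k) → (Fin n → ℕ) → ℕ → ℝ

/-- The addresses of length less than `k`. -/
abbrev Node (k : ℕ) := Σ n : Fin k, (Fin n → ℕ)

/-- The product of the numbers along the path `α`. -/
noncomputable def treeWeight (D : Tree k) (α : Fin k → ℕ) : ℝ := ∏ n, D n (prefixOf α n) (α n)

/-- The sum along the path `α` of the numbers with variances given by the increments of `q`. -/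
noncomputable def treeField (q : Fin (k + 1) → ℝ) (D : Tree k) (α : Fin k → ℕ) : ℝ :=
  ∑ n : Fin k, Real.sqrt (q n.succ - q n.castSucc) * D n (prefixOf α n) (α n)

/-- The perturbed weights of a tree. -/
noncomputable def perturbed (ψ : ℝ → ℝ) (q : Fin (k + 1) → ℝ) (y : ℝ) (X Z : Tree k)
    (α : Fin k → ℕ) : ℝ :=
  Real.exp (ψ (y + treeField q Z α)) * treeWeight X α

/-- The empty address. -/
def rootAddress : Fin ((0 : Fin (k + 1)) : ℕ) → ℕ := fun i => absurd i.2 (by simp)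

/-- The sequence at the root of a tree. -/
def treeRoot (D : Tree (k + 1)) : ℕ → ℝ := D 0 rootAddress

/-- The subtree attached to the child `m` of the root. -/
def treeSub (D : Tree (k + 1)) (m : ℕ) : Tree k :=
  fun n a => D n.succ (Fin.cons m a : Fin (n + 1) → ℕ)

/-- The weights of a tree in terms of the numbers at the root and of the weights of the subtrees. -/
def glue (u : ℕ → ℝ) (W : ℕ → (Fin k → ℕ) → ℝ) (α : Fin (k + 1) → ℕ) : ℝ :=
  u (α 0) * W (α 0) (Fin.tail α)

lemma prefixOf_zero (α : Fin (k + 1) → ℕ) : prefixOf α 0 = rootAddress := by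
  ext i
  exact absurd i.2 (by simp)

lemma prefixOf_succ (α : Fin (k + 1) → ℕ) (n : Fin k) :
    prefixOf α n.succ = (Fin.cons (α 0) (prefixOf (Fin.tail α) n) : Fin (n + 1) → ℕ) := by
  ext i
  refine Fin.cases ?_ (fun i => ?_) i
  · rfl
  · rfl

lemma treeWeight_succ (D : Tree (k + 1)) (α : Fin (k + 1) → ℕ) :
    treeWeight D α = treeRoot D (α 0) * treeWeight (treeSub D (α 0)) (Fin.tail α) := by
  rw [treeWeight, Fin.prod_univ_succ, prefixOf_zero]
  simp_rw [prefixOf_succ]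
  rfl

lemma treeField_succ (q : Fin (k + 2) → ℝ) (D : Tree (k + 1)) (α : Fin (k + 1) → ℕ) :
    treeField q D α = Real.sqrt (q (Fin.succ 0) - q (Fin.castSucc 0)) * treeRoot D (α 0) +
      treeField (Fin.tail q) (treeSub D (α 0)) (Fin.tail α) := by
  rw [treeField, Fin.sum_univ_succ, prefixOf_zero]
  simp_rw [prefixOf_succ]
  rfl

/-- The mark of a child of the root only shifts the starting value of the field in its subtree. This
is the reason for the parameter y. -/
lemma perturbed_succ (ψ : ℝ → ℝ) (q : Fin (k + 2) → ℝ) (y : ℝ) (X Z : Tree (k + 1)) :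
    perturbed ψ q y X Z = glue (treeRoot X) fun m => perturbed ψ (Fin.tail q)
      (y + Real.sqrt (q (Fin.succ 0) - q (Fin.castSucc 0)) * treeRoot Z m)
      (treeSub X m) (treeSub Z m) := by
  ext α
  rw [perturbed, treeWeight_succ, treeField_succ, glue, perturbed, ← add_assoc]
  ring

/-- The permutation of the addresses preserves the length of the common initial segments. -/
def IsTreeAut (σ : Equiv.Perm (Fin k → ℕ)) : Prop :=
  ∀ α β (j : ℕ), (∀ i : Fin k, (i : ℕ) < j → σ α i = σ β i) ↔ ∀ i : Fin k, (i : ℕ) < j → α i = β i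

/-- The permutation of addresses made of a permutation of the first entries and of permutations of
the subtrees. -/
def gluePerm (π : Equiv.Perm ℕ) (τ : ℕ → Equiv.Perm (Fin k → ℕ)) :
    Equiv.Perm (Fin (k + 1) → ℕ) where
  toFun α := Fin.cons (π (α 0)) (τ (α 0) (Fin.tail α))
  invFun β := Fin.cons (π.symm (β 0)) ((τ (π.symm (β 0))).symm (Fin.tail β))
  left_inv α := by simp
  right_inv β := by simp

lemma gluePerm_zero (π : Equiv.Perm ℕ) (τ : ℕ → Equiv.Perm (Fin k → ℕ)) (α : Fin (k + 1) → ℕ) :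
    gluePerm π τ α 0 = π (α 0) := rfl

/-- Paths with a common first entry m are sent to the same child and both moved by τ m; paths with
different first entries remain separated, as π is injective. -/
lemma isTreeAut_gluePerm (π : Equiv.Perm ℕ) {τ : ℕ → Equiv.Perm (Fin k → ℕ)}
    (hτ : ∀ m, IsTreeAut (τ m)) : IsTreeAut (gluePerm π τ) := by
  intro α β j
  rcases j with _ | j
  · simp
  simp only [Fin.forall_fin_succ, gluePerm_zero, Fin.val_zero, Fin.val_succ, Nat.zero_lt_succ,
    forall_const, EmbeddingLike.apply_eq_iff_eq, Nat.add_lt_add_iff_right]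
  refine and_congr_right fun h0 => ?_
  have := hτ (α 0) (Fin.tail α) (Fin.tail β) j
  refine Iff.trans ?_ this
  change (∀ i : Fin k, (i : ℕ) < j → τ (α 0) (Fin.tail α) i = τ (β 0) (Fin.tail β) i) ↔ _
  rw [h0]

lemma IsTreeAut.refl : IsTreeAut (Equiv.refl (Fin k → ℕ)) := fun _ _ _ => Iff.rfl

/-- The function of a family of weights does not change if the addresses of each of the trees are
permuted by an automorphism. -/
def TreeInvariant {J E : Type*} (F : (J → (Fin k → ℕ) → ℝ) → E) : Prop :=
  ∀ τ : J → Equiv.Perm (Fin k → ℕ), (∀ j, IsTreeAut (τ j)) →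
    ∀ w, F (fun j => w j ∘ τ j) = F w

lemma measurable_treeWeight (α : Fin k → ℕ) : Measurable fun D : Tree k => treeWeight D α := by
  unfold treeWeight; fun_prop

lemma measurable_treeField (q : Fin (k + 1) → ℝ) (α : Fin k → ℕ) :
    Measurable fun D : Tree k => treeField q D α := by
  unfold treeField; fun_prop

lemma measurable_perturbed {ψ : ℝ → ℝ} (hψ : Measurable ψ) (q : Fin (k + 1) → ℝ) :
    Measurable fun p : ℝ × Tree k × Tree k => perturbed ψ q p.1 p.2.1 p.2.2 := by
  refine measurable_pi_lambda _ fun α => ?_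
  unfold perturbed
  have h1 := measurable_treeWeight α
  have h2 := measurable_treeField q α
  fun_prop

lemma measurable_glue : Measurable fun p : (ℕ → ℝ) × (ℕ → (Fin k → ℕ) → ℝ) => glue p.1 p.2 := by
  refine measurable_pi_lambda _ fun α => ?_
  unfold glue
  fun_prop

lemma Measurable.glue {E : Type*} [MeasurableSpace E] {f : E → ℕ → ℝ}
    {g : E → ℕ → (Fin k → ℕ) → ℝ} (hf : Measurable f) (hg : Measurable g) :
    Measurable fun e => RPC.glue (f e) (g e) :=
  measurable_glue.comp (hf.prodMk hg)

end Tree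


/-! ### Independence of subfamilies and pairing of product measures. -/

section IndependenceAux

lemma comap_pi_le_iSup {Ω ι A : Type*} {β : ι → Type*} [mβ : ∀ i, MeasurableSpace (β i)]
    (f : ∀ i, Ω → β i) (g : A → ι) :
    MeasurableSpace.comap (fun ω a => f (g a) ω) MeasurableSpace.pi ≤
      ⨆ i ∈ Set.range g, MeasurableSpace.comap (f i) (mβ i) := by
  rw [MeasurableSpace.pi, MeasurableSpace.comap_iSup]
  refine iSup_le fun a => ?_
  rw [MeasurableSpace.comap_comp]
  exact le_iSup₂_of_le (f := fun i _ => MeasurableSpace.comap (f i) (mβ i)) (g a) ⟨a, rfl⟩ le_rfl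

variable {Ω : Type*} [MeasurableSpace Ω] {μ : Measure Ω}

/-- Subfamilies of an independent family with disjoint index sets are independent. -/
lemma indepFun_of_disjoint_range {ι A B : Type*} {β : ι → Type*}
    [mβ : ∀ i, MeasurableSpace (β i)] {f : ∀ i, Ω → β i} (hf : iIndepFun f μ)
    (hm : ∀ i, Measurable (f i)) (g : A → ι) (h : B → ι) (hgh : ∀ a b, g a ≠ h b) :
    IndepFun (fun ω a => f (g a) ω) (fun ω b => f (h b) ω) μ := by
  have hd : Disjoint (Set.range g) (Set.range h) := by
    rw [Set.disjoint_left]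
    rintro _ ⟨a, rfl⟩ ⟨b, hb⟩
    exact hgh a b hb.symm
  have key := indep_iSup_of_disjoint (fun i => (hm i).comap_le) hf.iIndep hd
  rw [IndepFun_iff_Indep]
  exact indep_of_indep_of_le_left (indep_of_indep_of_le_right key (comap_pi_le_iSup f h))
    (comap_pi_le_iSup f g)

/-- Pairing the coordinates of two independent product measures gives a product measure. -/
lemma infinitePi_prod_map_pair {ι : Type*} {A B : ι → Type*} [∀ i, MeasurableSpace (A i)]
    [∀ i, MeasurableSpace (B i)] (P : ∀ i, Measure (A i)) (Q : ∀ i, Measure (B i))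
    [∀ i, IsProbabilityMeasure (P i)] [∀ i, IsProbabilityMeasure (Q i)] :
    ((Measure.infinitePi P).prod (Measure.infinitePi Q)).map (fun p i => (p.1 i, p.2 i)) =
      Measure.infinitePi fun i => (P i).prod (Q i) := by
  have hm : Measurable fun (p : (∀ i, A i) × (∀ i, B i)) i => (p.1 i, p.2 i) := by fun_prop
  refine Measure.eq_infinitePi _ fun s t ht => ?_
  have hbox : MeasurableSet (Set.pi (s : Set ι) t) :=
    MeasurableSet.pi s.countable_toSet fun i _ => ht i
  rw [Measure.map_apply hm hbox, Measure.prod_apply (hm hbox)]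
  have h1 : ∀ u : ∀ i, A i, Measure.infinitePi Q
      (Prod.mk u ⁻¹' ((fun (p : (∀ i, A i) × (∀ i, B i)) i => (p.1 i, p.2 i)) ⁻¹'
        Set.pi (s : Set ι) t)) = ∏ i ∈ s, Q i (Prod.mk (u i) ⁻¹' t i) := by
    intro u
    rw [← Measure.infinitePi_pi Q fun i _ => measurable_prodMk_left (ht i)]
    rfl
  simp_rw [h1]
  -- For fixed u the section of the box has probability a product of functions of the single
  -- coordinates u i, and these are independent.
  rw [lintegral_prod_eq_prod_lintegral_of_indepFun s
    (fun i (u : ∀ i, A i) => Q i (Prod.mk (u i) ⁻¹' t i))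
    (iIndepFun_infinitePi (X := fun i a => Q i (Prod.mk a ⁻¹' t i))
      fun i => measurable_measure_prodMk_left (ht i))
    fun i => (measurable_measure_prodMk_left (ht i)).comp (measurable_pi_apply i)]
  refine Finset.prod_congr rfl fun i _ => ?_
  rw [Measure.prod_apply (ht i), ← Measure.infinitePi_map_eval P i,
    lintegral_map (measurable_measure_prodMk_left (ht i)) (measurable_pi_apply i)]

end IndependenceAux

/-! ### The reference law of the weights of a tree. -/

section Canonical

/-- The law of the weights of a tree whose sequences at the nodes are independent, with laws
`κ n` at level `n`. -/
noncomputable def canonLaw : (k : ℕ) → (Fin k → Measure (ℕ → ℝ)) → Measure ((Fin k → ℕ) → ℝ)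
  | 0, _ => Measure.dirac fun _ => 1
  | k + 1, κ => ((κ 0).prod (Measure.infinitePi fun _ : ℕ => canonLaw k (Fin.tail κ))).map
      fun p => glue p.1 p.2

lemma isProbabilityMeasure_canonLaw {k : ℕ} (κ : Fin k → Measure (ℕ → ℝ))
    (hκ : ∀ n, IsProbabilityMeasure (κ n)) : IsProbabilityMeasure (canonLaw k κ) := by
  induction k with
  | zero => unfold canonLaw; infer_instance
  | succ k ih =>
    have := ih (Fin.tail κ) fun n => hκ n.succ
    have := hκ 0
    exact Measure.isProbabilityMeasure_map measurable_glue.aemeasurable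

/-- Integration over a forest of independent trees, in terms of their roots and subtrees. -/
lemma lintegral_infinitePi_canonLaw_succ {J : Type*} [Countable J] {k : ℕ}
    (κ : Fin (k + 1) → Measure (ℕ → ℝ)) (hκ : ∀ n, IsProbabilityMeasure (κ n))
    {F : (J → (Fin (k + 1) → ℕ) → ℝ) → ℝ≥0∞} (hF : Measurable F) :
    ∫⁻ W, F W ∂(Measure.infinitePi fun _ : J => canonLaw (k + 1) κ) =
      ∫⁻ S, ∫⁻ W, F (fun j => glue (S j) fun m => W (j, m))
        ∂(Measure.infinitePi fun _ : J × ℕ => canonLaw k (Fin.tail κ))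
        ∂(Measure.infinitePi fun _ : J => κ 0) := by
  have h0 := hκ 0
  have hc := isProbabilityMeasure_canonLaw (Fin.tail κ) fun n => hκ n.succ
  set P := Measure.infinitePi fun _ : J => κ 0
  set Q := Measure.infinitePi fun _ : J × ℕ => canonLaw k (Fin.tail κ)
  have hS : ∀ j, Measurable fun p : (J → ℕ → ℝ) × (J × ℕ → (Fin k → ℕ) → ℝ) =>
      (p.1 j, fun m => p.2 (j, m)) := fun j => by fun_prop
  have hglue : ∀ j, Measurable fun p : (J → ℕ → ℝ) × (J × ℕ → (Fin k → ℕ) → ℝ) =>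
      glue (p.1 j) fun m => p.2 (j, m) := fun j => measurable_glue.comp (hS j)
  have hmap : (P.prod Q).map (fun p j => glue (p.1 j) fun m => p.2 (j, m)) =
      Measure.infinitePi fun _ : J => canonLaw (k + 1) κ := by
    -- The subtrees, indexed by J × ℕ, are regrouped into one sequence for each tree and then paired
    -- with the roots.
    have hQ : Q.map (MeasurableEquiv.curry J ℕ ((Fin k → ℕ) → ℝ)) =
        Measure.infinitePi fun _ : J => Measure.infinitePi fun _ : ℕ => canonLaw k (Fin.tail κ) :=
      Measure.infinitePi_map_curry fun (_ : J) (_ : ℕ) => canonLaw k (Fin.tail κ)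
    have hPair : (P.prod Q).map (fun p j => (p.1 j, fun m => p.2 (j, m))) =
        Measure.infinitePi fun _ : J =>
          (κ 0).prod (Measure.infinitePi fun _ : ℕ => canonLaw k (Fin.tail κ)) := by
      have hPQ : P.prod (Q.map (MeasurableEquiv.curry J ℕ ((Fin k → ℕ) → ℝ))) =
          (P.prod Q).map (Prod.map id (MeasurableEquiv.curry J ℕ ((Fin k → ℕ) → ℝ))) := by
        rw [← Measure.map_prod_map _ _ measurable_id (MeasurableEquiv.measurable _), Measure.map_id]
      rw [← infinitePi_prod_map_pair, ← hQ, hPQ,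
        Measure.map_map (by fun_prop) (measurable_id.prodMap (MeasurableEquiv.measurable _))]
      rfl
    have : (fun (p : (J → ℕ → ℝ) × (J × ℕ → (Fin k → ℕ) → ℝ)) j =>
        glue (p.1 j) fun m => p.2 (j, m)) = (fun v (j : J) => glue (v j).1 (v j).2) ∘
          fun p j => (p.1 j, fun m => p.2 (j, m)) := rfl
    rw [this, ← Measure.map_map (by
        exact measurable_pi_lambda _ fun j => measurable_glue.comp (measurable_pi_apply j))
      (measurable_pi_lambda _ hS), hPair, Measure.infinitePi_map_pi _ fun _ => measurable_glue]
    rfl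
  rw [← hmap, lintegral_map hF (measurable_pi_lambda _ hglue), lintegral_prod]
  exact (hF.comp (measurable_pi_lambda _ hglue)).aemeasurable

end Canonical

/-! ### Replacing the perturbation by a factor at the root: induction on the depth. -/

section Forest

variable {Ω : Type*} [MeasurableSpace Ω] {μ : Measure Ω}

/-- Independent random trees `X j` of REMs, with independent standard normal marks `Z j`. -/
structure IsMarkedForest {J : Type*} {k : ℕ} (x : Fin k → ℝ) (X Z : J → Ω → Tree k)
    (μ : Measure Ω) : Prop where
  rem : ∀ j n a, IsREM (x n) (fun m ω => X j ω n a m) μ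
  measurable_mark : ∀ j n a, Measurable fun ω => Z j ω n a
  mark_law : ∀ j n a, μ.map (fun ω => Z j ω n a) =
    Measure.infinitePi fun _ : ℕ => gaussianReal 0 1
  mark_indep : ∀ j n a, IndepFun (fun ω => X j ω n a) (fun ω => Z j ω n a) μ
  indep : iIndepFun (fun (p : J × Node k) ω => (X p.1 ω p.2.1 p.2.2, Z p.1 ω p.2.1 p.2.2)) μ

namespace IsMarkedForest

variable {J : Type*} {k : ℕ}

lemma measurable_node {x : Fin k → ℝ} {X Z : J → Ω → Tree k} (h : IsMarkedForest x X Z μ)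
    (p : J × Node k) : Measurable fun ω => (X p.1 ω p.2.1 p.2.2, Z p.1 ω p.2.1 p.2.2) :=
  (measurable_pi_lambda _ (h.rem p.1 p.2.1 p.2.2).measurable).prodMk (h.measurable_mark _ _ _)

/-- The subtrees of a forest indexed by J form a forest indexed by J × ℕ, so the induction
hypothesis applies to all of them at once. -/
lemma sub {x : Fin (k + 1) → ℝ} {X Z : J → Ω → Tree (k + 1)} (h : IsMarkedForest x X Z μ) :
    IsMarkedForest (Fin.tail x) (fun (p : J × ℕ) ω => treeSub (X p.1 ω) p.2)
      (fun (p : J × ℕ) ω => treeSub (Z p.1 ω) p.2) μ where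
  rem p n a := h.rem p.1 n.succ _
  measurable_mark p n a := h.measurable_mark p.1 n.succ _
  mark_law p n a := h.mark_law p.1 n.succ _
  mark_indep p n a := h.mark_indep p.1 n.succ _
  indep := by
    have hinj : Function.Injective fun p : (J × ℕ) × Node k =>
        ((p.1.1, ⟨p.2.1.succ, (Fin.cons p.1.2 p.2.2 : Fin (p.2.1 + 1) → ℕ)⟩) :
          J × Node (k + 1)) := by
      rintro ⟨⟨j, m⟩, ⟨n, a⟩⟩ ⟨⟨j', m'⟩, ⟨n', a'⟩⟩ heq
      simp only [Prod.mk.injEq, Sigma.mk.injEq, Fin.succ_inj] at heq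
      obtain ⟨rfl, rfl, heq⟩ := heq
      obtain ⟨rfl, rfl⟩ := Fin.cons_inj.1 (eq_of_heq heq)
      rfl
    exact h.indep.precomp hinj

/-- The roots and the nodes below them are disjoint sets of nodes. This permits fixing the roots
while integrating over the subtrees. -/
lemma indepFun_root_sub {x : Fin (k + 1) → ℝ} {X Z : J → Ω → Tree (k + 1)}
    (h : IsMarkedForest x X Z μ) :
    IndepFun (fun ω (j : J) => (treeRoot (X j ω), treeRoot (Z j ω)))
      (fun ω (p : J × ℕ) => (treeSub (X p.1 ω) p.2, treeSub (Z p.1 ω) p.2)) μ := by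
  have key := indepFun_of_disjoint_range h.indep h.measurable_node
    (fun j : J => (j, ⟨0, rootAddress⟩))
    (fun p : (J × ℕ) × Node k =>
        ((p.1.1, ⟨p.2.1.succ, (Fin.cons p.1.2 p.2.2 : Fin (p.2.1 + 1) → ℕ)⟩) :
          J × Node (k + 1))) (fun j p heq => by
      simp only [Prod.mk.injEq, Sigma.mk.injEq] at heq
      exact Fin.succ_ne_zero _ heq.2.1.symm)
  exact key.comp (φ := id) (ψ := fun v (p : J × ℕ) =>
    ((fun n a => (v (p, ⟨n, a⟩)).1, fun n a => (v (p, ⟨n, a⟩)).2) : Tree k × Tree k))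
    measurable_id (by fun_prop)

lemma iIndepFun_root {x : Fin (k + 1) → ℝ} {X Z : J → Ω → Tree (k + 1)}
    (h : IsMarkedForest x X Z μ) :
    iIndepFun (fun (j : J) ω => (treeRoot (X j ω), treeRoot (Z j ω))) μ :=
  iIndepFun.precomp (g := fun j : J => ((j, ⟨0, rootAddress⟩) : J × Node (k + 1)))
    (fun _ _ hj => (Prod.mk.inj hj).1) h.indep

lemma measurable_root {x : Fin (k + 1) → ℝ} {X Z : J → Ω → Tree (k + 1)}
    (h : IsMarkedForest x X Z μ) (j : J) :
    Measurable fun ω => (treeRoot (X j ω), treeRoot (Z j ω)) :=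
  h.measurable_node (j, ⟨0, rootAddress⟩)

lemma measurable_tree {x : Fin k → ℝ} {X Z : J → Ω → Tree k} (h : IsMarkedForest x X Z μ)
    (j : J) : Measurable fun ω => (X j ω, Z j ω) :=
  (measurable_pi_lambda _ fun n => measurable_pi_lambda _ fun a =>
    measurable_pi_lambda _ (h.rem j n a).measurable).prodMk
  (measurable_pi_lambda _ fun n => measurable_pi_lambda _ fun a => h.measurable_mark j n a)

end IsMarkedForest

/-- The integral over the subtrees does not depend on the order of the points at the roots. -/
lemma lintegral_glue_comp_perm {J : Type*} {k : ℕ} {P : Measure ((Fin k → ℕ) → ℝ)}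
    [IsProbabilityMeasure P] {F : (J → (Fin (k + 1) → ℕ) → ℝ) → ℝ≥0∞} (hF : Measurable F)
    (hinv : TreeInvariant F) (c : J → ℝ) (S : J → ℕ → ℝ) (π : J → Equiv.Perm ℕ) :
    ∫⁻ W, F (fun j α => c j * glue (S j ∘ π j) (fun m => W (j, m)) α)
        ∂(Measure.infinitePi fun _ : J × ℕ => P) =
      ∫⁻ W, F (fun j α => c j * glue (S j) (fun m => W (j, m)) α)
        ∂(Measure.infinitePi fun _ : J × ℕ => P) := by
  have hm : ∀ S : J → ℕ → ℝ, Measurable fun W : J × ℕ → (Fin k → ℕ) → ℝ =>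
      F (fun j α => c j * glue (S j) (fun m => W (j, m)) α) := by
    intro S
    refine hF.comp (measurable_pi_lambda _ fun j => measurable_pi_lambda _ fun α => ?_)
    unfold glue
    fun_prop
  have hinj : Function.Injective fun p : J × ℕ => (p.1, π p.1 p.2) := by
    rintro ⟨j, m⟩ ⟨j', m'⟩ h
    simp only [Prod.mk.injEq] at h
    obtain ⟨rfl, h⟩ := h
    exact Prod.ext rfl ((π j).injective h)
  -- Injective relabelling of i.i.d. coordinates preserves their law, so W (j, m) may be replaced by
  -- W (j, π j m).
  conv_lhs => rw [← Measure.map_infinitePi_infinitePi_of_inj (P := fun _ : J × ℕ => P) hinj]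
  rw [lintegral_map (hm _) (by fun_prop)]
  refine lintegral_congr fun W => ?_
  -- Now roots and subtrees are permuted in the same way, which is an automorphism of each tree.
  exact hinv (fun j => gluePerm (π j) fun _ => Equiv.refl _)
    (fun j => isTreeAut_gluePerm _ fun _ => IsTreeAut.refl)
    (fun j α => c j * glue (S j) (fun m => W (j, m)) α)

/-- The expectation of an invariant function of the perturbed weights of a forest. -/
theorem lintegral_perturbed_forest [IsProbabilityMeasure μ] {k : ℕ} {J : Type} [Countable J]
    {x : Fin k → ℝ} (hx : ∀ n, 0 < x n) (q : Fin (k + 1) → ℝ) {ψ : ℝ → ℝ} {K : ℝ≥0}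
    (hψ : LipschitzWith K ψ) {κ : Fin k → Measure (ℕ → ℝ)} (hκp : ∀ n, IsProbabilityMeasure (κ n))
    (hκ : ∀ n (Y : ℕ → Ω → ℝ), IsPPP (remIntensity (x n)) Y μ →
      μ.map (fun ω => sortSeq fun m => Y m ω) = κ n)
    {X Z : J → Ω → Tree k} (h : IsMarkedForest x X Z μ) (y : J → ℝ)
    {F : (J → (Fin k → ℕ) → ℝ) → ℝ≥0∞} (hF : Measurable F) (hinv : TreeInvariant F) :
    ∫⁻ ω, F (fun j => perturbed ψ q (y j) (X j ω) (Z j ω)) ∂μ =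
      ∫⁻ W, F (fun j α => Real.exp (psiLevel x q ψ 0 (y j)) * W j α)
        ∂(Measure.infinitePi fun _ : J => canonLaw k κ) := by
  induction k generalizing J with
  | zero =>
    have h1 : ∀ ω, (fun j => perturbed ψ q (y j) (X j ω) (Z j ω)) =
        fun j _ => Real.exp (ψ (y j)) * 1 := by
      intro ω
      ext j α
      simp [perturbed, treeWeight, treeField]
    have h2 : psiLevel x q ψ 0 = ψ := psiLevel_last x q ψ
    simp_rw [h1, h2]
    rw [lintegral_const, measure_univ, mul_one]
    unfold canonLaw
    rw [Measure.infinitePi_dirac, lintegral_dirac']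
    refine hF.comp ?_
    fun_prop
  | succ k ih =>
    have hκ0 := hκp 0
    have hcan := isProbabilityMeasure_canonLaw (Fin.tail κ) fun n => hκp n.succ
    set s : ℝ := Real.sqrt (q (Fin.succ 0) - q (Fin.castSucc 0)) with hs
    set ψ₁ : ℝ → ℝ := psiLevel (Fin.tail x) (Fin.tail q) ψ 0 with hψ₁
    have hψ₁L : LipschitzWith K ψ₁ := lipschitzWith_psiLevel (fun n => hx n.succ) _ hψ 0
    have hψ₀ : psiLevel x q ψ 0 =
        logMoment (x 0) (q (Fin.succ 0) - q (Fin.castSucc 0)) ψ₁ := by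
      rw [hψ₁, ← psiLevel_succ]
      exact psiLevel_castSucc x q ψ 0
    set c : J → ℝ := fun j => psiLevel x q ψ 0 (y j) with hc
    let Q := Measure.infinitePi fun _ : J × ℕ => canonLaw k (Fin.tail κ)
    -- The expectation given the root sequences, with unperturbed subtrees and the final factor exp
    -- ψ_0(y j) already in front.
    let G : (J → ℕ → ℝ) → ℝ≥0∞ := fun S =>
      ∫⁻ W, F (fun j α => Real.exp (c j) * glue (S j) (fun m => W (j, m)) α) ∂Q
    have hGm : Measurable G := by
      refine Measurable.lintegral_prod_right' (f := fun p : (J → ℕ → ℝ) ×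
        (J × ℕ → (Fin k → ℕ) → ℝ) =>
        F (fun j α => Real.exp (c j) * glue (p.1 j) (fun m => p.2 (j, m)) α)) ?_
      refine hF.comp (measurable_pi_lambda _ fun j => measurable_pi_lambda _ fun α => ?_)
      unfold glue
      fun_prop
    -- The root points absorb the factor exp ψ_1 left by their subtree; dividing by exp ψ_0(y j)
    -- makes the factor normalised.
    let Y : J → ℕ → Ω → ℝ := fun j m ω =>
      Real.exp (ψ₁ (y j + s * treeRoot (Z j ω) m) - c j) * treeRoot (X j ω) m
    have hstep : ∫⁻ ω, F (fun j => perturbed ψ q (y j) (X j ω) (Z j ω)) ∂μ =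
        ∫⁻ ω, G (fun j m => Y j m ω) ∂μ := by
      let Φ : (J → (ℕ → ℝ) × (ℕ → ℝ)) → (J × ℕ → Tree k × Tree k) → ℝ≥0∞ := fun u v =>
        F (fun j => glue (u j).1 fun m => perturbed ψ (Fin.tail q) (y j + s * (u j).2 m)
          (v (j, m)).1 (v (j, m)).2)
      have hΦ : Measurable (Function.uncurry Φ) := by
        refine hF.comp (measurable_pi_lambda _ fun j => Measurable.glue
          (by fun_prop) (measurable_pi_lambda _ fun m => ?_))
        exact (measurable_perturbed hψ.continuous.measurable (Fin.tail q)).comp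
          (f := fun u : (J → (ℕ → ℝ) × (ℕ → ℝ)) × (J × ℕ → Tree k × Tree k) =>
            (y j + s * (u.1 j).2 m, (u.2 (j, m)).1, (u.2 (j, m)).2)) (by fun_prop)
      have hUm : Measurable fun ω (j : J) => (treeRoot (X j ω), treeRoot (Z j ω)) :=
        measurable_pi_lambda _ h.measurable_root
      have hVm : Measurable fun ω (p : J × ℕ) => (treeSub (X p.1 ω) p.2, treeSub (Z p.1 ω) p.2) :=
        measurable_pi_lambda _ h.sub.measurable_tree
      simp_rw [perturbed_succ]
      refine (lintegral_indepFun h.indepFun_root_sub hUm hVm hΦ).trans ?_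
      refine lintegral_congr fun ω => ?_
      refine (lintegral_map (hΦ.comp measurable_prodMk_left) hVm).trans ?_
      have hF' : Measurable fun W : J × ℕ → (Fin k → ℕ) → ℝ =>
          F (fun j => glue (treeRoot (X j ω)) fun m => W (j, m)) := by
        refine hF.comp (measurable_pi_lambda _ fun j =>
          Measurable.glue measurable_const ?_)
        fun_prop
      have hinv' : TreeInvariant fun W : J × ℕ → (Fin k → ℕ) → ℝ =>
          F (fun j => glue (treeRoot (X j ω)) fun m => W (j, m)) := by
        intro τ hτ W
        exact hinv (fun j => gluePerm (Equiv.refl ℕ) fun m => τ (j, m))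
          (fun j => isTreeAut_gluePerm _ fun m => hτ (j, m))
          (fun j => glue (treeRoot (X j ω)) fun m => W (j, m))
      -- With the roots frozen, the test function of the subtrees is invariant under automorphisms
      -- of each of them. The induction hypothesis applies with starting values y + s z_m.
      refine (ih (fun n => hx n.succ) (Fin.tail q) (fun n => hκp n.succ) (fun n => hκ n.succ) h.sub
        (fun p => y p.1 + s * treeRoot (Z p.1 ω) p.2) hF' hinv').trans ?_
      refine lintegral_congr fun W => ?_
      congr 1
      ext j α
      simp only [glue, Y]
      rw [Real.exp_sub]
      field_simp
      exact mul_right_comm _ _ _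
    have hPPP : ∀ j, IsPPP (remIntensity (x 0)) (Y j) μ := by
      intro j
      refine IsREM.isPPP_mul (γ := gaussianReal 0 1)
        (a := fun z => Real.exp (ψ₁ (y j + s * z) - c j)) ?_
        (fun z => Real.exp_pos _) (hx 0) ?_ (h.rem j 0 rootAddress)
        (h.measurable_mark j 0 rootAddress) (h.mark_law j 0 rootAddress)
        (h.mark_indep j 0 rootAddress)
      · have := hψ₁L.continuous.measurable
        fun_prop
      · simp only [hc, hψ₀]
        exact lintegral_exp_sub_logMoment hψ₁L (hx 0) _ (y j)
    have hsortm : ∀ j, Measurable fun ω => sortSeq fun m => Y j m ω := fun j =>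
      measurable_sortSeq.comp (hPPP j).measurable_pi
    -- Sorting is almost surely a permutation of the children, and G does not see it.
    have hsort : ∫⁻ ω, G (fun j m => Y j m ω) ∂μ =
        ∫⁻ ω, G (fun j => sortSeq fun m => Y j m ω) ∂μ := by
      have hae : ∀ᵐ ω ∂μ, ∀ j, Rankable fun m => Y j m ω :=
        ae_all_iff.2 fun j => (hPPP j).ae_rankable (hx 0)
      refine lintegral_congr_ae ?_
      filter_upwards [hae] with ω hω
      choose σ hσ using fun j => (hω j).exists_sortSeq_eq
      simp_rw [hσ]
      exact (lintegral_glue_comp_perm hF hinv (fun j => Real.exp (c j)) (fun j m => Y j m ω) σ).symm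
    -- The roots of different trees are independent, and each sorted root has law κ 0, whatever the
    -- value of y j.
    have hlaw : μ.map (fun ω j => sortSeq fun m => Y j m ω) =
        Measure.infinitePi fun _ : J => κ 0 := by
      have hind : iIndepFun (fun (j : J) ω => sortSeq fun m => Y j m ω) μ :=
        h.iIndepFun_root.comp (fun j p => sortSeq fun m =>
          Real.exp (ψ₁ (y j + s * p.2 m) - c j) * p.1 m) fun j => by
            have := hψ₁L.continuous.measurable
            exact measurable_sortSeq.comp (by fun_prop)
      rw [hind.map_fun_eq_infinitePi_map hsortm]
      simp_rw [fun j => hκ 0 (Y j) (hPPP j)]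
    rw [hstep, hsort, lintegral_infinitePi_canonLaw_succ κ hκp
      (F := fun W => F fun j α => Real.exp (c j) * W j α) (hF.comp (by fun_prop)), ← hlaw,
      lintegral_map hGm (measurable_pi_lambda _ hsortm)]

end Forest


/-! ### Fractional moments of sums. -/

section Moments

lemma rpow_tsum_le_tsum_rpow {ι : Type*} (a : ι → ℝ≥0∞) {s : ℝ} (hs : 0 < s) (hs1 : s ≤ 1) :
    (∑' i, a i) ^ s ≤ ∑' i, a i ^ s := by
  classical
  have hfin : ∀ t : Finset ι, (∑ i ∈ t, a i) ^ s ≤ ∑ i ∈ t, a i ^ s := by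
    intro t
    induction t using Finset.induction_on with
    | empty => simp [hs]
    | insert i t hi ih =>
      rw [Finset.sum_insert hi, Finset.sum_insert hi]
      exact (ENNReal.rpow_add_le_add_rpow _ _ hs.le hs1).trans (by gcongr)
  rw [← ENNReal.le_rpow_inv_iff hs, ENNReal.tsum_eq_iSup_sum]
  refine iSup_le fun t => ?_
  rw [ENNReal.le_rpow_inv_iff hs]
  exact (hfin t).trans (ENNReal.sum_le_tsum t)

/-- The function equal to `a` for `a ≤ 1` and to `a ^ s` for `a > 1`. -/
noncomputable def truncPow (s : ℝ) (a : ℝ≥0∞) : ℝ≥0∞ := if a ≤ 1 then a else a ^ s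

lemma measurable_truncPow (s : ℝ) : Measurable (truncPow s) :=
  Measurable.ite measurableSet_Iic measurable_id (by fun_prop)

/-- Terms at most 1 and terms above 1 are treated separately: for the sum A of the small ones A^s ≤
1 + A, and for the large ones the power is subadditive. This yields a bound additive in the points,
so only the intensity enters its expectation. -/
lemma rpow_tsum_le_truncPow {ι : Type*} (a : ι → ℝ≥0∞) {s : ℝ} (hs : 0 < s) (hs1 : s ≤ 1) :
    (∑' i, a i) ^ s ≤ 1 + ∑' i, truncPow s (a i) := by
  have hsplit : ∀ i, a i = (if a i ≤ 1 then a i else 0) + if a i ≤ 1 then 0 else a i := by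
    intro i; split_ifs <;> simp
  have hg : ∀ i, truncPow s (a i) =
      (if a i ≤ 1 then a i else 0) + (if a i ≤ 1 then 0 else a i) ^ s := by
    intro i; unfold truncPow; split_ifs <;> simp [hs]
  have hle : ∀ A : ℝ≥0∞, A ^ s ≤ 1 + A := by
    intro A
    rcases le_total A 1 with h | h
    · exact (ENNReal.rpow_le_one h hs.le).trans le_self_add
    · refine le_trans ?_ (le_add_self (a := A))
      simpa using ENNReal.rpow_le_rpow_of_exponent_le h hs1
  conv_lhs => rw [tsum_congr hsplit, ENNReal.tsum_add]
  rw [tsum_congr hg, ENNReal.tsum_add, ← add_assoc]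
  exact (ENNReal.rpow_add_le_add_rpow _ _ hs.le hs1).trans
    (add_le_add (hle _) (rpow_tsum_le_tsum_rpow _ hs hs1))

/-- The small points are integrable because x < 1, the large ones because s < x. -/
lemma lintegral_truncPow_lt_top {x s : ℝ} (hx : 0 < x) (hx1 : x < 1) (hs : s < x) :
    ∫⁻ t, truncPow s (ENNReal.ofReal t) ∂remIntensity x < ⊤ := by
  have hcover : (Set.univ : Set ℝ) ⊆ Set.Iic 0 ∪ (Set.Ioc 0 1 ∪ Set.Ioi 1) := by
    intro t _
    simp only [Set.mem_union, Set.mem_Iic, Set.mem_Ioc, Set.mem_Ioi]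
    rcases le_or_gt t 0 with h | h
    · exact Or.inl h
    · rcases le_or_gt t 1 with h' | h'
      · exact Or.inr (Or.inl ⟨h, h'⟩)
      · exact Or.inr (Or.inr h')
  rw [← setLIntegral_univ]
  refine (lintegral_mono_set hcover).trans_lt ((lintegral_union_le _ _ _).trans_lt ?_)
  refine ENNReal.add_lt_top.2 ⟨?_, (lintegral_union_le _ _ _).trans_lt
    (ENNReal.add_lt_top.2 ⟨?_, ?_⟩)⟩
  · rw [setLIntegral_measure_zero _ _ (remIntensity_Iic_zero x)]
    exact ENNReal.zero_lt_top
  · refine lt_of_le_of_lt ?_ (setLIntegral_remIntensity_Ioc_lt_top hx hx1 one_pos)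
    refine setLIntegral_mono' measurableSet_Ioc fun t ht => ?_
    rw [truncPow, if_pos (by simpa using ht.2), ENNReal.rpow_one]
  · refine lt_of_le_of_lt ?_ (setLIntegral_remIntensity_Ioi_lt_top hx hs one_pos)
    refine setLIntegral_mono' measurableSet_Ioi fun t ht => ?_
    rw [truncPow, if_neg (by simpa using ht)]

end Moments

/-! ### Under the reference law the weights are positive, distinct and summable. -/

section CanonLaw

/-- Intensity and void probabilities do not depend on the labelling, and sorting is almost surely a
relabelling. -/
lemma isPPP_map_sortSeq {Ω : Type*} [MeasurableSpace Ω] {μ : Measure Ω} [IsProbabilityMeasure μ]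
    {x : ℝ} {X : ℕ → Ω → ℝ} (hx : 0 < x) (h : IsPPP (remIntensity x) X μ) :
    IsPPP (remIntensity x) (fun m (u : ℕ → ℝ) => u m)
      (μ.map fun ω => sortSeq fun m => X m ω) := by
  have hm : Measurable fun ω => sortSeq fun m => X m ω := measurable_sortSeq.comp h.measurable_pi
  refine ⟨measurable_pi_apply, ?_, fun A hA => ?_⟩
  · ext A hA
    rw [Measure.sum_apply _ hA, ← lintegral_indicator_one hA,
      ← tsum_lintegral_of_intensity h.measurable h.intensity (measurable_one.indicator hA)]
    have h1 : ∀ m, (μ.map fun ω => sortSeq fun m => X m ω).map (fun u => u m) A =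
        ∫⁻ ω, A.indicator (1 : ℝ → ℝ≥0∞) (sortSeq (fun m => X m ω) m) ∂μ := by
      intro m
      rw [← lintegral_indicator_one hA, lintegral_map (measurable_one.indicator hA) (by fun_prop)]
      exact lintegral_map ((measurable_one.indicator hA).comp (measurable_pi_apply m)) hm
    simp_rw [h1]
    refine (lintegral_tsum fun m => ((measurable_one.indicator hA).comp
      ((measurable_pi_apply m).comp hm)).aemeasurable).symm.trans (Eq.trans ?_ (lintegral_tsum
      fun m => ((measurable_one.indicator hA).comp (h.measurable m)).aemeasurable))
    refine lintegral_congr_ae ?_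
    filter_upwards [h.ae_rankable hx] with ω hω
    obtain ⟨σ, hσ⟩ := hω.exists_sortSeq_eq
    change ∑' m, A.indicator (1 : ℝ → ℝ≥0∞) (sortSeq (fun m => X m ω) m) =
      ∑' m, A.indicator (1 : ℝ → ℝ≥0∞) (X m ω)
    rw [hσ]
    exact σ.tsum_eq fun m => A.indicator (1 : ℝ → ℝ≥0∞) (X m ω)
  · change (μ.map fun ω => sortSeq fun m => X m ω) (voidSet A) = _
    rw [Measure.map_apply hm (measurableSet_voidSet hA), ← h.void A hA]
    refine measure_congr ?_
    filter_upwards [h.ae_rankable hx] with ω hω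
    obtain ⟨σ, hσ⟩ := hω.exists_sortSeq_eq
    refine propext ?_
    change (∀ m, sortSeq (fun m => X m ω) m ∉ A) ↔ ∀ m, X m ω ∉ A
    rw [hσ]
    exact σ.forall_congr fun _ => Iff.rfl

lemma measurableSet_pos_injective {A : Type*} [Countable A] :
    MeasurableSet {w : A → ℝ | (∀ a, 0 < w a) ∧ Function.Injective w} := by
  have hset : {w : A → ℝ | (∀ a, 0 < w a) ∧ Function.Injective w} = (⋂ a, {w | 0 < w a}) ∩
      ⋂ a, ⋂ b, ⋂ _ : a ≠ b, {w | w a ≠ w b} := by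
    ext w
    simp only [Set.mem_inter_iff, Set.mem_iInter, Set.mem_ofPred_eq]
    exact and_congr_right fun _ => ⟨fun h a b hab hw => hab (h hw),
      fun h a b hw => by_contra fun hab => h a b hab hw⟩
  rw [hset]
  refine (MeasurableSet.iInter fun a => ?_).inter (MeasurableSet.iInter fun a =>
    MeasurableSet.iInter fun b => MeasurableSet.iInter fun _ => ?_)
  · exact measurableSet_lt measurable_const (measurable_pi_apply a)
  · exact (measurableSet_eq_fun (measurable_pi_apply a) (measurable_pi_apply b)).compl

lemma ae_canonLaw_pos_injective {k : ℕ} {x : Fin k → ℝ} (hx : ∀ n, 0 < x n)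
    {κ : Fin k → Measure (ℕ → ℝ)} (hκp : ∀ n, IsProbabilityMeasure (κ n))
    (hκ : ∀ n, IsPPP (remIntensity (x n)) (fun m (u : ℕ → ℝ) => u m) (κ n)) :
    ∀ᵐ W ∂canonLaw k κ, (∀ α, 0 < W α) ∧ Function.Injective W := by
  induction k with
  | zero =>
    unfold canonLaw
    rw [ae_dirac_iff measurableSet_pos_injective]
    exact ⟨fun _ => one_pos, Function.injective_of_subsingleton _⟩
  | succ k ih =>
    have h0 := hκp 0
    have hc := isProbabilityMeasure_canonLaw (Fin.tail κ) fun n => hκp n.succ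
    unfold canonLaw
    rw [ae_map_iff measurable_glue.aemeasurable measurableSet_pos_injective]
    set Q := Measure.infinitePi fun _ : ℕ => canonLaw k (Fin.tail κ)
    have ihQ : ∀ᵐ W ∂Q, ∀ m, (∀ α, 0 < W m α) ∧ Function.Injective (W m) :=
      ae_all_iff.2 fun m => (measurePreserving_eval_infinitePi
        (fun _ : ℕ => canonLaw k (Fin.tail κ)) m).quasiMeasurePreserving.ae
          (ih (fun n => hx n.succ) (fun n => hκp n.succ) fun n => hκ n.succ)
    have h1 : ∀ᵐ p ∂(κ 0).prod Q, ∀ m, 0 < p.1 m :=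
      Measure.quasiMeasurePreserving_fst.ae (hκ 0).ae_pos
    have h2 : ∀ᵐ p ∂(κ 0).prod Q, ∀ m, (∀ α, 0 < p.2 m α) ∧ Function.Injective (p.2 m) :=
      Measure.quasiMeasurePreserving_snd.ae ihQ
    -- With the subtrees fixed by Fubini, equality of weights below different children would make
    -- the ratio of two root points equal to a given positive number, which has probability zero.
    have h3 : ∀ᵐ p ∂(κ 0).prod Q, ∀ m m', m ≠ m' → ∀ α β,
        p.1 m * p.2 m α ≠ p.1 m' * p.2 m' β := by
      simp_rw [ae_all_iff]
      intro m m' hmm α β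
      have hms : MeasurableSet {p : (ℕ → ℝ) × (ℕ → (Fin k → ℕ) → ℝ) |
          p.1 m * p.2 m α ≠ p.1 m' * p.2 m' β} :=
        (measurableSet_eq_fun (by fun_prop) (by fun_prop)).compl
      rw [Measure.ae_prod_iff_ae_ae hms]
      refine (Measure.ae_ae_comm (p := fun (u : ℕ → ℝ) (W : ℕ → (Fin k → ℕ) → ℝ) =>
        u m * W m α ≠ u m' * W m' β) hms).2 ?_
      filter_upwards [ihQ] with W hW
      have hpos : 0 < W m' β / W m α := div_pos ((hW m').1 β) ((hW m).1 α)
      filter_upwards [(hκ 0).ae_ne_mul (hx 0) hmm hpos] with u hu heq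
      refine hu ?_
      have := (hW m).1 α
      field_simp
      linarith
    filter_upwards [h1, h2, h3] with p h1 h2 h3
    refine ⟨fun α => mul_pos (h1 _) ((h2 _).1 _), fun α β hαβ => ?_⟩
    have h0 : α 0 = β 0 := by_contra fun hne => h3 _ _ hne _ _ hαβ
    simp only [glue, h0] at hαβ
    have := (h2 (β 0)).2 (mul_left_cancel₀ (h1 (β 0)).ne' hαβ)
    rw [← Fin.cons_self_tail α, ← Fin.cons_self_tail β, h0, this]

/-- The sum of the weights, with values in `[0, ∞]`. -/
noncomputable def totalMass {A : Type*} (W : A → ℝ) : ℝ≥0∞ := ∑' a, ENNReal.ofReal (W a)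

lemma measurable_totalMass {A : Type*} [Countable A] : Measurable (totalMass (A := A)) := by
  unfold totalMass
  exact Measurable.tsum fun a => by fun_prop

lemma totalMass_glue {k : ℕ} {u : ℕ → ℝ} (hu : ∀ m, 0 < u m) (W : ℕ → (Fin k → ℕ) → ℝ) :
    totalMass (glue u W) = ∑' m, ENNReal.ofReal (u m) * totalMass (W m) := by
  rw [totalMass, ← (Fin.consEquiv fun _ : Fin (k + 1) => ℕ).tsum_eq]
  refine (ENNReal.tsum_prod (f := fun m α => ENNReal.ofReal (u m * W m α))).trans ?_
  refine tsum_congr fun m => ?_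
  rw [totalMass, ← ENNReal.tsum_mul_left]
  exact tsum_congr fun α => ENNReal.ofReal_mul (hu m).le

lemma lintegral_truncPow_mul_le {x s : ℝ} (hx : 0 < x) {c : ℝ≥0∞} (hc : c ≠ ⊤) :
    ∫⁻ t, truncPow s (ENNReal.ofReal t * c) ∂remIntensity x ≤
      c ^ x * ∫⁻ t, truncPow s (ENNReal.ofReal t) ∂remIntensity x := by
  rcases eq_or_ne c 0 with rfl | h0
  · simp [truncPow]
  · have hpos := ENNReal.toReal_pos h0 hc
    rw [← ENNReal.ofReal_toReal hc, ← lintegral_remIntensity_comp_mul hx hpos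
      (g := fun t => truncPow s (ENNReal.ofReal t))
      ((measurable_truncPow s).comp ENNReal.measurable_ofReal)]
    refine lintegral_mono fun t => le_of_eq ?_
    rw [ENNReal.ofReal_mul hpos.le, mul_comm]

/-- The total mass is the sum of root points times subtree masses. By scaling, integrating
`truncPow` over a root point times a mass c gives a constant times c^{x 0}. So the moment of order s
is controlled by the moment of order x 0 of a subtree mass, which is finite by induction because x 0
lies below all deeper parameters; hence s varies in the induction. -/
lemma lintegral_totalMass_rpow_lt_top {k : ℕ} {x : Fin k → ℝ} (hmono : StrictMono x)
    (hx : ∀ n, 0 < x n) (hx1 : ∀ n, x n < 1) {κ : Fin k → Measure (ℕ → ℝ)}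
    (hκp : ∀ n, IsProbabilityMeasure (κ n))
    (hκ : ∀ n, IsPPP (remIntensity (x n)) (fun m (u : ℕ → ℝ) => u m) (κ n)) {s : ℝ} (hs : 0 < s)
    (hs1 : s ≤ 1) (hsx : ∀ n, s < x n) : ∫⁻ W, totalMass W ^ s ∂canonLaw k κ < ⊤ := by
  induction k generalizing s with
  | zero =>
    unfold canonLaw
    rw [lintegral_dirac' _ (measurable_totalMass.pow_const s)]
    refine ENNReal.rpow_lt_top_of_nonneg hs.le ?_
    simp [totalMass]
  | succ k ih =>
    have h0 := hκp 0
    have hc := isProbabilityMeasure_canonLaw (Fin.tail κ) fun n => hκp n.succ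
    have hIH := fun {s : ℝ} => ih (x := Fin.tail x) (κ := Fin.tail κ) (s := s)
      (fun a b hab => hmono (Fin.succ_lt_succ_iff.2 hab)) (fun n => hx n.succ)
      (fun n => hx1 n.succ) (fun n => hκp n.succ) fun n => hκ n.succ
    -- The scaling bound needs a finite mass c; the induction hypothesis with the same s gives it
    -- almost surely.
    have hfin : ∀ᵐ V ∂canonLaw k (Fin.tail κ), totalMass V ≠ ⊤ := by
      filter_upwards [ae_lt_top (measurable_totalMass.pow_const s)
        (hIH hs hs1 fun n => hsx n.succ).ne] with V hV
      exact ((ENNReal.rpow_lt_top_iff_of_pos hs).1 hV).ne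
    unfold canonLaw
    rw [lintegral_map (measurable_totalMass.pow_const s) measurable_glue]
    set Q := Measure.infinitePi fun _ : ℕ => canonLaw k (Fin.tail κ)
    have hmT : Measurable (totalMass (A := Fin k → ℕ)) := measurable_totalMass
    have hmG := measurable_truncPow s
    have hmI : ∀ m, Measurable fun p : (ℕ → ℝ) × (ℕ → (Fin k → ℕ) → ℝ) =>
        truncPow s (ENNReal.ofReal (p.1 m) * totalMass (p.2 m)) := fun m => by fun_prop
    have hm2 : Measurable fun p : ℝ × ((Fin k → ℕ) → ℝ) =>
        truncPow s (ENNReal.ofReal p.1 * totalMass p.2) := by fun_prop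
    have hpos : ∀ᵐ p ∂(κ 0).prod Q, ∀ m, 0 < p.1 m :=
      Measure.quasiMeasurePreserving_fst.ae (hκ 0).ae_pos
    calc ∫⁻ p, totalMass (glue p.1 p.2) ^ s ∂(κ 0).prod Q
        ≤ ∫⁻ p, 1 + ∑' m, truncPow s (ENNReal.ofReal (p.1 m) * totalMass (p.2 m))
            ∂(κ 0).prod Q := by
          refine lintegral_mono_ae ?_
          filter_upwards [hpos] with p hp
          rw [totalMass_glue hp]
          exact rpow_tsum_le_truncPow _ hs hs1
      _ = 1 + ∑' m, ∫⁻ p, truncPow s (ENNReal.ofReal (p.1 m) * totalMass (p.2 m))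
            ∂(κ 0).prod Q := by
          rw [lintegral_add_left measurable_const, lintegral_const, measure_univ, mul_one,
            lintegral_tsum fun m => (hmI m).aemeasurable]
      _ = 1 + ∑' m, ∫⁻ u, ∫⁻ V, truncPow s (ENNReal.ofReal (u m) * totalMass V)
            ∂canonLaw k (Fin.tail κ) ∂κ 0 := by
          congr 1
          refine tsum_congr fun m => ?_
          rw [lintegral_prod _ (hmI m).aemeasurable]
          refine lintegral_congr fun u => ?_
          have := (measurePreserving_eval_infinitePi
            (fun _ : ℕ => canonLaw k (Fin.tail κ)) m).lintegral_comp
            (f := fun V => truncPow s (ENNReal.ofReal (u m) * totalMass V)) (by fun_prop)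
          exact this
      _ = 1 + ∫⁻ V, ∫⁻ t, truncPow s (ENNReal.ofReal t * totalMass V) ∂remIntensity (x 0)
            ∂canonLaw k (Fin.tail κ) := by
          rw [tsum_lintegral_of_intensity (hκ 0).measurable (hκ 0).intensity
            (g := fun t => ∫⁻ V, truncPow s (ENNReal.ofReal t * totalMass V)
              ∂canonLaw k (Fin.tail κ)) hm2.lintegral_prod_right',
            lintegral_lintegral_swap hm2.aemeasurable]
      _ ≤ 1 + ∫⁻ V, totalMass V ^ x 0 * ∫⁻ t, truncPow s (ENNReal.ofReal t) ∂remIntensity (x 0)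
            ∂canonLaw k (Fin.tail κ) := by
          gcongr 1 + ?_
          refine lintegral_mono_ae ?_
          filter_upwards [hfin] with V hV
          exact lintegral_truncPow_mul_le (hx 0) hV
      _ < ⊤ := by
          rw [lintegral_mul_const _ (hmT.pow_const _)]
          exact ENNReal.add_lt_top.2 ⟨ENNReal.one_lt_top, ENNReal.mul_lt_top
            (hIH (hx 0) (hx1 0).le fun n => hmono (Fin.succ_pos n))
            (lintegral_truncPow_lt_top (hx 0) (hx1 0) (hsx 0))⟩

/-- Almost surely the weights are positive, distinct and summable. -/
theorem ae_canonLaw_wellOrdered {k : ℕ} {x : Fin k → ℝ} (hmono : StrictMono x)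
    (hx : ∀ n, 0 < x n) (hx1 : ∀ n, x n < 1) {κ : Fin k → Measure (ℕ → ℝ)}
    (hκp : ∀ n, IsProbabilityMeasure (κ n))
    (hκ : ∀ n, IsPPP (remIntensity (x n)) (fun m (u : ℕ → ℝ) => u m) (κ n)) :
    ∀ᵐ W ∂canonLaw k κ, WellOrdered W := by
  -- Any positive exponent below the smallest parameter serves; for depth 0 there is no constraint
  -- and s = 1 is taken.
  obtain ⟨s, hs, hs1, hsx⟩ : ∃ s : ℝ, 0 < s ∧ s ≤ 1 ∧ ∀ n, s < x n := by
    rcases k with _ | k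
    · exact ⟨1, one_pos, le_rfl, fun n => n.elim0⟩
    · refine ⟨x 0 / 2, half_pos (hx 0), by linarith [hx1 0, hx 0], fun n => ?_⟩
      linarith [hmono.monotone (Fin.zero_le n), hx 0]
  filter_upwards [ae_canonLaw_pos_injective hx hκp hκ,
    ae_lt_top (measurable_totalMass.pow_const s)
      (lintegral_totalMass_rpow_lt_top hmono hx hx1 hκp hκ hs hs1 hsx).ne] with W h1 h2
  refine ⟨h1.1, h1.2, ?_⟩
  have := ENNReal.summable_toReal ((ENNReal.rpow_lt_top_iff_of_pos hs).1 h2).ne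
  exact this.congr fun α => (ENNReal.toReal_ofReal (h1.1 α).le)

end CanonLaw


/-! ### Stability of well-ordered weights; relative weights. -/

section WellOrdered

variable {A : Type*}

lemma wellOrdered_iff_totalMass {w : A → ℝ} :
    WellOrdered w ↔ ((∀ a, 0 < w a) ∧ Function.Injective w) ∧ totalMass w < ⊤ := by
  constructor
  · rintro ⟨h1, h2, h3⟩
    refine ⟨⟨h1, h2⟩, ?_⟩
    rw [totalMass, ← ENNReal.ofReal_tsum_of_nonneg (fun a => (h1 a).le) h3]
    exact ENNReal.ofReal_lt_top
  · rintro ⟨⟨h1, h2⟩, h3⟩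
    refine ⟨h1, h2, ?_⟩
    exact (ENNReal.summable_toReal h3.ne).congr fun a => (ENNReal.toReal_ofReal (h1 a).le)

lemma measurableSet_wellOrdered [Countable A] : MeasurableSet {w : A → ℝ | WellOrdered w} := by
  have : {w : A → ℝ | WellOrdered w} =
      {w | (∀ a, 0 < w a) ∧ Function.Injective w} ∩ totalMass ⁻¹' Set.Iio ⊤ := by
    ext w
    exact wellOrdered_iff_totalMass
  rw [this]
  exact measurableSet_pos_injective.inter (measurable_totalMass measurableSet_Iio)

lemma toReal_totalMass {w : A → ℝ} (hw : ∀ a, 0 < w a) : (totalMass w).toReal = ∑' a, w a := by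
  rw [totalMass, ENNReal.tsum_toReal_eq fun a => ENNReal.ofReal_ne_top]
  exact tsum_congr fun a => ENNReal.toReal_ofReal (hw a).le

lemma WellOrdered.const_mul {w : A → ℝ} (h : WellOrdered w) {c : ℝ} (hc : 0 < c) :
    WellOrdered fun a => c * w a :=
  ⟨fun a => mul_pos hc (h.1 a), fun _ _ hab => h.2.1 (mul_left_cancel₀ hc.ne' hab),
    h.2.2.mul_left c⟩

lemma WellOrdered.comp_equiv {w : A → ℝ} (h : WellOrdered w) (σ : A ≃ A) : WellOrdered (w ∘ σ) :=
  ⟨fun _ => h.1 _, h.2.1.comp σ.injective, σ.summable_iff.2 h.2.2⟩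

lemma WellOrdered.tsum_pos [Nonempty A] {w : A → ℝ} (h : WellOrdered w) : 0 < ∑' a, w a :=
  h.2.2.tsum_pos (fun a => (h.1 a).le) (Classical.arbitrary A) (h.1 _)

/-- The relative weights. -/
noncomputable def relWeight (w : A → ℝ) (a : A) : ℝ := w a / ∑' b, w b

/-- A common factor, even a random one, disappears on normalisation: the source of
quasi-stationarity. -/
lemma relWeight_const_mul {c : ℝ} (hc : c ≠ 0) (w : A → ℝ) :
    relWeight (fun a => c * w a) = relWeight w := by
  ext a
  rw [relWeight, relWeight, tsum_mul_left, mul_div_mul_left _ _ hc]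

lemma WellOrdered.relWeight [Nonempty A] {w : A → ℝ} (h : WellOrdered w) :
    WellOrdered (relWeight w) := by
  convert h.const_mul (inv_pos.2 h.tsum_pos) using 2
  rw [RPC.relWeight, div_eq_inv_mul]

end WellOrdered

/-! ### Invariance and measurability of the ordered configuration. -/

section Config

variable {k : ℕ}

lemma le_commonLevel_iff (α β : Fin k → ℕ) {j : ℕ} (hj : j ≤ k) :
    j ≤ (commonLevel α β : ℕ) ↔ ∀ i : Fin k, (i : ℕ) < j → α i = β i := by
  refine ⟨fun h i hi => ?_, fun h => Nat.le_findGreatest hj h⟩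
  have := Nat.findGreatest_spec (P := fun j => ∀ i : Fin k, (i : ℕ) < j → α i = β i)
    (Nat.zero_le k) (fun i hi => absurd hi (Nat.not_lt_zero _))
  exact this i (hi.trans_le h)

lemma IsTreeAut.overlap {σ : Equiv.Perm (Fin k → ℕ)} (hσ : IsTreeAut σ) (q : Fin (k + 1) → ℝ)
    (α β : Fin k → ℕ) : overlap q (σ α) (σ β) = RPC.overlap q α β := by
  simp only [RPC.overlap, commonLevel, hσ α β]

lemma IsTreeAut.symm {σ : Equiv.Perm (Fin k → ℕ)} (hσ : IsTreeAut σ) : IsTreeAut σ.symm := by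
  intro α β j
  simpa using (hσ (σ.symm α) (σ.symm β) j).symm

instance [NeZero k] : Infinite (Fin k → ℕ) :=
  have : Nonempty (Fin k) := ⟨0⟩
  Function.infinite_of_right

/-- The index of each rank is moved by σ⁻¹: the ordered values are unchanged, and so are the
overlaps, since σ⁻¹ is also an automorphism. -/
lemma config_comp [NeZero k] (q : Fin (k + 1) → ℝ) {w : (Fin k → ℕ) → ℝ} (hw : WellOrdered w)
    {σ : Equiv.Perm (Fin k → ℕ)} (hσ : IsTreeAut σ) : config q (w ∘ σ) = config q w := by
  simp only [config, hw.rankable.rankIndex_comp, hσ.symm.overlap, Function.comp_apply,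
    Equiv.apply_symm_apply]

open Classical in
/-- A measurable version of the index of the `(n+1)`-st largest weight. -/
noncomputable def measRankIndex (n : ℕ) (w : (Fin k → ℕ) → ℝ) : Fin k → ℕ :=
  if Rankable w then rankIndex w n else fun _ => 0

/-- Having index a at rank n is a condition on the number of weights above w a. Off the rankable
families a fixed address replaces the arbitrary choice made by `rankIndex`. -/
lemma measurable_measRankIndex [NeZero k] (n : ℕ) : Measurable (measRankIndex (k := k) n) := by
  classical
  refine measurable_to_countable' fun a => ?_
  have hset : measRankIndex n ⁻¹' {a} =
      ({w : (Fin k → ℕ) → ℝ | Rankable w} ∩ {w | {c | w a < w c}.encard = (n : ℕ∞)}) ∪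
        ({w | Rankable w}ᶜ ∩ {_w | (fun _ => 0) = a}) := by
    ext w
    by_cases hw : Rankable w
    · simp [measRankIndex, hw, hw.rankIndex_eq_iff]
    · simp [measRankIndex, hw]
  rw [hset]
  refine (measurableSet_rankable.inter ?_).union
    (measurableSet_rankable.compl.inter (MeasurableSet.const _))
  have hm : Measurable fun w : (Fin k → ℕ) → ℝ => {c | w a < w c}.encard := by
    refine measurable_encard.comp (measurable_set_iff.2 fun c => ?_)
    exact measurable_mem.2 (measurableSet_lt (measurable_pi_apply a) (measurable_pi_apply c))
  exact hm (MeasurableSet.of_discrete (s := {(n : ℕ∞)}))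

/-- A measurable version of the configuration. -/
noncomputable def measConfig (q : Fin (k + 1) → ℝ) (w : (Fin k → ℕ) → ℝ) :
    (ℕ → ℝ) × (ℕ → ℕ → ℝ) :=
  (fun n => w (measRankIndex n w),
    fun n m => overlap q (measRankIndex n w) (measRankIndex m w))

lemma measurable_measConfig [NeZero k] (q : Fin (k + 1) → ℝ) : Measurable (measConfig q) := by
  refine Measurable.prodMk (measurable_pi_lambda _ fun n => ?_)
    (measurable_pi_lambda _ fun n => measurable_pi_lambda _ fun m => ?_)
  · have h1 : Measurable fun p : ((Fin k → ℕ) → ℝ) × (Fin k → ℕ) => p.1 p.2 :=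
      measurable_from_prod_countable_left fun a => measurable_pi_apply a
    exact h1.comp (measurable_id.prodMk (measurable_measRankIndex n))
  · have h1 : Measurable fun p : (Fin k → ℕ) × (Fin k → ℕ) => overlap q p.1 p.2 :=
      measurable_of_countable _
    exact h1.comp ((measurable_measRankIndex n).prodMk (measurable_measRankIndex m))

lemma WellOrdered.config_eq (q : Fin (k + 1) → ℝ) {w : (Fin k → ℕ) → ℝ} (hw : WellOrdered w) :
    config q w = measConfig q w := by
  simp only [config, measConfig, measRankIndex, if_pos hw.rankable]

end Config

/-! ### From expectations of invariant functions to equality in law. -/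

section Functional

variable {k : ℕ}

/-- The functional of the weights depends on the addresses only through the tree structure, and
it is measurable, as far as families of positive, distinct and summable weights are concerned. -/
structure IsTreeFunctional {E : Type*} [MeasurableSpace E] (Φ : ((Fin k → ℕ) → ℝ) → E) :
    Prop where
  measurable : ∃ Φ' : ((Fin k → ℕ) → ℝ) → E, Measurable Φ' ∧ ∀ w, WellOrdered w → Φ w = Φ' w
  invariant : ∀ w, WellOrdered w → ∀ σ : Equiv.Perm (Fin k → ℕ), IsTreeAut σ → Φ (w ∘ σ) = Φ w

lemma isTreeFunctional_config [NeZero k] (q : Fin (k + 1) → ℝ) : IsTreeFunctional (config q) where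
  measurable := ⟨measConfig q, measurable_measConfig q, fun _ hw => hw.config_eq q⟩
  invariant _ hw _ hσ := config_comp q hw hσ

lemma isTreeFunctional_tsum :
    IsTreeFunctional fun w : (Fin k → ℕ) → ℝ => ∑' α, w α where
  measurable := ⟨fun w => (totalMass w).toReal, measurable_totalMass.ennreal_toReal,
    fun _ hw => (toReal_totalMass hw.1).symm⟩
  invariant w _ σ _ := σ.tsum_eq w

lemma isTreeFunctional_config_relWeight [NeZero k] (q : Fin (k + 1) → ℝ) :
    IsTreeFunctional fun w => config q (relWeight w) where
  measurable := by
    refine ⟨fun w => measConfig q fun α => w α / (totalMass w).toReal,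
      (measurable_measConfig q).comp (measurable_pi_lambda _ fun α =>
        (measurable_pi_apply α).div measurable_totalMass.ennreal_toReal), fun w hw => ?_⟩
    simp only [hw.relWeight.config_eq, toReal_totalMass hw.1]
    rfl
  invariant w hw σ hσ := by
    rw [← config_comp q hw.relWeight hσ]
    congr 1
    ext α
    simp only [relWeight, Function.comp_apply]
    rw [σ.tsum_eq w]

variable {Ω Ω' : Type*} [MeasurableSpace Ω] [MeasurableSpace Ω'] {μ : Measure Ω} {ν : Measure Ω'}

/-- The families of weights have the same law up to automorphisms of the tree. -/
def SameTreeLaw (U : Ω → (Fin k → ℕ) → ℝ) (V : Ω' → (Fin k → ℕ) → ℝ) (μ : Measure Ω)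
    (ν : Measure Ω') : Prop :=
  ∀ F : ((Fin k → ℕ) → ℝ) → ℝ≥0∞, Measurable F →
    (∀ w, ∀ σ : Equiv.Perm (Fin k → ℕ), IsTreeAut σ → F (w ∘ σ) = F w) →
    ∫⁻ ω, F (U ω) ∂μ = ∫⁻ ω, F (V ω) ∂ν

namespace SameTreeLaw

variable {U : Ω → (Fin k → ℕ) → ℝ} {V : Ω' → (Fin k → ℕ) → ℝ}

lemma measure_eq (h : SameTreeLaw U V μ ν) (hU : Measurable U) (hV : Measurable V)
    {S : Set ((Fin k → ℕ) → ℝ)} (hS : MeasurableSet S)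
    (hinv : ∀ w, ∀ σ : Equiv.Perm (Fin k → ℕ), IsTreeAut σ → (w ∘ σ ∈ S ↔ w ∈ S)) :
    μ (U ⁻¹' S) = ν (V ⁻¹' S) := by
  classical
  have := h (S.indicator 1) (measurable_one.indicator hS) fun w σ hσ => by
    simp only [Set.indicator_apply, hinv w σ hσ, Pi.one_apply]
  rw [← lintegral_indicator_one (hU hS), ← lintegral_indicator_one (hV hS)]
  exact this

lemma wellOrdered_comp_iff {w : (Fin k → ℕ) → ℝ} (σ : Equiv.Perm (Fin k → ℕ)) :
    WellOrdered (w ∘ σ) ↔ WellOrdered w := by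
  refine ⟨fun h => ?_, fun h => h.comp_equiv σ⟩
  have := h.comp_equiv σ.symm
  rwa [Function.comp_assoc, Equiv.self_comp_symm, Function.comp_id] at this

/-- Being well ordered is invariant under permutations of the addresses, so it passes from one side
to the other. -/
lemma ae_wellOrdered (h : SameTreeLaw U V μ ν) (hU : Measurable U) (hV : Measurable V)
    (hW : ∀ᵐ ω ∂ν, WellOrdered (V ω)) : ∀ᵐ ω ∂μ, WellOrdered (U ω) := by
  have := h.measure_eq hU hV measurableSet_wellOrdered.compl fun w σ _ =>
    not_congr (wellOrdered_comp_iff σ)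
  exact this.trans hW

lemma identDistrib (h : SameTreeLaw U V μ ν) (hU : Measurable U) (hV : Measurable V)
    (hW : ∀ᵐ ω ∂ν, WellOrdered (V ω)) {E : Type*} [MeasurableSpace E]
    {Φ : ((Fin k → ℕ) → ℝ) → E} (hΦ : IsTreeFunctional Φ) :
    IdentDistrib (fun ω => Φ (U ω)) (fun ω => Φ (V ω)) μ ν := by
  have hW' := h.ae_wellOrdered hU hV hW
  obtain ⟨Φ', hm, heq⟩ := hΦ.measurable
  have h1 : (fun ω => Φ (U ω)) =ᵐ[μ] fun ω => Φ' (U ω) := by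
    filter_upwards [hW'] with ω hω using heq _ hω
  have h2 : (fun ω => Φ (V ω)) =ᵐ[ν] fun ω => Φ' (V ω) := by
    filter_upwards [hW] with ω hω using heq _ hω
  refine ⟨⟨_, hm.comp hU, h1⟩, ⟨_, hm.comp hV, h2⟩, ?_⟩
  rw [Measure.map_congr h1, Measure.map_congr h2]
  have hmU : Measurable fun ω => Φ' (U ω) := hm.comp hU
  have hmV : Measurable fun ω => Φ' (V ω) := hm.comp hV
  ext B hB
  rw [Measure.map_apply hmU hB, Measure.map_apply hmV hB]
  -- The measurable version Φ' is known to be invariant only on well-ordered families, hence the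
  -- intersection; it changes the event by a null set.
  have key := h.measure_eq hU hV (measurableSet_wellOrdered.inter (hm hB)) fun w σ hσ => by
    simp only [Set.mem_inter_iff, Set.mem_ofPred_eq, wellOrdered_comp_iff, Set.mem_preimage]
    refine and_congr_right fun hw => ?_
    rw [← heq _ hw, ← heq _ (hw.comp_equiv σ), hΦ.invariant w hw σ hσ]
  calc _ = μ (U ⁻¹' ({w | WellOrdered w} ∩ Φ' ⁻¹' B)) := by
        refine measure_congr ?_
        filter_upwards [hW'] with ω hω
        exact propext ⟨fun hB => ⟨hω, hB⟩, fun hB => hB.2⟩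
    _ = _ := key
    _ = _ := by
        refine measure_congr ?_
        filter_upwards [hW] with ω hω
        exact propext ⟨fun hB => hB.2, fun hB => ⟨hω, hB⟩⟩

end SameTreeLaw

end Functional


/-! ### A centred Gaussian process is determined by its covariance. -/

section GaussianLaw

variable {Ω Ω' T : Type*} [MeasurableSpace Ω] [MeasurableSpace Ω'] {μ : Measure Ω}
  {ν : Measure Ω'}

lemma integral_sq_linear_comb {ι : Type*} [Fintype ι] {V : ι → Ω → ℝ}
    (hV : ∀ i, MemLp (V i) 2 μ) (c : ι → ℝ) :
    ∫ ω, (∑ i, c i * V i ω) ^ 2 ∂μ = ∑ i, ∑ j, c i * c j * ∫ ω, V i ω * V j ω ∂μ := by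
  have hint : ∀ i j, Integrable (fun ω => V i ω * V j ω) μ := fun i j =>
    (hV i).integrable_mul (hV j)
  have h1 : ∀ ω, (∑ i, c i * V i ω) ^ 2 = ∑ i, ∑ j, c i * c j * (V i ω * V j ω) := by
    intro ω
    rw [sq, Finset.sum_mul_sum]
    exact Finset.sum_congr rfl fun i _ => Finset.sum_congr rfl fun j _ => by ring
  simp_rw [h1]
  rw [integral_finsetSum _ fun i _ => integrable_finsetSum _ fun j _ => (hint i j).const_mul _]
  refine Finset.sum_congr rfl fun i _ => ?_
  rw [integral_finsetSum _ fun j _ => (hint i j).const_mul _]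
  exact Finset.sum_congr rfl fun j _ => integral_const_mul _ _

/-- The law of a centered Gaussian process is determined by its covariance. -/
lemma map_eq_of_covariance_eq {X : T → Ω → ℝ} {Y : T → Ω' → ℝ} (hX : IsGaussianProcess X μ)
    (hY : IsGaussianProcess Y ν) (hXm : ∀ t, Measurable (X t)) (hYm : ∀ t, Measurable (Y t))
    (hX0 : ∀ t, ∫ ω, X t ω ∂μ = 0) (hY0 : ∀ t, ∫ ω, Y t ω ∂ν = 0)
    (hcov : ∀ s t, ∫ ω, X s ω * X t ω ∂μ = ∫ ω, Y s ω * Y t ω ∂ν) :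
    μ.map (fun ω t => X t ω) = ν.map (fun ω t => Y t ω) := by
  classical
  have := hX.isProbabilityMeasure
  have := hY.isProbabilityMeasure
  have hXl := isProjectiveLimit_map (P := μ) (X := X) (measurable_pi_lambda _ hXm).aemeasurable
  have hYl := isProjectiveLimit_map (P := ν) (X := Y) (measurable_pi_lambda _ hYm).aemeasurable
  have hfin : ∀ I : Finset T, IsFiniteMeasure (ν.map fun ω => I.restrict (Y · ω)) := fun I =>
    inferInstance
  -- Finite-dimensional marginals determine the law. Each marginal is Gaussian, so its
  -- characteristic function depends only on the means and variances of linear combinations of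
  -- coordinates.
  refine IsProjectiveLimit.unique (P := fun I => ν.map fun ω => I.restrict (Y · ω)) ?_ hYl
  intro I
  rw [hXl I]
  have hm1 : Measurable fun ω => I.restrict (X · ω) := measurable_pi_lambda _ fun i => hXm _
  have hm2 : Measurable fun ω => I.restrict (Y · ω) := measurable_pi_lambda _ fun i => hYm _
  refine Measure.ext_of_charFunDual ?_
  ext L
  rw [(hX.hasGaussianLaw I).charFunDual_map_eq, (hY.hasGaussianLaw I).charFunDual_map_eq]
  have hL : ∀ v : I → ℝ, L v = ∑ i, L (Pi.single i 1) * v i := by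
    intro v
    conv_lhs => rw [pi_eq_sum_univ' v, map_sum]
    refine Finset.sum_congr rfl fun i _ => ?_
    rw [map_smul, smul_eq_mul, mul_comm]
  have hXL : L ∘ (fun ω => I.restrict (X · ω)) = fun ω => ∑ i, L (Pi.single i 1) * X i ω :=
    funext fun ω => hL _
  have hYL : L ∘ (fun ω => I.restrict (Y · ω)) = fun ω => ∑ i, L (Pi.single i 1) * Y i ω :=
    funext fun ω => hL _
  have hX2 : ∀ i : I, MemLp (X i) 2 μ := fun i => (hX.hasGaussianLaw_eval i).memLp_two
  have hY2 : ∀ i : I, MemLp (Y i) 2 ν := fun i => (hY.hasGaussianLaw_eval i).memLp_two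
  have hX1 : ∫ ω, ∑ i, L (Pi.single i 1) * X i ω ∂μ = 0 := by
    rw [integral_finsetSum _ fun i _ => ((hX2 i).integrable one_le_two).const_mul _]
    simp [integral_const_mul, hX0]
  have hY1 : ∫ ω, ∑ i, L (Pi.single i 1) * Y i ω ∂ν = 0 := by
    rw [integral_finsetSum _ fun i _ => ((hY2 i).integrable one_le_two).const_mul _]
    simp [integral_const_mul, hY0]
  rw [hXL, hYL, hX1, hY1, variance_of_integral_eq_zero (by fun_prop) hX1,
    variance_of_integral_eq_zero (by fun_prop) hY1]
  have e1 := integral_sq_linear_comb hX2 fun i => L (Pi.single i 1)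
  have e2 := integral_sq_linear_comb hY2 fun i => L (Pi.single i 1)
  simp_rw [hcov, ← e2] at e1
  rw [e1]

end GaussianLaw

/-! ### The field built from independent normal steps, and its covariance. -/

section Marks

variable {k : ℕ}

/-- The law of a family of independent standard normal variables, one for each label at each
node. -/
noncomputable def markLaw (k : ℕ) : Measure (Node k × ℕ → ℝ) :=
  Measure.infinitePi fun _ => gaussianReal 0 1

instance : IsProbabilityMeasure (markLaw k) := by unfold markLaw; infer_instance

/-- The tree with the given marks. -/
def markTree (z : Node k × ℕ → ℝ) : Tree k := fun n a m => z (⟨n, a⟩, m)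

lemma measurable_markTree : Measurable (markTree (k := k)) := by unfold markTree; fun_prop

/-- The position of the last step of the initial segment of length `n + 1` of a path. -/
def pathIndex (α : Fin k → ℕ) (n : Fin k) : Node k × ℕ := (⟨n, prefixOf α n⟩, α n)

/-- The position of step n includes the label α n, so sharing it means agreeing in the first n + 1
entries; levels are counted from 0, whence the strict inequality. -/
lemma pathIndex_eq_iff (α β : Fin k → ℕ) (n m : Fin k) :
    pathIndex α n = pathIndex β m ↔ n = m ∧ (n : ℕ) < commonLevel α β := by
  rw [← Nat.succ_le_iff, le_commonLevel_iff α β n.isLt]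
  constructor
  · intro h
    simp only [pathIndex, Prod.mk.injEq, Sigma.mk.injEq] at h
    obtain ⟨⟨rfl, h1⟩, h2⟩ := h
    refine ⟨rfl, fun i hi => ?_⟩
    rcases Nat.lt_succ_iff_lt_or_eq.1 hi with hi | hi
    · exact congrFun (eq_of_heq h1) ⟨i, hi⟩
    · rw [Fin.ext hi]; exact h2
  · rintro ⟨rfl, h⟩
    have h1 : prefixOf α n = prefixOf β n := funext fun i => h _ (Nat.lt_succ_of_lt i.2)
    simp only [pathIndex, h1, h n (Nat.lt_succ_self _)]

lemma sum_increments (q : Fin (k + 1) → ℝ) (L : Fin (k + 1)) :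
    ∑ n : Fin k, (if (n : ℕ) < L then q n.succ - q n.castSucc else 0) = q L - q 0 := by
  -- Extending q beyond k by its last value allows telescoping over an initial segment of ℕ.
  let Q : ℕ → ℝ := fun j => q ⟨min j k, Nat.lt_succ_of_le (min_le_right _ _)⟩
  have h1 : ∀ n : Fin k, (if (n : ℕ) < L then q n.succ - q n.castSucc else 0) =
      if (n : ℕ) < L then Q (n + 1) - Q n else 0 := by
    intro n
    have e1 : (⟨min (n + 1) k, Nat.lt_succ_of_le (min_le_right _ _)⟩ : Fin (k + 1)) = n.succ :=
      Fin.ext (min_eq_left n.isLt)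
    have e2 : (⟨min n k, Nat.lt_succ_of_le (min_le_right _ _)⟩ : Fin (k + 1)) = n.castSucc :=
      Fin.ext (min_eq_left n.isLt.le)
    simp only [Q, e1, e2]
  rw [Finset.sum_congr rfl fun n _ => h1 n, Fin.sum_univ_eq_sum_range
    (fun n => if n < (L : ℕ) then Q (n + 1) - Q n else 0) k, ← Finset.sum_filter]
  have h2 : (Finset.range k).filter (· < (L : ℕ)) = Finset.range L := by
    ext n
    simp only [Finset.mem_filter, Finset.mem_range]
    have := L.isLt
    omega
  rw [h2, Finset.sum_range_sub]
  have e1 : (⟨min L k, Nat.lt_succ_of_le (min_le_right _ _)⟩ : Fin (k + 1)) = L :=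
    Fin.ext (min_eq_left (Nat.le_of_lt_succ L.isLt))
  have e2 : (⟨min 0 k, Nat.lt_succ_of_le (min_le_right _ _)⟩ : Fin (k + 1)) = 0 :=
    Fin.ext (min_eq_left (Nat.zero_le k))
  simp only [Q, e1, e2]

lemma isGaussianProcess_infinitePi {ι : Type*} :
    IsGaussianProcess (fun (i : ι) (z : ι → ℝ) => z i)
      (Measure.infinitePi fun _ : ι => gaussianReal 0 1) where
  hasGaussianLaw I := by
    have hlaw : ∀ i : ι, (Measure.infinitePi fun _ : ι => gaussianReal 0 1).map (fun z => z i) =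
        gaussianReal 0 1 := fun i => Measure.infinitePi_map_eval _ i
    refine iIndepFun.hasGaussianLaw (X := fun (i : I) (z : ι → ℝ) => z i) (fun i => ⟨?_⟩) ?_
    · rw [hlaw]; infer_instance
    · exact (iIndepFun_infinitePi (P := fun _ : ι => gaussianReal 0 1)
        (X := fun _ (r : ℝ) => r) fun _ => measurable_id).precomp Subtype.val_injective

lemma integral_gaussianReal_sq : ∫ z, z * z ∂gaussianReal 0 1 = 1 := by
  have h := variance_id_gaussianReal (μ := 0) (v := 1)
  rw [variance_of_integral_eq_zero (by fun_prop) (by simp)] at h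
  simpa [sq] using h

lemma integral_infinitePi_mul {ι : Type*} [DecidableEq ι] (i j : ι) :
    ∫ z, z i * z j ∂(Measure.infinitePi fun _ : ι => gaussianReal 0 1) =
      if i = j then 1 else 0 := by
  split_ifs with hij
  · subst hij
    have := integral_map (μ := Measure.infinitePi fun _ : ι => gaussianReal 0 1)
      (φ := fun z => z i) (f := fun z => z * z) (measurable_pi_apply i).aemeasurable (by fun_prop)
    rw [Measure.infinitePi_map_eval, integral_gaussianReal_sq] at this
    exact this.symm
  · have hind : IndepFun (fun z : ι → ℝ => z i) (fun z => z j)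
        (Measure.infinitePi fun _ : ι => gaussianReal 0 1) :=
      (iIndepFun_infinitePi (P := fun _ : ι => gaussianReal 0 1)
        (X := fun _ (r : ℝ) => r) fun _ => measurable_id).indepFun hij
    have h0 : ∫ z : ι → ℝ, z i ∂(Measure.infinitePi fun _ : ι => gaussianReal 0 1) = 0 := by
      have := integral_map (μ := Measure.infinitePi fun _ : ι => gaussianReal 0 1)
        (φ := fun z => z i) (f := id) (measurable_pi_apply i).aemeasurable (by fun_prop)
      rw [Measure.infinitePi_map_eval] at this
      simpa using this.symm
    rw [hind.integral_fun_mul_eq_mul_integral (measurable_pi_apply i).aestronglyMeasurable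
      (measurable_pi_apply j).aestronglyMeasurable, h0, zero_mul]

lemma treeField_markTree (q : Fin (k + 1) → ℝ) (z : Node k × ℕ → ℝ) (α : Fin k → ℕ) :
    treeField q (markTree z) α =
      ∑ n : Fin k, Real.sqrt (q n.succ - q n.castSucc) * z (pathIndex α n) := rfl

lemma isGaussianProcess_treeField (q : Fin (k + 1) → ℝ) :
    IsGaussianProcess (fun α z => treeField q (markTree z) α) (markLaw k) := by
  classical
  refine isGaussianProcess_infinitePi.of_isGaussianProcess fun α =>
    ⟨Finset.univ.image (pathIndex α),
      ∑ n : Fin k, Real.sqrt (q n.succ - q n.castSucc) •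
        ContinuousLinearMap.proj (R := ℝ) (φ := fun _ : Finset.univ.image (pathIndex α) => ℝ)
          ⟨pathIndex α n, Finset.mem_image_of_mem _ (Finset.mem_univ n)⟩, fun z => ?_⟩
  rw [treeField_markTree]
  simp

lemma integral_treeField (q : Fin (k + 1) → ℝ) (α : Fin k → ℕ) :
    ∫ z, treeField q (markTree z) α ∂markLaw k = 0 := by
  have hG := isGaussianProcess_infinitePi (ι := Node k × ℕ)
  simp_rw [treeField_markTree]
  rw [integral_finsetSum _ fun n _ => by
    exact (hG.hasGaussianLaw_eval (pathIndex α n)).integrable.const_mul _]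
  refine Finset.sum_eq_zero fun n _ => ?_
  rw [integral_const_mul]
  have := integral_map (μ := markLaw k) (φ := fun z => z (pathIndex α n)) (f := id)
    (measurable_pi_apply _).aemeasurable (by fun_prop)
  rw [markLaw, Measure.infinitePi_map_eval] at this
  simp only [id_eq, integral_id_gaussianReal] at this
  rw [markLaw, ← this, mul_zero]

/-- Only steps shared by the two paths are correlated. Their variances telescope to q_n − q_0 at the
common level n; monotonicity of q makes the squares of the square roots equal to the increments. -/
lemma integral_treeField_mul {q : Fin (k + 1) → ℝ} (hq : Monotone q) (α β : Fin k → ℕ) :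
    ∫ z, treeField q (markTree z) α * treeField q (markTree z) β ∂markLaw k =
      overlap q α β - q 0 := by
  classical
  have hG := isGaussianProcess_infinitePi (ι := Node k × ℕ)
  have hint : ∀ i j : Node k × ℕ, Integrable (fun z => z i * z j) (markLaw k) := fun i j =>
    (hG.hasGaussianLaw_eval i).memLp_two.integrable_mul (hG.hasGaussianLaw_eval j).memLp_two
  simp_rw [treeField_markTree, Finset.sum_mul_sum, fun (z : Node k × ℕ → ℝ) n m =>
    mul_mul_mul_comm (Real.sqrt (q (Fin.succ n) - q n.castSucc)) (z (pathIndex α n))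
      (Real.sqrt (q (Fin.succ m) - q m.castSucc)) (z (pathIndex β m))]
  rw [integral_finsetSum _ fun n _ => integrable_finsetSum _ fun m _ =>
    (hint _ _).const_mul _]
  simp_rw [integral_finsetSum _ fun m _ => (hint _ _).const_mul _, integral_const_mul, markLaw,
    integral_infinitePi_mul, pathIndex_eq_iff]
  rw [overlap, ← sum_increments]
  refine Finset.sum_congr rfl fun n _ => ?_
  rw [Finset.sum_eq_single n]
  · have := sub_nonneg.2 (hq n.castSucc_lt_succ.le)
    simp [Real.mul_self_sqrt this]
  · intro m _ hmn
    simp [hmn.symm]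
  · simp

/-- The random field `√q₀ g + treeField q Z`. -/
lemma isGaussianProcess_rootField (q : Fin (k + 1) → ℝ) :
    IsGaussianProcess
      (fun α (p : ℝ × (Node k × ℕ → ℝ)) => Real.sqrt (q 0) * p.1 + treeField q (markTree p.2) α)
      ((gaussianReal 0 1).prod (markLaw k)) where
  hasGaussianLaw I := by
    have hid : HasGaussianLaw (fun p : ℝ × (Node k × ℕ → ℝ) => p.1)
        ((gaussianReal 0 1).prod (markLaw k)) := ⟨by
      have : ((gaussianReal 0 1).prod (markLaw k)).map (fun p => p.1) = gaussianReal 0 1 :=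
        Measure.fst_prod
      rw [this]; infer_instance⟩
    have h1 : HasGaussianLaw (fun (p : ℝ × (Node k × ℕ → ℝ)) (_ : I) => Real.sqrt (q 0) * p.1)
        ((gaussianReal 0 1).prod (markLaw k)) :=
      hid.map (ContinuousLinearMap.pi fun _ : I => Real.sqrt (q 0) • ContinuousLinearMap.id ℝ ℝ)
    have hmf : Measurable fun (z : Node k × ℕ → ℝ) (i : I) => treeField q (markTree z) i :=
      measurable_pi_lambda _ fun i => (measurable_treeField q i).comp measurable_markTree
    have h2 : HasGaussianLaw (fun (p : ℝ × (Node k × ℕ → ℝ)) (i : I) =>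
        treeField q (markTree p.2) i) ((gaussianReal 0 1).prod (markLaw k)) := ⟨by
      have : ((gaussianReal 0 1).prod (markLaw k)).map (fun p (i : I) =>
          treeField q (markTree p.2) i) = (markLaw k).map fun z (i : I) =>
            treeField q (markTree z) i := by
        rw [← Measure.snd_prod (μ := gaussianReal 0 1) (ν := markLaw k), Measure.snd,
          Measure.map_map hmf measurable_snd]
        rw [← Measure.snd, Measure.snd_prod]
        rfl
      rw [this]
      exact ((isGaussianProcess_treeField q).hasGaussianLaw I).isGaussian_map⟩
    have hind : IndepFun (fun (p : ℝ × (Node k × ℕ → ℝ)) (_ : I) => Real.sqrt (q 0) * p.1)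
        (fun p (i : I) => treeField q (markTree p.2) i) ((gaussianReal 0 1).prod (markLaw k)) :=
      indepFun_prod (X := fun (g : ℝ) (_ : I) => Real.sqrt (q 0) * g) (by fun_prop) hmf
    exact (hind.hasGaussianLaw h1 h2).add

end Marks


/-! ### Adding the common variable √q_0 g to obtain the covariance q. -/

section RootField

variable {k : ℕ}

lemma integral_rootField (q : Fin (k + 1) → ℝ) (α : Fin k → ℕ) :
    ∫ p, Real.sqrt (q 0) * p.1 + treeField q (markTree p.2) α
      ∂((gaussianReal 0 1).prod (markLaw k)) = 0 := by
  have hT : Integrable (fun z => treeField q (markTree z) α) (markLaw k) :=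
    ((isGaussianProcess_treeField q).hasGaussianLaw_eval α).integrable
  have hg : Integrable (fun g : ℝ => Real.sqrt (q 0) * g) (gaussianReal 0 1) :=
    (IsGaussian.hasGaussianLaw_id (μ := gaussianReal 0 1)).integrable.const_mul _
  have h1 := integral_fun_fst (μ := gaussianReal 0 1) (ν := markLaw k)
    fun g : ℝ => Real.sqrt (q 0) * g
  have h2 := integral_fun_snd (μ := gaussianReal 0 1) (ν := markLaw k)
    fun z => treeField q (markTree z) α
  rw [integral_add (hg.comp_fst _) (hT.comp_snd _), h1, h2, integral_treeField, integral_const_mul]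
  simp

lemma integral_rootField_mul {q : Fin (k + 1) → ℝ} (hq : Monotone q) (hq0 : 0 ≤ q 0)
    (α β : Fin k → ℕ) :
    ∫ p, (Real.sqrt (q 0) * p.1 + treeField q (markTree p.2) α) *
        (Real.sqrt (q 0) * p.1 + treeField q (markTree p.2) β)
      ∂((gaussianReal 0 1).prod (markLaw k)) = overlap q α β := by
  have hT2 : ∀ α, MemLp (fun z => treeField q (markTree z) α) 2 (markLaw k) := fun α =>
    ((isGaussianProcess_treeField q).hasGaussianLaw_eval α).memLp_two
  have hT : ∀ α, Integrable (fun z => treeField q (markTree z) α) (markLaw k) := fun α =>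
    (hT2 α).integrable one_le_two
  have hid2 : MemLp (fun g : ℝ => g) 2 (gaussianReal 0 1) :=
    (IsGaussian.hasGaussianLaw_id (μ := gaussianReal 0 1)).memLp_two
  have hid : Integrable (fun g : ℝ => g) (gaussianReal 0 1) := hid2.integrable one_le_two
  have hsum : Integrable (fun z => treeField q (markTree z) α + treeField q (markTree z) β)
      (markLaw k) := (hT α).add (hT β)
  have hprod : Integrable (fun z => treeField q (markTree z) α * treeField q (markTree z) β)
      (markLaw k) := (hT2 α).integrable_mul (hT2 β)
  have hsq : Integrable (fun g : ℝ => q 0 * (g * g)) (gaussianReal 0 1) :=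
    (hid2.integrable_mul hid2).const_mul _
  have hexp : ∀ p : ℝ × (Node k × ℕ → ℝ),
      (Real.sqrt (q 0) * p.1 + treeField q (markTree p.2) α) *
        (Real.sqrt (q 0) * p.1 + treeField q (markTree p.2) β) =
      (q 0 * (p.1 * p.1) +
        Real.sqrt (q 0) * p.1 * (treeField q (markTree p.2) α + treeField q (markTree p.2) β)) +
        treeField q (markTree p.2) α * treeField q (markTree p.2) β := by
    intro p
    have := Real.mul_self_sqrt hq0
    linear_combination (p.1 * p.1) * this
  simp_rw [hexp]
  have hcross : Integrable (fun p : ℝ × (Node k × ℕ → ℝ) => Real.sqrt (q 0) * p.1 *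
      (treeField q (markTree p.2) α + treeField q (markTree p.2) β))
      ((gaussianReal 0 1).prod (markLaw k)) := (hid.const_mul _).mul_prod hsum
  have h1 := integral_fun_fst (μ := gaussianReal 0 1) (ν := markLaw k)
    fun g : ℝ => q 0 * (g * g)
  have h2 := integral_fun_snd (μ := gaussianReal 0 1) (ν := markLaw k)
    fun z => treeField q (markTree z) α * treeField q (markTree z) β
  have h3 := integral_prod_mul (μ := gaussianReal 0 1) (ν := markLaw k)
    (fun g : ℝ => Real.sqrt (q 0) * g)
    fun z => treeField q (markTree z) α + treeField q (markTree z) β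
  have hleft : Integrable (fun p : ℝ × (Node k × ℕ → ℝ) => q 0 * (p.1 * p.1) +
      Real.sqrt (q 0) * p.1 * (treeField q (markTree p.2) α + treeField q (markTree p.2) β))
      ((gaussianReal 0 1).prod (markLaw k)) := (hsq.comp_fst _).add hcross
  rw [integral_add hleft (hprod.comp_snd _),
    integral_add (hsq.comp_fst _) hcross, h1, h2, h3, integral_treeField_mul hq,
    integral_const_mul, integral_const_mul, integral_gaussianReal_sq]
  simp

lemma measurable_rootField (q : Fin (k + 1) → ℝ) :
    Measurable fun (p : ℝ × (Node k × ℕ → ℝ)) α =>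
      Real.sqrt (q 0) * p.1 + treeField q (markTree p.2) α := by
  refine measurable_pi_lambda _ fun α => ?_
  have := (measurable_treeField q α).comp measurable_markTree
  exact (measurable_fst.const_mul _).add (this.comp measurable_snd)

/-- A centered Gaussian field whose covariance is the overlap has the law of a sum of independent
normal variables along the paths. -/
lemma map_field_eq_map_rootField {Ω : Type*} [MeasurableSpace Ω] {μ : Measure Ω}
    {q : Fin (k + 1) → ℝ} (hq : Monotone q) (hq0 : 0 ≤ q 0) {η : (Fin k → ℕ) → Ω → ℝ}
    (hη_meas : ∀ α, Measurable (η α)) (hη : IsGaussianProcess η μ)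
    (hη_mean : ∀ α, ∫ ω, η α ω ∂μ = 0)
    (hη_cov : ∀ α β, ∫ ω, η α ω * η β ω ∂μ = overlap q α β) :
    μ.map (fun ω α => η α ω) = ((gaussianReal 0 1).prod (markLaw k)).map
      fun p α => Real.sqrt (q 0) * p.1 + treeField q (markTree p.2) α :=
  map_eq_of_covariance_eq hη (isGaussianProcess_rootField q) hη_meas
    (fun α => (measurable_pi_apply α).comp (measurable_rootField q)) hη_mean
    (integral_rootField q) fun α β => by rw [hη_cov, integral_rootField_mul hq hq0]

end RootField

/-! ### A cascade with independent marks as a marked forest. -/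

section Cascade

variable {Ω : Type*} [MeasurableSpace Ω] {μ : Measure Ω}

lemma IsREM.comp_measurePreserving {Ω' : Type*} [MeasurableSpace Ω'] {μ' : Measure Ω'} {x : ℝ}
    {X : ℕ → Ω → ℝ} (h : IsREM x X μ) {f : Ω' → Ω} (hf : MeasurePreserving f μ' μ) :
    IsREM x (fun m ω => X m (f ω)) μ' where
  measurable m := (h.measurable m).comp hf.measurable
  indep r A hA hd := by
    have key := h.indep r A hA hd
    rw [iIndepFun_iff_measure_inter_preimage_eq_mul] at key ⊢
    intro S s hs
    have hm : ∀ i ∈ S, MeasurableSet (occupation X (A i) ⁻¹' s i) := fun i hi =>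
      measurable_occupation h.measurable (hA i) (hs i hi)
    have h1 := hf.measure_preimage (S.measurableSet_biInter hm).nullMeasurableSet
    have h2 : ∀ i ∈ S, μ' (f ⁻¹' (occupation X (A i) ⁻¹' s i)) = μ (occupation X (A i) ⁻¹' s i) :=
      fun i hi => hf.measure_preimage (hm i hi).nullMeasurableSet
    rw [key S hs, ← Finset.prod_congr rfl h2, Set.preimage_iInter₂] at h1
    exact h1
  law A hA hfin n := by
    rw [← h.law A hA hfin n]
    exact hf.measure_preimage (measurable_occupation h.measurable hA
      (MeasurableSet.of_discrete (s := {(n : ℕ∞)}))).nullMeasurableSet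

/-- Marking with the constant factor 1. -/
lemma IsREM.isPPP [IsProbabilityMeasure μ] {x : ℝ} (hx : 0 < x) {X : ℕ → Ω → ℝ}
    (h : IsREM x X μ) : IsPPP (remIntensity x) X μ := by
  have := h.isPPP_mul (β := Unit) (γ := Measure.dirac ()) (a := fun _ => 1) (by fun_prop)
    (fun _ => one_pos) hx (by simp) (Z := fun _ _ => ()) (by fun_prop)
    (by rw [Measure.infinitePi_dirac, Measure.map_const, measure_univ, one_smul])
    (indepFun_const_right _ _)
  simpa using this

variable {k : ℕ} {x : Fin k → ℝ} {X : (n : Fin k) → (Fin n → ℕ) → ℕ → Ω → ℝ}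

/-- The numbers of a cascade as a random tree. -/
def cascadeTree (X : (n : Fin k) → (Fin n → ℕ) → ℕ → Ω → ℝ) (ω : Ω) : Tree k :=
  fun n a m => X n a m ω

lemma IsCascade.measurable_cascadeTree (h : IsCascade x X μ) : Measurable (cascadeTree X) :=
  measurable_pi_lambda _ fun n => measurable_pi_lambda _ fun a =>
    measurable_pi_lambda _ fun m => (h.rem n a).measurable m

lemma IsCascade.measurable_weight (h : IsCascade x X μ) :
    Measurable fun ω α => weight X α ω :=
  measurable_pi_lambda _ fun α => (measurable_treeWeight α).comp h.measurable_cascadeTree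

lemma markLaw_map_curry : (markLaw k).map (fun z (p : Node k) (m : ℕ) => z (p, m)) =
    Measure.infinitePi fun _ : Node k => Measure.infinitePi fun _ : ℕ => gaussianReal 0 1 :=
  Measure.infinitePi_map_curry fun (_ : Node k) (_ : ℕ) => gaussianReal 0 1

lemma IsCascade.isMarkedForest [IsProbabilityMeasure μ] (h : IsCascade x X μ) :
    IsMarkedForest x (fun (_ : Unit) (p : Ω × (Node k × ℕ → ℝ)) => cascadeTree X p.1)
      (fun _ p => markTree p.2) (μ.prod (markLaw k)) := by
  have hfst : MeasurePreserving Prod.fst (μ.prod (markLaw k)) μ := measurePreserving_fst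
  have hsnd : MeasurePreserving Prod.snd (μ.prod (markLaw k)) (markLaw k) :=
    measurePreserving_snd
  have hXn : ∀ p : Node k, Measurable fun ω (m : ℕ) => X p.1 p.2 m ω := fun p =>
    measurable_pi_lambda _ (h.rem p.1 p.2).measurable
  have hZn : ∀ p : Node k, Measurable fun (z : Node k × ℕ → ℝ) (m : ℕ) => z (p, m) := fun p => by
    fun_prop
  have hlaw : ∀ p : Node k, (markLaw k).map (fun z (m : ℕ) => z (p, m)) =
      Measure.infinitePi fun _ : ℕ => gaussianReal 0 1 := by
    intro p
    exact Measure.map_infinitePi_infinitePi_of_inj (P := fun _ : Node k × ℕ => gaussianReal 0 1)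
      (Prod.mk_right_injective p)
  refine ⟨fun _ n a => (h.rem n a).comp_measurePreserving hfst,
    fun _ n a => (hZn ⟨n, a⟩).comp measurable_snd, fun _ n a => ?_, fun _ n a => ?_, ?_⟩
  · rw [← hlaw ⟨n, a⟩, ← hsnd.map_eq, Measure.map_map (hZn ⟨n, a⟩) measurable_snd, hsnd.map_eq]
    rfl
  · exact indepFun_prod (hXn ⟨n, a⟩) (hZn ⟨n, a⟩)
  · have hpair : ∀ p : Node k, Measurable fun w : Ω × (Node k × ℕ → ℝ) =>
        ((fun m => X p.1 p.2 m w.1, fun m => w.2 (p, m)) : (ℕ → ℝ) × (ℕ → ℝ)) := fun p =>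
      ((hXn p).comp measurable_fst).prodMk ((hZn p).comp measurable_snd)
    -- Points and marks live on different factors of the product space and are independent over the
    -- nodes on each. Pairing the two product laws node by node gives a product law.
    have hnode : iIndepFun (fun (p : Node k) (w : Ω × (Node k × ℕ → ℝ)) =>
        ((fun m => X p.1 p.2 m w.1, fun m => w.2 (p, m)) : (ℕ → ℝ) × (ℕ → ℝ)))
        (μ.prod (markLaw k)) := by
      rw [iIndepFun_iff_map_fun_eq_infinitePi_map hpair]
      have h1 : ∀ p : Node k, (μ.prod (markLaw k)).map (fun w =>
          ((fun m => X p.1 p.2 m w.1, fun m => w.2 (p, m)) : (ℕ → ℝ) × (ℕ → ℝ))) =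
          (μ.map fun ω m => X p.1 p.2 m ω).prod
            (Measure.infinitePi fun _ : ℕ => gaussianReal 0 1) := by
        intro p
        rw [← hlaw p, Measure.map_prod_map _ _ (hXn p) (hZn p)]
        rfl
      have hprob : ∀ p : Node k, IsProbabilityMeasure (μ.map fun ω m => X p.1 p.2 m ω) := fun p =>
        Measure.isProbabilityMeasure_map (hXn p).aemeasurable
      simp_rw [h1]
      rw [← infinitePi_prod_map_pair, ← h.indep.map_fun_eq_infinitePi_map hXn,
        ← markLaw_map_curry, Measure.map_prod_map _ _ (measurable_pi_lambda _ hXn)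
          (measurable_pi_lambda _ hZn), Measure.map_map (by fun_prop) ((measurable_pi_lambda _ hXn).prodMap
          (measurable_pi_lambda _ hZn))]
      rfl
    exact hnode.precomp (g := fun p : Unit × Node k => p.2) fun a b hab => Prod.ext rfl hab

end Cascade


/-! ### Comparison of perturbed and unperturbed weights. -/

section Main

variable {Ω : Type*} [MeasurableSpace Ω] {μ : Measure Ω} {k : ℕ} {x : Fin k → ℝ}
  {X : (n : Fin k) → (Fin n → ℕ) → ℕ → Ω → ℝ}

/-- The laws of the ordered points of the processes of the cascade, one for each level. -/
noncomputable def levelLaw (X : (n : Fin k) → (Fin n → ℕ) → ℕ → Ω → ℝ) (μ : Measure Ω)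
    (n : Fin k) : Measure (ℕ → ℝ) :=
  μ.map fun ω => sortSeq fun m => X n (fun _ => 0) m ω

/-- Every invariant function of the perturbed weights has the expectation that it has for the
weights multiplied by an independent factor. -/
lemma IsCascade.lintegral_perturbed [IsProbabilityMeasure μ] (h : IsCascade x X μ)
    (hx : ∀ n, 0 < x n) (q : Fin (k + 1) → ℝ) {ψ : ℝ → ℝ} {K : ℝ≥0} (hψ : LipschitzWith K ψ)
    (y : ℝ) {F : ((Fin k → ℕ) → ℝ) → ℝ≥0∞} (hF : Measurable F)
    (hinv : ∀ w, ∀ σ : Equiv.Perm (Fin k → ℕ), IsTreeAut σ → F (w ∘ σ) = F w) :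
    ∫⁻ p, F (perturbed ψ q y (cascadeTree X p.1) (markTree p.2)) ∂(μ.prod (markLaw k)) =
      ∫⁻ W, F (fun α => Real.exp (psiLevel x q ψ 0 y) * W () α)
        ∂(Measure.infinitePi fun _ : Unit => canonLaw k (levelLaw X μ)) := by
  have hPPP : ∀ n, IsPPP (remIntensity (x n)) (X n fun _ => 0) μ := fun n =>
    (h.rem n _).isPPP (hx n)
  have hprob : ∀ n, IsProbabilityMeasure (levelLaw X μ n) := fun n =>
    Measure.isProbabilityMeasure_map (measurable_sortSeq.comp (hPPP n).measurable_pi).aemeasurable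
  -- The forest consists of one tree. Every Poisson process of the right intensity has the sorted
  -- law of the process at the zero address, so this choice in `levelLaw` is immaterial.
  exact lintegral_perturbed_forest hx q hψ hprob
    (fun n Y hY => hY.map_sortSeq_eq (hx n) (hPPP n)) h.isMarkedForest (fun _ => y)
    (F := fun W => F (W ())) (hF.comp (measurable_pi_apply ()))
    (fun τ hτ w => hinv (w ()) (τ ()) (hτ ()))

/-- The perturbation result with ψ = 0: it identifies the unperturbed weights with the reference
law, so both families can be compared with the same object. -/
lemma IsCascade.lintegral_const_mul_weight [IsProbabilityMeasure μ] (h : IsCascade x X μ)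
    (hx : ∀ n, 0 < x n) (c : ℝ) {F : ((Fin k → ℕ) → ℝ) → ℝ≥0∞} (hF : Measurable F)
    (hinv : ∀ w, ∀ σ : Equiv.Perm (Fin k → ℕ), IsTreeAut σ → F (w ∘ σ) = F w) :
    ∫⁻ ω, F (fun α => c * weight X α ω) ∂μ =
      ∫⁻ W, F (fun α => c * W () α)
        ∂(Measure.infinitePi fun _ : Unit => canonLaw k (levelLaw X μ)) := by
  have hc : Measurable fun (w : (Fin k → ℕ) → ℝ) α => c * w α := by fun_prop
  have key := h.lintegral_perturbed hx 0 (ψ := fun _ => 0) (K := 0)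
    (LipschitzWith.const 0) 0 (F := fun w => F fun α => c * w α) (hF.comp hc)
    fun w σ hσ => hinv (fun α => c * w α) σ hσ
  simp only [psiLevel_zero_fun, perturbed, Real.exp_zero, one_mul] at key
  rw [← key]
  exact (measurePreserving_fst.lintegral_comp
    (f := fun ω => F fun α => c * weight X α ω) (hF.comp (hc.comp h.measurable_weight))).symm

lemma IsCascade.ae_wellOrdered_weight [IsProbabilityMeasure μ] (h : IsCascade x X μ)
    (hmono : StrictMono x) (hx : ∀ n, 0 < x n) (hx1 : ∀ n, x n < 1) :
    ∀ᵐ ω ∂μ, WellOrdered fun α => weight X α ω := by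
  have hPPP : ∀ n, IsPPP (remIntensity (x n)) (X n fun _ => 0) μ := fun n =>
    (h.rem n _).isPPP (hx n)
  have hprob : ∀ n, IsProbabilityMeasure (levelLaw X μ n) := fun n =>
    Measure.isProbabilityMeasure_map (measurable_sortSeq.comp (hPPP n).measurable_pi).aemeasurable
  have hcan := isProbabilityMeasure_canonLaw (levelLaw X μ) hprob
  have hlaw : SameTreeLaw (fun ω α => weight X α ω) (fun W => W ()) μ
      (Measure.infinitePi fun _ : Unit => canonLaw k (levelLaw X μ)) := by
    intro F hF hinv
    simpa using h.lintegral_const_mul_weight hx 1 hF hinv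
  refine hlaw.ae_wellOrdered h.measurable_weight (measurable_pi_apply _) ?_
  exact (measurePreserving_eval_infinitePi
    (fun _ : Unit => canonLaw k (levelLaw X μ)) ()).quasiMeasurePreserving.ae
    (ae_canonLaw_wellOrdered hmono hx hx1 hprob fun n => isPPP_map_sortSeq (hx n) (hPPP n))

/-- The perturbed weights have the law of the weights multiplied by a function of an independent
standard normal variable. -/
lemma IsCascade.sameTreeLaw [IsProbabilityMeasure μ] (h : IsCascade x X μ)
    (hx : ∀ n, 0 < x n) {q : Fin (k + 1) → ℝ} (hq : Monotone q) (hq0 : 0 ≤ q 0)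
    {η : (Fin k → ℕ) → Ω → ℝ} (hη_meas : ∀ α, Measurable (η α)) (hη : IsGaussianProcess η μ)
    (hη_mean : ∀ α, ∫ ω, η α ω ∂μ = 0)
    (hη_cov : ∀ α β, ∫ ω, η α ω * η β ω ∂μ = overlap q α β)
    (hη_indep : IndepFun (fun ω α => η α ω)
      (fun ω (p : Σ n : Fin k, (Fin n → ℕ)) (m : ℕ) => X p.1 p.2 m ω) μ)
    {ψ : ℝ → ℝ} {K : ℝ≥0} (hψ : LipschitzWith K ψ) :
    SameTreeLaw (fun ω α => Real.exp (ψ (η α ω)) * weight X α ω)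
      (fun (p : Ω × ℝ) α =>
        Real.exp (psiLevel x q ψ 0 (Real.sqrt (q 0) * p.2)) * weight X α p.1)
      μ (μ.prod (gaussianReal 0 1)) := by
  intro F hF hinv
  have hψm : Measurable ψ := hψ.continuous.measurable
  have hψ0 : Measurable (psiLevel x q ψ 0) := (lipschitzWith_psiLevel hx q hψ 0).continuous.measurable
  have hηm : Measurable fun ω α => η α ω := measurable_pi_lambda _ hη_meas
  have hind : IndepFun (cascadeTree X) (fun ω α => η α ω) μ :=
    hη_indep.symm.comp (φ := fun (v : Node k → ℕ → ℝ) => (fun n a m => v ⟨n, a⟩ m : Tree k))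
      (by fun_prop) measurable_id
  have hG : Measurable (Function.uncurry fun (D : Tree k) (v : (Fin k → ℕ) → ℝ) =>
      F fun α => Real.exp (ψ (v α)) * treeWeight D α) := by
    refine hF.comp (measurable_pi_lambda _ fun α => ?_)
    have := measurable_treeWeight α
    fun_prop
  have hR := measurable_rootField q
  have hP : Measurable fun p : Ω × ℝ × (Node k × ℕ → ℝ) =>
      F (perturbed ψ q (Real.sqrt (q 0) * p.2.1) (cascadeTree X p.1) (markTree p.2.2)) := by
    refine hF.comp ((measurable_perturbed hψm q).comp
      (f := fun p : Ω × ℝ × (Node k × ℕ → ℝ) =>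
        (Real.sqrt (q 0) * p.2.1, cascadeTree X p.1, markTree p.2.2)) ?_)
    have h1 := h.measurable_cascadeTree
    have h2 := measurable_markTree (k := k)
    fun_prop
  -- The field is integrated out first, with its law replaced by that of √q_0 g plus the tree field.
  -- For fixed g the starting value is y = √q_0 g, and both families are compared through the
  -- reference law.
  calc ∫⁻ ω, F (fun α => Real.exp (ψ (η α ω)) * weight X α ω) ∂μ
      = ∫⁻ ω, ∫⁻ v, F (fun α => Real.exp (ψ (v α)) * treeWeight (cascadeTree X ω) α)
          ∂(μ.map fun ω α => η α ω) ∂μ :=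
        lintegral_indepFun hind h.measurable_cascadeTree hηm hG
    _ = ∫⁻ ω, ∫⁻ p, F (perturbed ψ q (Real.sqrt (q 0) * p.1) (cascadeTree X ω) (markTree p.2))
          ∂((gaussianReal 0 1).prod (markLaw k)) ∂μ := by
        rw [map_field_eq_map_rootField hq hq0 hη_meas hη hη_mean hη_cov]
        exact lintegral_congr fun ω => lintegral_map (hG.comp measurable_prodMk_left) hR
    _ = ∫⁻ ω, ∫⁻ g, ∫⁻ z, F (perturbed ψ q (Real.sqrt (q 0) * g) (cascadeTree X ω) (markTree z))
          ∂(markLaw k) ∂(gaussianReal 0 1) ∂μ :=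
        lintegral_congr fun ω => lintegral_prod _ (hP.comp measurable_prodMk_left).aemeasurable
    _ = ∫⁻ g, ∫⁻ ω, ∫⁻ z, F (perturbed ψ q (Real.sqrt (q 0) * g) (cascadeTree X ω) (markTree z))
          ∂(markLaw k) ∂μ ∂(gaussianReal 0 1) := by
        refine lintegral_lintegral_swap (Measurable.aemeasurable ?_)
        exact Measurable.lintegral_prod_right' (f := fun p : (Ω × ℝ) × (Node k × ℕ → ℝ) =>
          F (perturbed ψ q (Real.sqrt (q 0) * p.1.2) (cascadeTree X p.1.1) (markTree p.2)))
          (hP.comp (f := fun p : (Ω × ℝ) × (Node k × ℕ → ℝ) => (p.1.1, p.1.2, p.2)) (by fun_prop))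
    _ = ∫⁻ g, ∫⁻ ω, F (fun α => Real.exp (psiLevel x q ψ 0 (Real.sqrt (q 0) * g)) *
          weight X α ω) ∂μ ∂(gaussianReal 0 1) := by
        refine lintegral_congr fun g => ?_
        rw [h.lintegral_const_mul_weight hx _ hF hinv, ← h.lintegral_perturbed hx q hψ _ hF hinv]
        exact (lintegral_prod (fun p : Ω × (Node k × ℕ → ℝ) =>
          F (perturbed ψ q (Real.sqrt (q 0) * g) (cascadeTree X p.1) (markTree p.2)))
          (hP.comp (f := fun p : Ω × (Node k × ℕ → ℝ) => (p.1, g, p.2))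
            (by fun_prop)).aemeasurable).symm
    _ = _ := by
        refine (lintegral_prod_symm' (fun p : Ω × ℝ => F fun α =>
          Real.exp (psiLevel x q ψ 0 (Real.sqrt (q 0) * p.2)) * weight X α p.1) ?_).symm
        refine hF.comp (measurable_pi_lambda _ fun α => ?_)
        have := (measurable_pi_apply α).comp h.measurable_weight
        exact (Real.measurable_exp.comp (hψ0.comp (measurable_snd.const_mul _))).mul
          (this.comp measurable_fst)

lemma identDistrib_comp_fst {Ω' E : Type*} [MeasurableSpace Ω'] [MeasurableSpace E]
    {ν : Measure Ω'} [IsProbabilityMeasure ν] [SFinite μ] {f : Ω → E} (hf : AEMeasurable f μ) :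
    IdentDistrib (fun p : Ω × Ω' => f p.1) f (μ.prod ν) μ where
  aemeasurable_fst := hf.comp_quasiMeasurePreserving Measure.quasiMeasurePreserving_fst
  aemeasurable_snd := hf
  map_eq := by
    have hfst : MeasurePreserving Prod.fst (μ.prod ν) μ := measurePreserving_fst
    have := AEMeasurable.map_map_of_aemeasurable (μ := μ.prod ν) (f := Prod.fst) (g := f)
      (by rwa [hfst.map_eq]) hfst.measurable.aemeasurable
    rw [hfst.map_eq] at this
    exact this.symm

end Main

end RPC

theorem theorem4p4 {Ω : Type*} [MeasurableSpace Ω] (μ : Measure Ω) [IsProbabilityMeasure μ]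
    (k : ℕ) (hk : 1 ≤ k)
    (x : Fin k → ℝ) (hx : StrictMono x) (hx0 : ∀ n, 0 < x n) (hx1 : ∀ n, x n < 1)
    (q : Fin (k + 1) → ℝ) (hq : StrictMono q) (hq0 : 0 ≤ q 0) (hq1 : q (Fin.last k) ≤ 1)
    (X : (n : Fin k) → (Fin n → ℕ) → ℕ → Ω → ℝ) (hX : RPC.IsCascade x X μ)
    (η : (Fin k → ℕ) → Ω → ℝ) (hη_meas : ∀ α, Measurable (η α))
    (hη : IsGaussianProcess η μ) (hη_mean : ∀ α, ∫ ω, η α ω ∂μ = 0)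
    (hη_cov : ∀ α β, ∫ ω, η α ω * η β ω ∂μ = RPC.overlap q α β)
    (hη_indep : IndepFun (fun ω α => η α ω)
      (fun ω (p : Σ n : Fin k, (Fin n → ℕ)) (m : ℕ) => X p.1 p.2 m ω) μ)
    (ψ : ℝ → ℝ) (K : ℝ≥0) (hψ : LipschitzWith K ψ) :
    -- the recursion is well defined
    (∀ (j : Fin k) (y : ℝ), Integrable (fun z => Real.exp (x j *
        RPC.psiLevel x q ψ j.succ (y + Real.sqrt (q j.succ - q j.castSucc) * z)))
      (gaussianReal 0 1)) ∧
    -- both families of weights can be ordered and normalised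
    (∀ᵐ ω ∂μ, RPC.WellOrdered (fun α => RPC.weight X α ω) ∧
      RPC.WellOrdered (fun α => Real.exp (ψ (η α ω)) * RPC.weight X α ω)) ∧
    -- if `q_0 = 0`, the factor is a deterministic constant
    (q 0 = 0 →
      IdentDistrib
        (fun ω => RPC.config q fun α => Real.exp (ψ (η α ω)) * RPC.weight X α ω)
        (fun ω => RPC.config q fun α => Real.exp (RPC.psiLevel x q ψ 0 0) * RPC.weight X α ω)
        μ μ ∧
      IdentDistrib
        (fun ω => ∑' α, Real.exp (ψ (η α ω)) * RPC.weight X α ω)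
        (fun ω => Real.exp (RPC.psiLevel x q ψ 0 0) * ∑' α, RPC.weight X α ω)
        μ μ) ∧
    -- in general it is a function of one independent standard normal variable
    IdentDistrib
      (fun ω => RPC.config q fun α => Real.exp (ψ (η α ω)) * RPC.weight X α ω)
      (fun p : Ω × ℝ => RPC.config q fun α =>
        Real.exp (RPC.psiLevel x q ψ 0 (Real.sqrt (q 0) * p.2)) * RPC.weight X α p.1)
      μ (μ.prod (gaussianReal 0 1)) ∧
    -- in every case the relative weights are stationary
    IdentDistrib
      (fun ω => RPC.config q fun α => Real.exp (ψ (η α ω)) * RPC.weight X α ω /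
        ∑' β, Real.exp (ψ (η β ω)) * RPC.weight X β ω)
      (fun ω => RPC.config q fun α => RPC.weight X α ω / ∑' β, RPC.weight X β ω)
      μ μ := by
  -- For positive depth the set of addresses is infinite, so every rank is attained.
  have : NeZero k := ⟨by omega⟩
  have hlaw := hX.sameTreeLaw hx0 hq.monotone hq0 hη_meas hη hη_mean hη_cov hη_indep hψ
  have hwm : ∀ α, Measurable fun ω => RPC.weight X α ω := fun α =>
    (measurable_pi_apply α).comp hX.measurable_weight
  have hψm : Measurable ψ := hψ.continuous.measurable
  have hψ0 : Measurable (RPC.psiLevel x q ψ 0) :=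
    (RPC.lipschitzWith_psiLevel hx0 q hψ 0).continuous.measurable
  have hU : Measurable fun ω α => Real.exp (ψ (η α ω)) * RPC.weight X α ω :=
    measurable_pi_lambda _ fun α => (Real.measurable_exp.comp (hψm.comp (hη_meas α))).mul (hwm α)
  have hV : Measurable fun (p : Ω × ℝ) α =>
      Real.exp (RPC.psiLevel x q ψ 0 (Real.sqrt (q 0) * p.2)) * RPC.weight X α p.1 :=
    measurable_pi_lambda _ fun α =>
      (Real.measurable_exp.comp (hψ0.comp (measurable_snd.const_mul _))).mul
        ((hwm α).comp measurable_fst)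
  have hW := hX.ae_wellOrdered_weight hx hx0 hx1
  have hWV : ∀ᵐ p ∂μ.prod (gaussianReal 0 1), RPC.WellOrdered fun α =>
      Real.exp (RPC.psiLevel x q ψ 0 (Real.sqrt (q 0) * p.2)) * RPC.weight X α p.1 := by
    filter_upwards [Measure.quasiMeasurePreserving_fst.ae hW] with p hp
    exact hp.const_mul (Real.exp_pos _)
  refine ⟨fun j y => RPC.integrable_exp_lipschitz
    (RPC.lipschitzWith_psiLevel hx0 q hψ j.succ) _ _ _, ?_, fun hq00 => ?_, ?_, ?_⟩
  · filter_upwards [hW, hlaw.ae_wellOrdered hU hV hWV] with ω h1 h2 using ⟨h1, h2⟩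
  · have hc : ∀ {E : Type} [MeasurableSpace E] {Φ : ((Fin k → ℕ) → ℝ) → E},
        RPC.IsTreeFunctional Φ →
        IdentDistrib (fun ω => Φ fun α => Real.exp (ψ (η α ω)) * RPC.weight X α ω)
          (fun ω => Φ fun α => Real.exp (RPC.psiLevel x q ψ 0 0) * RPC.weight X α ω) μ μ := by
      intro E _ Φ hΦ
      have hm0 : Measurable fun ω α => Real.exp (RPC.psiLevel x q ψ 0 0) * RPC.weight X α ω :=
        measurable_pi_lambda _ fun α => (hwm α).const_mul _
      have hlaw0 : RPC.SameTreeLaw (fun ω α => Real.exp (ψ (η α ω)) * RPC.weight X α ω)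
          (fun ω α => Real.exp (RPC.psiLevel x q ψ 0 0) * RPC.weight X α ω) μ μ := by
        intro F hF hinv
        rw [hlaw F hF hinv]
        -- The factor no longer depends on g, which can therefore be integrated out.
        simp only [hq00, Real.sqrt_zero, zero_mul]
        exact (measurePreserving_fst (μ := μ) (ν := gaussianReal 0 1)).lintegral_comp
          (f := fun ω => F fun α => Real.exp (RPC.psiLevel x q ψ 0 0) * RPC.weight X α ω)
          (hF.comp hm0)
      exact hlaw0.identDistrib hU hm0
        (hW.mono fun ω hω => hω.const_mul (Real.exp_pos _)) hΦ
    refine ⟨hc (RPC.isTreeFunctional_config q), ?_⟩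
    simpa only [tsum_mul_left] using hc RPC.isTreeFunctional_tsum
  · exact hlaw.identDistrib hU hV hWV (RPC.isTreeFunctional_config q)
  · have hΦ := RPC.isTreeFunctional_config_relWeight q
    have h1 := hlaw.identDistrib hU hV hWV hΦ
    simp only [RPC.relWeight_const_mul (Real.exp_pos _).ne'] at h1
    -- The trivial comparison of the weights with themselves supplies the a.e. measurability of
    -- their relative configuration, needed to discard the coordinate g.
    have hself : RPC.SameTreeLaw (fun ω α => RPC.weight X α ω) (fun ω α => RPC.weight X α ω) μ μ :=
      fun _ _ _ => rfl
    exact h1.trans (RPC.identDistrib_comp_fst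
      (hself.identDistrib hX.measurable_weight hX.measurable_weight hW hΦ).aemeasurable_fst)
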